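/- **Setting.** Consider the plant $x_{k+1}=Ax_k+Bu_k+w_k$, $k\ge 0$, with $x_k\in\mathbb R^n$, $u_k\in\mathbb R^m$, spectral radius $\rho(A)>1$, and zero-mean Gaussian white noise $w_k$ with positive definite covariance $R$. In each slot $k$ a half-duplex controller schedules either the sensor's transmission ($a_k=1$) or its own transmission to the actuator ($a_k=2$). These transmissions are lost, independently over time and independently of the noise, with probabilities $p_s,p_c\in(0,1)$ respectively. The initial data $(x_0,\hat x_0)$ are independent of the noise and of the packet losses. If the control packet is received in slot $k$, then $u_k=K\hat x_k$; otherwise $u_k=0$. The controller's estimate satisfies $\hat x_{k+1}=Ax_k+Bu_k$ if the sensor's packet is received in slot $k$, and $\hat x_{k+1}=A\hat x_k+Bu_k$ otherwise. The system is one-step controllable: $A+BK=0$. Define the indicators $\tau_k,\phi_k$ as follows: $\tau_{k+1}=1$ if the sensor's packet is received in slot $k$, and $\tau_{k+1}=\tau_k+1$ otherwise; $\phi_{k+1}=\tau_k+1$ if the control packet is received in slot $k$, and $\phi_{k+1}=\phi_k+1$ otherwise. Let $$\mathbb S=\{(\tau,\phi)\in\mathbb Z^2:\ \tau\ge1,\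 \phi\ge2,\ \phi\ge\tau,\ \phi\ne\tau+1\},\qquad F(\tau)=\sum_{i=1}^{\tau}A^{i-1}R(A^\top)^{i-1}.$$ The system starts with $(\tau_0,\phi_0)\in\mathbb S$, $\mathbb E[x_0x_0^\top]=F(\phi_0)$ and $\mathbb E[(x_0-\hat x_0)(x_0-\hat x_0)^\top]=F(\tau_0)$. A scheduling policy chooses $a_k\in\{1,2\}$ as a function of $(\tau_0,\phi_0),\dots,(\tau_k,\phi_k)$. Its cost is $$J=\limsup_{N\to\infty}\frac1N\sum_{k=0}^{N-1}\mathbb E[x_k^\top Qx_k],$$ with $Q$ symmetric positive definite. Assume $\max\{p_s,p_c\}<1/\rho(A)^2$. **Proposition.** Let $\pi^*$ be a stationary deterministic policy, $a_k=\pi^*(\tau_k,\phi_k)$, that minimizes $J$ over all scheduling policies. Then $\pi^*$ is of switching type: for all $(\tau,\phi)\in\mathbb S$ and all integers $z\ge1$, (i) if $\pi^*(\tau,\phi)=1$ and $(\tau+z,\phi)\in\mathbb S$, then $\pi^*(\tau+z,\phi)=1$; (ii) if $\pi^*(\tau,\phi)=2$ and $(\tau,\phi+z)\in\mathbb S$,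 then $\pi^*(\tau,\phi+z)=2$. -/

import Mathlib

open MeasureTheory ProbabilityTheory Filter
open scoped ENNReal Matrix

noncomputable section

namespace HalfDuplex

/-- The two possible decisions of the half-duplex controller in a time slot: schedule the sensor's
transmission (decision `1`) or the controller's transmission (decision `2`). -/
inductive Action where
  | sensor : Action
  | controller : Action

/-- The constant data of the networked control system: the plant matrices `A`, `B`, the controller
gain `K`, the disturbance covariance `R`, the cost weight `Q`, and the packet-error probabilities
`ps` (uplink, sensor to controller) and `pc` (downlink, controller to actuator). -/
structure System (n m : ℕ) where
  A : Matrix (Fin n) (Fin n) ℝ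
  B : Matrix (Fin n) (Fin m) ℝ
  K : Matrix (Fin m) (Fin n) ℝ
  R : Matrix (Fin n) (Fin n) ℝ
  Q : Matrix (Fin n) (Fin n) ℝ
  ps : ℝ
  pc : ℝ

/-- The spectral radius of a real square matrix: the largest modulus of its complex eigenvalues. -/
def specRadius {n : ℕ} (M : Matrix (Fin n) (Fin n) ℝ) : ℝ≥0∞ :=
  spectralRadius ℂ (M.map (algebraMap ℝ ℂ))

/-- Standing assumptions: the plant is unstable, disturbance covariance and cost weight are
positive definite, and the packet-error probabilities lie in the open unit interval. -/
structure System.Standing {n m : ℕ} (S : System n m) : Prop where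
  unstable : 1 < specRadius S.A
  posDef_R : S.R.PosDef
  posDef_Q : S.Q.PosDef
  ps_mem : S.ps ∈ Set.Ioo (0 : ℝ) 1
  pc_mem : S.pc ∈ Set.Ioo (0 : ℝ) 1

/-- The one-step controllable case. -/
def System.OneStepControllable {n m : ℕ} (S : System n m) : Prop :=
  S.A + S.B * S.K = 0

/-- The stability condition `max {ps, pc} < 1 / ρ(A)²`. -/
def System.Stabilizable {n m : ℕ} (S : System n m) : Prop :=
  ENNReal.ofReal (max S.ps S.pc) < 1 / specRadius S.A ^ 2

/-- `F(τ) = ∑_{i=1}^{τ} A^{i-1} R (Aᵀ)^{i-1}`. -/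
def System.F {n m : ℕ} (S : System n m) (τ : ℕ) : Matrix (Fin n) (Fin n) ℝ :=
  ∑ i ∈ Finset.Icc 1 τ, S.A ^ (i - 1) * S.R * S.Aᵀ ^ (i - 1)

/-- The set of states `(τ, φ)`: `τ ≥ 1`, `φ ≥ 2`, `φ ≥ τ` and `φ ≠ τ + 1`. -/
def stateSpace : Set (ℕ × ℕ) :=
  {s | 1 ≤ s.1 ∧ 2 ≤ s.2 ∧ s.1 ≤ s.2 ∧ s.2 ≠ s.1 + 1}

/-- The random primitives of the system: the initial plant state and its initial estimate, the
plant disturbances, and, for every time slot, whether a packet would be delivered on the uplink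
(`up`) and on the downlink (`down`) if it were sent in that slot. -/
structure Primitives (Ω : Type*) (n : ℕ) where
  x₀ : Ω → (Fin n → ℝ)
  xhat₀ : Ω → (Fin n → ℝ)
  w : ℕ → Ω → (Fin n → ℝ)
  up : ℕ → Ω → Bool
  down : ℕ → Ω → Bool

/-- The probabilistic assumptions on the primitives, with initial indicators `s₀ = (τ₀, φ₀)`:
`w` is zero-mean Gaussian white noise with covariance `R`; the uplink and the downlink lose packets
independently over time with probabilities `ps` and `pc`; initial data, noise and channels are
independent; the initial plant state and the initial estimation error are square-integrable with
`E[x₀ x₀ᵀ] = F(φ₀)` and `E[e₀ e₀ᵀ] = F(τ₀)`. -/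
structure Primitives.IsModel {Ω : Type*} [MeasurableSpace Ω] {n m : ℕ} (X : Primitives Ω n)
    (μ : Measure Ω) (S : System n m) (s₀ : ℕ × ℕ) : Prop where
  measurable_x₀ : Measurable X.x₀
  measurable_xhat₀ : Measurable X.xhat₀
  measurable_w : ∀ k, Measurable (X.w k)
  measurable_up : ∀ k, Measurable (X.up k)
  measurable_down : ∀ k, Measurable (X.down k)
  law_w : ∀ k, HasLaw (fun ω => WithLp.toLp 2 (X.w k ω)) (multivariateGaussian 0 S.R) μ
  prob_up : ∀ k, μ {ω | X.up k ω = false} = ENNReal.ofReal S.ps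
  prob_down : ∀ k, μ {ω | X.down k ω = false} = ENNReal.ofReal S.pc
  indep_slot : ∀ k, IndepFun (X.w k) (fun ω => (X.up k ω, X.down k ω)) μ
  indep_time : iIndepFun (fun k ω => (X.w k ω, X.up k ω, X.down k ω)) μ
  indep_init : IndepFun (fun ω => (X.x₀ ω, X.xhat₀ ω))
    (fun ω (k : ℕ) => (X.w k ω, X.up k ω, X.down k ω)) μ
  memLp_x₀ : MemLp X.x₀ 2 μ
  memLp_xhat₀ : MemLp X.xhat₀ 2 μ
  cov_x₀ : ∀ i j, ∫ ω, X.x₀ ω i * X.x₀ ω j ∂μ = S.F s₀.2 i j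
  cov_e₀ : ∀ i j,
    ∫ ω, (X.x₀ ω i - X.xhat₀ ω i) * (X.x₀ ω j - X.xhat₀ ω j) ∂μ = S.F s₀.1 i j

/-- The state of the closed loop at the beginning of a time slot: plant state `x`, its estimate
`xhat` at the controller, the estimation-quality indicator `τ` and the state-quality
indicator `φ`. -/
structure LoopState (n : ℕ) where
  x : Fin n → ℝ
  xhat : Fin n → ℝ
  τ : ℕ
  φ : ℕ

/-- One time slot of the closed loop under the decision `a`, with disturbance `w` and link
conditions `up`, `down`.  `δ` and `γ` indicate a successful sensor's and controller's transmission;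
the actuator applies `K xhat` if it receives the control packet and `0` otherwise. -/
def System.step {n m : ℕ} (S : System n m) (a : Action) (w : Fin n → ℝ) (up down : Bool)
    (s : LoopState n) : LoopState n :=
  let δ : Bool := match a with
    | Action.sensor => up
    | Action.controller => false
  let γ : Bool := match a with
    | Action.sensor => false
    | Action.controller => down
  let u : Fin m → ℝ := if γ = true then S.K *ᵥ s.xhat else 0
  { x := S.A *ᵥ s.x + S.B *ᵥ u + w
    xhat := if δ = true then S.A *ᵥ s.x + S.B *ᵥ u else S.A *ᵥ s.xhat + S.B *ᵥ u
    τ := if δ = true then 1 else s.τ + 1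
    φ := if γ = true then s.τ + 1 else s.φ + 1 }

/-- A scheduling policy chooses the decision in each slot from the past values of `(τ, φ)` (most
recent first) and the current value of `(τ, φ)`. -/
abbrev Policy : Type := List (ℕ × ℕ) → ℕ × ℕ → Action

/-- The policy given by a stationary deterministic decision rule. -/
def stationary (π : ℕ × ℕ → Action) : Policy := fun _ s => π s

/-- The closed loop under a policy: its state at time `k`, together with the values of `(τ, φ)`
at the times before `k`, most recent first. -/
def loop {Ω : Type*} {n m : ℕ} (S : System n m) (X : Primitives Ω n) (s₀ : ℕ × ℕ) (σ : Policy)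
    (ω : Ω) : ℕ → LoopState n × List (ℕ × ℕ)
  | 0 => (⟨X.x₀ ω, X.xhat₀ ω, s₀.1, s₀.2⟩, [])
  | k + 1 =>
    let c := loop S X s₀ σ ω k
    let s : ℕ × ℕ := (c.1.τ, c.1.φ)
    (S.step (σ c.2 s) (X.w k ω) (X.up k ω) (X.down k ω) c.1, s :: c.2)

/-- The expected quadratic cost `E[x_kᵀ Q x_k]` at time `k`. -/
def stageCost {Ω : Type*} [MeasurableSpace Ω] {n m : ℕ} (S : System n m) (X : Primitives Ω n)
    (μ : Measure Ω) (s₀ : ℕ × ℕ) (σ : Policy) (k : ℕ) : ℝ≥0∞ :=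
  ∫⁻ ω, ENNReal.ofReal
    ((loop S X s₀ σ ω k).1.x ⬝ᵥ (S.Q *ᵥ (loop S X s₀ σ ω k).1.x)) ∂μ

/-- The long-term average cost `J = limsup_K (1/K) ∑_{k<K} E[x_kᵀ Q x_k]`. -/
def averageCost {Ω : Type*} [MeasurableSpace Ω] {n m : ℕ} (S : System n m) (X : Primitives Ω n)
    (μ : Measure Ω) (s₀ : ℕ × ℕ) (σ : Policy) : ℝ≥0∞ :=
  limsup (fun N : ℕ => (∑ k ∈ Finset.range N, stageCost S X μ s₀ σ k) / (N : ℝ≥0∞)) atTop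

/-- A policy is optimal if it minimizes the long-term average cost over all policies. -/
def IsOptimal {Ω : Type*} [MeasurableSpace Ω] {n m : ℕ} (S : System n m) (X : Primitives Ω n)
    (μ : Measure Ω) (s₀ : ℕ × ℕ) (σ : Policy) : Prop :=
  ∀ σ' : Policy, averageCost S X μ s₀ σ ≤ averageCost S X μ s₀ σ'

end HalfDuplex

end

/-!
A scheduling problem over two indicators, solved by average-cost dynamic programming.

*Reduction.* Since `A + B K = 0`, a received control packet replaces the plant state by the
estimation error, a received sensor packet resets that error, and every slot applies `A` and adds
noise. Hence, given the indicators, the plant state has second moment `F(φ)` and the estimation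
error has second moment `F(τ)` (`hasSecondMoment_closedLoop`). The cost of a stationary rule is
therefore that of a Markov chain on pairs `(τ, φ)` with stage cost `c(φ) = tr (Q F(φ))`
(`stageCost_stationary`). Instability of `A` makes the increments of `c` bounded below, and the
stability condition makes `c` grow more slowly than the loss probabilities decay
(`System.exists_costBounds`).

*Optimality equation.* A Lyapunov function for one particular rule (`CostBounds.exists_lyapunov`)
bounds discounted values relative to the state `(2, 2)` uniformly in the discount factor. The limit
of these relative values is a solution `(g, h)` of the average-cost optimality equation
(`CostBounds.exists_optimality_equation`), and rules that are greedy for `h` have average cost at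
most `g`. The solution inherits the invariants of value iteration collected in `Regular`. They
imply that the advantage of the controller over the sensor, the difference of the two one-slot
values, is strictly decreasing in `τ` and strictly increasing in `φ`. So decisions that are
optimal with respect to `h` are of switching type.

*From average optimality to optimality in every state.* An average-optimal rule could deviate from
the optimality equation in states that it rarely visits. It does not, because every state is
visited a positive fraction of the time, along suitable horizons
(`IsRelativeValue.action_optimal`). From any frequently visited state the rule must reach `(1, φ)`
for some `φ`, then `(2, 2)`, then the diagonal by packet losses, all `(1, φ)` by sensing on the
diagonal, and the remaining states by packet losses. Sensing on the diagonal requires the sensor to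
be strictly better than the controller there (`IsRelativeValue.advantage_diag_neg`). If it were not,
interchanging a sensor slot and a controller slot (`IsRelativeValue.exchange`) would make the
controller strictly better in a state `(1, a)` where the sensor is optimal.
-/

noncomputable section

namespace HalfDuplex

/-! ### The Bellman operator and its invariants -/

/-- Expected value of `h` after a slot in which the sensor is scheduled in state `(τ, φ)`. -/
def sensorValue (ps : ℝ) (h : ℕ → ℕ → ℝ) (τ φ : ℕ) : ℝ :=
  ps * h (τ + 1) (φ + 1) + (1 - ps) * h 1 (φ + 1)

/-- Expected value of `h` after a slot in which the controller is scheduled in state `(τ, φ)`. -/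
def controllerValue (pc : ℝ) (h : ℕ → ℕ → ℝ) (τ φ : ℕ) : ℝ :=
  pc * h (τ + 1) (φ + 1) + (1 - pc) * h (τ + 1) (τ + 1)

/-- The advantage of the controller over the sensor: it is nonnegative exactly when scheduling the
controller is at least as good as scheduling the sensor, if `h` is the value of the next state. -/
def advantage (ps pc : ℝ) (h : ℕ → ℕ → ℝ) (τ φ : ℕ) : ℝ :=
  sensorValue ps h τ φ - controllerValue pc h τ φ

/-- The Bellman operator with discount factor `α` and stage cost `c φ`. -/
def bellman (ps pc α : ℝ) (c : ℕ → ℝ) (h : ℕ → ℕ → ℝ) (τ φ : ℕ) : ℝ :=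
  c φ + α * min (sensorValue ps h τ φ) (controllerValue pc h τ φ)

/-- The invariants of value iteration: monotonicity in both indicators, increasing differences, and
two inequalities which say that `advantage ps pc h` is antitone in `τ` and monotone in `φ`. All
pairs of natural numbers are admitted, not only those in `stateSpace`; the Bellman operator is
defined for all of them, and this spares the boundary cases. -/
structure Regular (ps pc : ℝ) (h : ℕ → ℕ → ℝ) : Prop where
  mono_left : ∀ τ φ, h τ φ ≤ h (τ + 1) φ
  mono_right : ∀ τ φ, h τ φ ≤ h τ (φ + 1)
  supermod : ∀ τ φ, h (τ + 1) φ + h τ (φ + 1) ≤ h (τ + 1) (φ + 1) + h τ φ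
  left_le : ∀ τ φ, (ps - pc) * (h (τ + 1) φ - h τ φ) ≤ (1 - pc) * (h (τ + 1) (τ + 1) - h τ τ)
  right_le : ∀ τ φ, (pc - ps) * (h τ (φ + 1) - h τ φ) ≤ (1 - ps) * (h 1 (φ + 1) - h 1 φ)

section Bellman

variable {ps pc α : ℝ} {c : ℕ → ℝ} {h : ℕ → ℕ → ℝ}

lemma Regular.zero : Regular ps pc (fun _ _ => 0) := by
  constructor <;> intros <;> simp

lemma Regular.diag (H : Regular ps pc h) (τ : ℕ) : h τ τ ≤ h (τ + 1) (τ + 1) :=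
  (H.mono_left τ τ).trans (H.mono_right _ _)

lemma Regular.le_left (H : Regular ps pc h) {τ τ' : ℕ} (hτ : τ ≤ τ') (φ : ℕ) :
    h τ φ ≤ h τ' φ :=
  monotone_nat_of_le_succ (f := fun τ => h τ φ) (fun τ => H.mono_left τ φ) hτ

lemma Regular.le_right (H : Regular ps pc h) (τ : ℕ) {φ φ' : ℕ} (hφ : φ ≤ φ') :
    h τ φ ≤ h τ φ' :=
  monotone_nat_of_le_succ (f := h τ) (fun φ => H.mono_right τ φ) hφ

lemma Regular.mono (H : Regular ps pc h) {τ τ' φ φ' : ℕ} (hτ : τ ≤ τ') (hφ : φ ≤ φ') :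
    h τ φ ≤ h τ' φ' :=
  (H.le_left hτ φ).trans (H.le_right τ' hφ)

/-- Either decision passes the diagonal increment on with probability at least `ps`. -/
lemma Regular.bellman_diag (H : Regular ps pc h) (hps : ps ∈ Set.Ioo (0 : ℝ) 1) (hα : 0 ≤ α)
    (τ : ℕ) :
    c (τ + 1) - c τ + α * (ps * (h (τ + 2) (τ + 2) - h (τ + 1) (τ + 1))) ≤
      bellman ps pc α c h (τ + 1) (τ + 1) - bellman ps pc α c h τ τ := by
  have h1 := H.diag (τ + 1)
  have h2 := H.mono_right 1 (τ + 1)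
  have key : ps * (h (τ + 2) (τ + 2) - h (τ + 1) (τ + 1)) +
      min (sensorValue ps h τ τ) (controllerValue pc h τ τ) ≤
      min (sensorValue ps h (τ + 1) (τ + 1)) (controllerValue pc h (τ + 1) (τ + 1)) := by
    refine le_min ?_ ?_
    · refine (add_le_add_right (min_le_left _ _) _).trans ?_
      simp only [sensorValue]
      nlinarith [hps.2]
    · refine (add_le_add_right (min_le_right _ _) _).trans ?_
      simp only [controllerValue]
      nlinarith [hps.2]
  simp only [bellman]
  nlinarith [mul_le_mul_of_nonneg_left key hα]

lemma Regular.bellman_mono_left (H : Regular ps pc h) (hps : ps ∈ Set.Ioo (0 : ℝ) 1)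
    (hpc : pc ∈ Set.Ioo (0 : ℝ) 1) (hα : 0 ≤ α) (τ φ : ℕ) :
    bellman ps pc α c h τ φ ≤ bellman ps pc α c h (τ + 1) φ := by
  have h1 := H.mono_left (τ + 1) (φ + 1)
  have h2 := H.diag (τ + 1)
  simp only [bellman]
  gcongr
  · simp only [sensorValue]
    nlinarith [hps.1]
  · simp only [controllerValue]
    nlinarith [hpc.1, hpc.2]

/-- The increments of the value in `φ` are at least those of the stage cost. -/
lemma Regular.bellman_right (H : Regular ps pc h) (hps : ps ∈ Set.Ioo (0 : ℝ) 1)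
    (hpc : pc ∈ Set.Ioo (0 : ℝ) 1) (hα : 0 ≤ α) (τ φ : ℕ) :
    c (φ + 1) - c φ ≤ bellman ps pc α c h τ (φ + 1) - bellman ps pc α c h τ φ := by
  have h1 := H.mono_right (τ + 1) (φ + 1)
  have h2 := H.mono_right 1 (φ + 1)
  have key : min (sensorValue ps h τ φ) (controllerValue pc h τ φ) ≤
      min (sensorValue ps h τ (φ + 1)) (controllerValue pc h τ (φ + 1)) := by
    gcongr
    · simp only [sensorValue]
      nlinarith [hps.1, hps.2]
    · simp only [controllerValue]
      nlinarith [hpc.1]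
  simp only [bellman]
  nlinarith [mul_le_mul_of_nonneg_left key hα]

/-- With a fresh estimate (`τ = 1`), either decision passes the increment in `φ` on with weight at
least `pc`, by increasing differences. -/
lemma Regular.bellman_right_one (H : Regular ps pc h) (hps : ps ∈ Set.Ioo (0 : ℝ) 1)
    (hpc : pc ∈ Set.Ioo (0 : ℝ) 1) (hα : 0 ≤ α) (φ : ℕ) :
    c (φ + 1) - c φ + α * (pc * (h 1 (φ + 2) - h 1 (φ + 1))) ≤
      bellman ps pc α c h 1 (φ + 1) - bellman ps pc α c h 1 φ := by
  have h1 := H.supermod 1 (φ + 1)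
  have h2 := H.mono_right 1 (φ + 1)
  have key : pc * (h 1 (φ + 2) - h 1 (φ + 1)) +
      min (sensorValue ps h 1 φ) (controllerValue pc h 1 φ) ≤
      min (sensorValue ps h 1 (φ + 1)) (controllerValue pc h 1 (φ + 1)) := by
    refine le_min ?_ ?_
    · refine (add_le_add_right (min_le_left _ _) _).trans ?_
      simp only [sensorValue]
      nlinarith [hps.1, hpc.2]
    · refine (add_le_add_right (min_le_right _ _) _).trans ?_
      simp only [controllerValue]
      nlinarith [hpc.1]
  simp only [bellman]
  nlinarith [mul_le_mul_of_nonneg_left key hα]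

/-- The strict form of `Regular.left_le` after one step of value iteration. If the sensor has
the less reliable link, the larger `τ` copies the decision that is best for the smaller `τ`: a
received sensor packet cancels the difference, and a received control packet moves it to the
diagonal. -/
lemma Regular.bellman_left_le (H : Regular ps pc h) (hps : ps ∈ Set.Ioo (0 : ℝ) 1)
    (hpc : pc ∈ Set.Ioo (0 : ℝ) 1) (hα : 0 ≤ α) (τ φ : ℕ) :
    (ps - pc) * (bellman ps pc α c h (τ + 1) φ - bellman ps pc α c h τ φ) +
      (1 - pc) * (c (τ + 1) - c τ) ≤
      (1 - pc) * (bellman ps pc α c h (τ + 1) (τ + 1) - bellman ps pc α c h τ τ) := by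
  have hd := H.bellman_diag (pc := pc) (c := c) hps hα τ
  have hd' := mul_le_mul_of_nonneg_left hd (sub_nonneg.2 hpc.2.le)
  have hH := H.diag (τ + 1)
  refine le_trans ?_ hd'
  rcases le_or_gt ps pc with hle | hlt
  · have hm := H.bellman_mono_left (c := c) hps hpc hα τ φ
    have h1 : (ps - pc) * (bellman ps pc α c h (τ + 1) φ - bellman ps pc α c h τ φ) ≤ 0 :=
      mul_nonpos_of_nonpos_of_nonneg (by linarith) (by linarith)
    have h2 : 0 ≤ (1 - pc) * (α * (ps * (h (τ + 2) (τ + 2) - h (τ + 1) (τ + 1)))) :=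
      mul_nonneg (by linarith [hpc.2]) (mul_nonneg hα (mul_nonneg hps.1.le (by linarith)))
    linarith
  · have hm := H.left_le (τ + 1) (φ + 1)
    have key : (ps - pc) * (min (sensorValue ps h (τ + 1) φ) (controllerValue pc h (τ + 1) φ) -
        min (sensorValue ps h τ φ) (controllerValue pc h τ φ)) ≤
        (1 - pc) * (ps * (h (τ + 2) (τ + 2) - h (τ + 1) (τ + 1))) := by
      rcases min_choice (sensorValue ps h τ φ) (controllerValue pc h τ φ) with e | e <;> rw [e]
      · have := min_le_left (sensorValue ps h (τ + 1) φ) (controllerValue pc h (τ + 1) φ)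
        calc _ ≤ (ps - pc) * (sensorValue ps h (τ + 1) φ - sensorValue ps h τ φ) := by
              apply mul_le_mul_of_nonneg_left _ (by linarith); linarith
          _ = ps * ((ps - pc) * (h (τ + 1 + 1) (φ + 1) - h (τ + 1) (φ + 1))) := by
              simp only [sensorValue]; ring
          _ ≤ ps * ((1 - pc) * (h (τ + 2) (τ + 2) - h (τ + 1) (τ + 1))) :=
              mul_le_mul_of_nonneg_left hm hps.1.le
          _ = _ := by ring
      · have := min_le_right (sensorValue ps h (τ + 1) φ) (controllerValue pc h (τ + 1) φ)
        calc _ ≤ (ps - pc) * (controllerValue pc h (τ + 1) φ - controllerValue pc h τ φ) := by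
              apply mul_le_mul_of_nonneg_left _ (by linarith); linarith
          _ = pc * ((ps - pc) * (h (τ + 1 + 1) (φ + 1) - h (τ + 1) (φ + 1))) +
              (ps - pc) * (1 - pc) * (h (τ + 2) (τ + 2) - h (τ + 1) (τ + 1)) := by
              simp only [controllerValue]; ring
          _ ≤ pc * ((1 - pc) * (h (τ + 2) (τ + 2) - h (τ + 1) (τ + 1))) +
              (ps - pc) * (1 - pc) * (h (τ + 2) (τ + 2) - h (τ + 1) (τ + 1)) := by
              gcongr; exact hpc.1.le
          _ = _ := by ring
    simp only [bellman]
    linarith [mul_le_mul_of_nonneg_left key hα]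

/-- The strict form of `Regular.right_le` after one step of value iteration. If the controller has
the less reliable link, the larger `φ` copies the decision that is best for the smaller `φ`: a
received control packet cancels the difference, and a received sensor packet moves it to `τ = 1`. -/
lemma Regular.bellman_right_le (H : Regular ps pc h) (hps : ps ∈ Set.Ioo (0 : ℝ) 1)
    (hpc : pc ∈ Set.Ioo (0 : ℝ) 1) (hα : 0 ≤ α) (hc : Monotone c) (τ φ : ℕ) :
    (pc - ps) * (bellman ps pc α c h τ (φ + 1) - bellman ps pc α c h τ φ) +
      min (1 - ps) (1 - pc) * (c (φ + 1) - c φ) ≤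
      (1 - ps) * (bellman ps pc α c h 1 (φ + 1) - bellman ps pc α c h 1 φ) := by
  have hcφ : 0 ≤ c (φ + 1) - c φ := sub_nonneg.2 (hc (Nat.le_succ φ))
  rcases le_or_gt pc ps with hle | hlt
  · have h0 := H.bellman_right (c := c) hps hpc hα τ φ
    have h1 := mul_le_mul_of_nonneg_left (H.bellman_right (c := c) hps hpc hα 1 φ)
      (sub_nonneg.2 hps.2.le)
    have h2 : (pc - ps) * (bellman ps pc α c h τ (φ + 1) - bellman ps pc α c h τ φ) ≤ 0 :=
      mul_nonpos_of_nonpos_of_nonneg (by linarith) (by linarith)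
    have h3 := mul_le_mul_of_nonneg_right (min_le_left (1 - ps) (1 - pc)) hcφ
    linarith
  · have h1 := mul_le_mul_of_nonneg_left (H.bellman_right_one (c := c) hps hpc hα φ)
      (sub_nonneg.2 hps.2.le)
    have h3 := mul_le_mul_of_nonneg_right (min_le_right (1 - ps) (1 - pc)) hcφ
    have hn := H.right_le (τ + 1) (φ + 1)
    have key : (pc - ps) * (min (sensorValue ps h τ (φ + 1)) (controllerValue pc h τ (φ + 1)) -
        min (sensorValue ps h τ φ) (controllerValue pc h τ φ)) ≤
        (1 - ps) * (pc * (h 1 (φ + 2) - h 1 (φ + 1))) := by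
      rcases min_choice (sensorValue ps h τ φ) (controllerValue pc h τ φ) with e | e <;> rw [e]
      · have := min_le_left (sensorValue ps h τ (φ + 1)) (controllerValue pc h τ (φ + 1))
        calc _ ≤ (pc - ps) * (sensorValue ps h τ (φ + 1) - sensorValue ps h τ φ) := by
              apply mul_le_mul_of_nonneg_left _ (by linarith); linarith
          _ = ps * ((pc - ps) * (h (τ + 1) (φ + 1 + 1) - h (τ + 1) (φ + 1))) +
              (pc - ps) * (1 - ps) * (h 1 (φ + 2) - h 1 (φ + 1)) := by
              simp only [sensorValue]; ring
          _ ≤ ps * ((1 - ps) * (h 1 (φ + 2) - h 1 (φ + 1))) +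
              (pc - ps) * (1 - ps) * (h 1 (φ + 2) - h 1 (φ + 1)) := by
              gcongr; exact hps.1.le
          _ = _ := by ring
      · have := min_le_right (sensorValue ps h τ (φ + 1)) (controllerValue pc h τ (φ + 1))
        calc _ ≤ (pc - ps) * (controllerValue pc h τ (φ + 1) - controllerValue pc h τ φ) := by
              apply mul_le_mul_of_nonneg_left _ (by linarith); linarith
          _ = pc * ((pc - ps) * (h (τ + 1) (φ + 1 + 1) - h (τ + 1) (φ + 1))) := by
              simp only [controllerValue]; ring
          _ ≤ pc * ((1 - ps) * (h 1 (φ + 2) - h 1 (φ + 1))) :=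
              mul_le_mul_of_nonneg_left hn hpc.1.le
          _ = _ := by ring
    simp only [bellman]
    simp only [bellman] at h1
    linarith [mul_le_mul_of_nonneg_left key hα]

/-- Increasing differences persist. If different actions are best at `(τ, φ)` and at
`(τ + 1, φ + 1)`, the sensor is scheduled at `(τ + 1, φ)` and the controller at `(τ, φ + 1)`. -/
lemma Regular.bellman_supermod (H : Regular ps pc h) (hps : ps ∈ Set.Ioo (0 : ℝ) 1)
    (hpc : pc ∈ Set.Ioo (0 : ℝ) 1) (hα : 0 ≤ α) (τ φ : ℕ) :
    bellman ps pc α c h (τ + 1) φ + bellman ps pc α c h τ (φ + 1) ≤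
      bellman ps pc α c h (τ + 1) (φ + 1) + bellman ps pc α c h τ φ := by
  have key : min (sensorValue ps h (τ + 1) φ) (controllerValue pc h (τ + 1) φ) +
      min (sensorValue ps h τ (φ + 1)) (controllerValue pc h τ (φ + 1)) ≤
      min (sensorValue ps h (τ + 1) (φ + 1)) (controllerValue pc h (τ + 1) (φ + 1)) +
      min (sensorValue ps h τ φ) (controllerValue pc h τ φ) := by
    have a1 := min_le_left (sensorValue ps h (τ + 1) φ) (controllerValue pc h (τ + 1) φ)
    have a2 := min_le_right (sensorValue ps h (τ + 1) φ) (controllerValue pc h (τ + 1) φ)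
    have b1 := min_le_left (sensorValue ps h τ (φ + 1)) (controllerValue pc h τ (φ + 1))
    have b2 := min_le_right (sensorValue ps h τ (φ + 1)) (controllerValue pc h τ (φ + 1))
    have sm := H.supermod (τ + 1) (φ + 1)
    have hl := H.left_le (τ + 1) (φ + 1)
    have hr := H.right_le (τ + 1) (φ + 1)
    rcases min_choice (sensorValue ps h τ φ) (controllerValue pc h τ φ) with e | e <;>
    rcases min_choice (sensorValue ps h (τ + 1) (φ + 1)) (controllerValue pc h (τ + 1) (φ + 1))
      with e' | e' <;> rw [e, e']
    · refine (add_le_add a1 b1).trans ?_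
      simp only [sensorValue]
      nlinarith [mul_le_mul_of_nonneg_left sm hps.1.le]
    · refine (add_le_add a1 b2).trans ?_
      simp only [sensorValue, controllerValue]
      nlinarith [mul_le_mul_of_nonneg_left sm hpc.1.le]
    · refine (add_le_add a1 b2).trans ?_
      simp only [sensorValue, controllerValue]
      nlinarith [mul_le_mul_of_nonneg_left sm hps.1.le]
    · refine (add_le_add a2 b2).trans ?_
      simp only [controllerValue]
      nlinarith [mul_le_mul_of_nonneg_left sm hpc.1.le]
  simp only [bellman]
  linarith [mul_le_mul_of_nonneg_left key hα]

lemma Regular.bellman (H : Regular ps pc h) (hps : ps ∈ Set.Ioo (0 : ℝ) 1)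
    (hpc : pc ∈ Set.Ioo (0 : ℝ) 1) (hα : 0 ≤ α) (hc : Monotone c) :
    Regular ps pc (bellman ps pc α c h) where
  mono_left := H.bellman_mono_left hps hpc hα
  mono_right τ φ := by
    have := H.bellman_right (c := c) hps hpc hα τ φ
    have := hc (Nat.le_succ φ)
    simp only [Nat.succ_eq_add_one] at this
    linarith
  supermod := H.bellman_supermod hps hpc hα
  left_le τ φ := by
    have h1 := H.bellman_left_le (c := c) hps hpc hα τ φ
    have h2 := mul_nonneg (sub_nonneg.2 hpc.2.le) (sub_nonneg.2 (hc (Nat.le_succ τ)))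
    simp only [Nat.succ_eq_add_one] at h2
    linarith
  right_le τ φ := by
    have h1 := H.bellman_right_le hps hpc hα hc τ φ
    have h2 := mul_nonneg (le_min (sub_nonneg.2 hps.2.le) (sub_nonneg.2 hpc.2.le))
      (sub_nonneg.2 (hc (Nat.le_succ φ)))
    simp only [Nat.succ_eq_add_one] at h2
    linarith

lemma bellman_mono (hps : ps ∈ Set.Ioo (0 : ℝ) 1) (hpc : pc ∈ Set.Ioo (0 : ℝ) 1) (hα : 0 ≤ α)
    {h h' : ℕ → ℕ → ℝ} (hh : ∀ τ φ, h τ φ ≤ h' τ φ) (τ φ : ℕ) :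
    HalfDuplex.bellman ps pc α c h τ φ ≤ HalfDuplex.bellman ps pc α c h' τ φ := by
  have h1 := sub_nonneg.2 hps.2.le
  have h2 := sub_nonneg.2 hpc.2.le
  have h3 := hps.1.le
  have h4 := hpc.1.le
  simp only [HalfDuplex.bellman, sensorValue, controllerValue]
  gcongr <;> apply hh

end Bellman

/-! ### Growth of the stage cost and a Lyapunov function -/

/-- What the dynamic programming argument needs to know about the stage cost `c φ = tr (Q F(φ))`:
it starts at `0`, its increments are bounded below by `δ > 0`, and it grows at most geometrically
with a rate `r` at which both loss probabilities keep expected costs summable. -/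
structure CostBounds (ps pc : ℝ) (c : ℕ → ℝ) (δ r C : ℝ) : Prop where
  ps_mem : ps ∈ Set.Ioo (0 : ℝ) 1
  pc_mem : pc ∈ Set.Ioo (0 : ℝ) 1
  zero : c 0 = 0
  pos : 0 < δ
  increment : ∀ i, δ ≤ c (i + 1) - c i
  one_le : 1 ≤ r
  ps_mul : ps * r < 1
  pc_mul : pc * r < 1
  growth : ∀ φ j, c (φ + 1 + j) ≤ C * r ^ j * c (φ + 1)

section Limits

open scoped Topology

variable {ps pc : ℝ} {ι : Type*} {F : Filter ι} {u : ι → ℕ → ℕ → ℝ} {h : ℕ → ℕ → ℝ}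

lemma tendsto_sensorValue (hu : ∀ τ φ, Tendsto (fun i => u i τ φ) F (𝓝 (h τ φ))) (τ φ : ℕ) :
    Tendsto (fun i => sensorValue ps (u i) τ φ) F (𝓝 (sensorValue ps h τ φ)) :=
  ((hu _ _).const_mul _).add ((hu _ _).const_mul _)

lemma tendsto_controllerValue (hu : ∀ τ φ, Tendsto (fun i => u i τ φ) F (𝓝 (h τ φ))) (τ φ : ℕ) :
    Tendsto (fun i => controllerValue pc (u i) τ φ) F (𝓝 (controllerValue pc h τ φ)) :=
  ((hu _ _).const_mul _).add ((hu _ _).const_mul _)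

lemma tendsto_bellman {c : ℕ → ℝ} {α : ι → ℝ} {α₀ : ℝ} (hα : Tendsto α F (𝓝 α₀))
    (hu : ∀ τ φ, Tendsto (fun i => u i τ φ) F (𝓝 (h τ φ))) (τ φ : ℕ) :
    Tendsto (fun i => bellman ps pc (α i) c (u i) τ φ) F (𝓝 (bellman ps pc α₀ c h τ φ)) :=
  tendsto_const_nhds.add
    (hα.mul ((tendsto_sensorValue hu τ φ).min (tendsto_controllerValue hu τ φ)))

lemma Regular.of_tendsto [F.NeBot] (H : ∀ᶠ i in F, Regular ps pc (u i))
    (hu : ∀ τ φ, Tendsto (fun i => u i τ φ) F (𝓝 (h τ φ))) : Regular ps pc h where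
  mono_left _ _ := le_of_tendsto_of_tendsto (hu _ _) (hu _ _) (H.mono fun _ h => h.mono_left _ _)
  mono_right _ _ := le_of_tendsto_of_tendsto (hu _ _) (hu _ _) (H.mono fun _ h => h.mono_right _ _)
  supermod _ _ := le_of_tendsto_of_tendsto ((hu _ _).add (hu _ _)) ((hu _ _).add (hu _ _))
    (H.mono fun _ h => h.supermod _ _)
  left_le _ _ := le_of_tendsto_of_tendsto (((hu _ _).sub (hu _ _)).const_mul _)
    (((hu _ _).sub (hu _ _)).const_mul _) (H.mono fun _ h => h.left_le _ _)
  right_le _ _ := le_of_tendsto_of_tendsto (((hu _ _).sub (hu _ _)).const_mul _)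
    (((hu _ _).sub (hu _ _)).const_mul _) (H.mono fun _ h => h.right_le _ _)

lemma Regular.sub_const (H : Regular ps pc h) (b : ℝ) : Regular ps pc (fun τ φ => h τ φ - b) where
  mono_left τ φ := by linarith [H.mono_left τ φ]
  mono_right τ φ := by linarith [H.mono_right τ φ]
  supermod τ φ := by linarith [H.supermod τ φ]
  left_le τ φ := by linarith [H.left_le τ φ]
  right_le τ φ := by linarith [H.right_le τ φ]

end Limits

namespace CostBounds

variable {ps pc δ r C : ℝ} {c : ℕ → ℝ}

lemma strictMono (hc : CostBounds ps pc c δ r C) : StrictMono c :=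
  strictMono_nat_of_lt_succ fun i => by linarith [hc.increment i, hc.pos]

lemma nonneg (hc : CostBounds ps pc c δ r C) (i : ℕ) : 0 ≤ c i := by
  rw [← hc.zero]; exact hc.strictMono.monotone (Nat.zero_le i)

lemma mul_le (hc : CostBounds ps pc c δ r C) (i : ℕ) : δ * i ≤ c i := by
  induction i with
  | zero => simp [hc.zero]
  | succ i ih => push_cast; linarith [hc.increment i]

/-- A majorant of the cost, comparable to it, which grows by at most the factor `r` per step. -/
lemma exists_majorant (hc : CostBounds ps pc c δ r C) :
    ∃ b : ℕ → ℝ, (∀ φ, c φ ≤ b φ) ∧ (∀ φ, b (φ + 1) ≤ r * b φ) ∧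
      ∀ φ, 1 ≤ φ → b φ ≤ C * c φ := by
  have hr : 0 < r := lt_of_lt_of_le one_pos hc.one_le
  have hle : ∀ φ j, c (φ + 1 + j) / r ^ j ≤ C * c (φ + 1) := fun φ j => by
    rw [div_le_iff₀ (pow_pos hr j)]
    linarith [hc.growth φ j]
  have hbdd : ∀ φ, BddAbove (Set.range fun j => c (φ + j) / r ^ j) := by
    rintro (_ | φ)
    · refine ⟨max 0 (C * c 1), ?_⟩
      rintro _ ⟨_ | j, rfl⟩
      · simp [hc.zero]
      · refine le_max_of_le_right (le_trans ?_ (hle 0 j))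
        have : 0 + (j + 1) = 0 + 1 + j := by ring
        simp only [this]
        exact div_le_div_of_nonneg_left (hc.nonneg _) (pow_pos hr j)
          (pow_le_pow_right₀ hc.one_le (Nat.le_succ j))
    · refine ⟨C * c (φ + 1), ?_⟩
      rintro _ ⟨j, rfl⟩
      exact hle φ j
  refine ⟨fun φ => ⨆ j, c (φ + j) / r ^ j, fun φ => ?_, fun φ => ?_, fun φ hφ => ?_⟩
  · simpa using le_ciSup (hbdd φ) 0
  · refine ciSup_le fun j => ?_
    have := mul_le_mul_of_nonneg_left (le_ciSup (hbdd φ) (j + 1)) hr.le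
    refine le_trans (le_of_eq ?_) this
    have e : φ + 1 + j = φ + (j + 1) := by ring
    simp only [e]
    field_simp
    ring
  · obtain ⟨φ, rfl⟩ := Nat.exists_eq_add_of_le' hφ
    exact ciSup_le fun j => hle φ j

/-- A Lyapunov function for the policy that schedules the sensor on the diagonal `τ = φ` and the
controller elsewhere: it bounds the expected cost until the state `(2, 2)` is reached. -/
lemma exists_lyapunov (hc : CostBounds ps pc c δ r C) :
    ∃ (W : ℕ → ℕ → ℝ) (K : ℝ), (∀ τ φ, 0 ≤ W τ φ) ∧ W 2 2 = 0 ∧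
      (∀ τ φ, 1 ≤ τ → (τ, φ) ≠ (2, 2) →
        c φ + min (sensorValue ps W τ φ) (controllerValue pc W τ φ) ≤ W τ φ) ∧
      ∀ τ φ, 1 ≤ τ → τ ≤ φ → W τ φ ≤ K * (1 + c φ) := by
  obtain ⟨b, hb1, hb2, hb3⟩ := hc.exists_majorant
  have hb0 : ∀ φ, 0 ≤ b φ := fun φ => (hc.nonneg φ).trans (hb1 φ)
  obtain ⟨hps0, hps1⟩ := hc.ps_mem
  obtain ⟨hpc0, hpc1⟩ := hc.pc_mem
  have hr := hc.one_le
  have hs := hc.ps_mul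
  have hk := hc.pc_mul
  -- coefficients of the controller rule, of the sensor rule, and the constants
  obtain ⟨x, hx0, hx⟩ : ∃ x : ℝ, 0 ≤ x ∧ 1 + pc * r * x = x :=
    ⟨1 / (1 - pc * r), by apply div_nonneg <;> linarith, by
      have : 1 - pc * r ≠ 0 := by linarith
      field_simp; ring⟩
  obtain ⟨e, he0, he⟩ : ∃ e : ℝ, 0 ≤ e ∧ 1 + ps * r * e + (1 - ps) * (x * r) = e :=
    ⟨(1 + (1 - ps) * (x * r)) / (1 - ps * r), by
      apply div_nonneg _ (by linarith)
      have : 0 ≤ (1 - ps) * (x * r) := mul_nonneg (by linarith) (by positivity)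
      linarith, by
      have : 1 - ps * r ≠ 0 := by linarith
      field_simp; ring⟩
  obtain ⟨y, hy0, hy⟩ : ∃ y : ℝ, 0 ≤ y ∧ pc * r * y + (1 - pc) * (e * r) = y :=
    ⟨(1 - pc) * (e * r) / (1 - pc * r), by
      apply div_nonneg _ (by linarith)
      exact mul_nonneg (by linarith) (by positivity), by
      have : 1 - pc * r ≠ 0 := by linarith
      field_simp; ring⟩
  obtain ⟨C₂, hC0, hC⟩ : ∃ C₂ : ℝ, 0 ≤ C₂ ∧ pc * (y * b 2) + pc * C₂ = C₂ :=
    ⟨pc * (y * b 2) / (1 - pc), by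
      apply div_nonneg _ (by linarith)
      exact mul_nonneg hpc0.le (mul_nonneg hy0 (hb0 _)), by
      have : 1 - pc ≠ 0 := by linarith
      field_simp; ring⟩
  set V : ℕ → ℕ → ℝ := fun τ φ =>
    if τ = φ then e * b τ + C₂ else if τ = 1 then x * b φ + C₂ else x * b φ + y * b τ + C₂ with hV
  set W : ℕ → ℕ → ℝ := fun τ φ => if τ = 2 ∧ φ = 2 then 0 else V τ φ with hW
  have hV0 : ∀ τ φ, 0 ≤ V τ φ := fun τ φ => by
    have h1 := mul_nonneg he0 (hb0 τ)
    have h2 := mul_nonneg hx0 (hb0 φ)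
    have h3 := mul_nonneg hy0 (hb0 τ)
    simp only [hV]; split_ifs <;> linarith
  have hWV : ∀ τ φ, W τ φ ≤ V τ φ := fun τ φ => by
    simp only [hW]; split_ifs
    exacts [hV0 _ _, le_rfl]
  have hxr : ∀ φ, x * b (φ + 1) ≤ x * (r * b φ) := fun φ => mul_le_mul_of_nonneg_left (hb2 φ) hx0
  have hyr : ∀ φ, y * b (φ + 1) ≤ y * (r * b φ) := fun φ => mul_le_mul_of_nonneg_left (hb2 φ) hy0
  have her : ∀ φ, e * b (φ + 1) ≤ e * (r * b φ) := fun φ => mul_le_mul_of_nonneg_left (hb2 φ) he0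
  refine ⟨W, x * C + y * C + e * C + C₂, fun τ φ => ?_, by simp [hW], fun τ φ hτ hne => ?_,
    fun τ φ hτ hφ => ?_⟩
  · simp only [hW]; split_ifs
    exacts [le_rfl, hV0 _ _]
  · have hWe : W τ φ = V τ φ := by
      simp only [hW]; rw [if_neg]; simpa using hne
    rw [hWe]
    by_cases hd : τ = φ
    · subst hd
      have h1 : W (τ + 1) (τ + 1) ≤ e * b (τ + 1) + C₂ := (hWV _ _).trans (by simp [hV])
      have h2 : W 1 (τ + 1) ≤ x * b (τ + 1) + C₂ := (hWV _ _).trans (by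
        simp only [hV]; rw [if_neg (by omega)]; simp)
      have h3 : V τ τ = e * b τ + C₂ := by simp [hV]
      rw [h3]
      refine (add_le_add_right (min_le_left _ _) _).trans ?_
      simp only [sensorValue]
      calc c τ + (ps * W (τ + 1) (τ + 1) + (1 - ps) * W 1 (τ + 1))
          ≤ b τ + (ps * (e * (r * b τ) + C₂) + (1 - ps) * (x * (r * b τ) + C₂)) := by
            gcongr
            · exact hb1 τ
            · linarith [her τ]
            · linarith [hxr τ]
        _ = (1 + ps * r * e + (1 - ps) * (x * r)) * b τ + C₂ := by ring
        _ = e * b τ + C₂ := by rw [he]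
    · have h4 := min_le_right (sensorValue ps W τ φ) (controllerValue pc W τ φ)
      have h1 : W (τ + 1) (φ + 1) ≤ x * b (φ + 1) + y * b (τ + 1) + C₂ := (hWV _ _).trans (by
        simp only [hV]; rw [if_neg (by omega), if_neg (by omega)])
      refine (add_le_add_right h4 _).trans ?_
      simp only [controllerValue]
      rcases Nat.lt_or_ge 1 τ with h1τ | h1τ
      · have h2 : W (τ + 1) (τ + 1) ≤ e * b (τ + 1) + C₂ := (hWV _ _).trans (by simp [hV])
        have h3 : V τ φ = x * b φ + y * b τ + C₂ := by
          simp only [hV]; rw [if_neg hd, if_neg (by omega)]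
        rw [h3]
        calc c φ + (pc * W (τ + 1) (φ + 1) + (1 - pc) * W (τ + 1) (τ + 1))
            ≤ b φ + (pc * (x * (r * b φ) + y * (r * b τ) + C₂) +
                (1 - pc) * (e * (r * b τ) + C₂)) := by
              gcongr
              · exact hb1 φ
              · linarith [hxr φ, hyr τ]
              · linarith [her τ]
          _ = (1 + pc * r * x) * b φ + (pc * r * y + (1 - pc) * (e * r)) * b τ + C₂ := by ring
          _ = _ := by rw [hx, hy]
      · obtain rfl : τ = 1 := by omega
        have h2 : W 2 2 = 0 := by simp [hW]
        have h3 : V 1 φ = x * b φ + C₂ := by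
          simp only [hV]; rw [if_neg hd]; simp
        rw [h3]
        simp only [Nat.reduceAdd] at h1 ⊢
        rw [h2]
        calc c φ + (pc * W 2 (φ + 1) + (1 - pc) * 0)
            ≤ b φ + (pc * (x * (r * b φ) + y * b 2 + C₂) + (1 - pc) * 0) := by
              gcongr
              · exact hb1 φ
              · linarith [hxr φ]
          _ = (1 + pc * r * x) * b φ + (pc * (y * b 2) + pc * C₂) := by ring
          _ = _ := by rw [hx, hC]
  · have hcφ := hc.nonneg φ
    have h1 : b φ ≤ C * c φ := hb3 φ (hτ.trans hφ)
    have hC' : 0 ≤ C := by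
      have h2 : c 0 < c φ := hc.strictMono (by omega)
      rw [hc.zero] at h2
      by_contra hneg
      nlinarith [hb0 φ]
    have h2 : b τ ≤ C * c φ :=
      (hb3 τ hτ).trans (mul_le_mul_of_nonneg_left (hc.strictMono.monotone hφ) hC')
    have h3 : V τ φ ≤ x * b φ + y * b τ + e * b τ + C₂ := by
      have h1 := mul_nonneg he0 (hb0 τ)
      have h2 := mul_nonneg hx0 (hb0 φ)
      have h3 := mul_nonneg hy0 (hb0 τ)
      simp only [hV]; split_ifs <;> linarith
    refine (hWV τ φ).trans (h3.trans ?_)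
    have g1 := mul_le_mul_of_nonneg_left h1 hx0
    have g2 := mul_le_mul_of_nonneg_left h2 hy0
    have g3 := mul_le_mul_of_nonneg_left h2 he0
    have g4 : 0 ≤ C₂ * c φ := mul_nonneg hC0 hcφ
    have g5 : 0 ≤ x * C + y * C + e * C := by positivity
    nlinarith

end CostBounds

/-! ### The average-cost optimality equation -/

section

open scoped Topology

variable {ps pc δ r C : ℝ} {c : ℕ → ℝ}

/-- The discounted value function, as the limit of value iteration. The Lyapunov function `W`
compares it with the value of the reference state `(2, 2)`. -/
lemma CostBounds.exists_discounted (hc : CostBounds ps pc c δ r C) {W : ℕ → ℕ → ℝ} {G : ℝ}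
    (hW0 : ∀ τ φ, 0 ≤ W τ φ) (hW2 : W 2 2 = 0)
    (hW : ∀ τ φ, 1 ≤ τ → (τ, φ) ≠ (2, 2) →
      c φ + min (sensorValue ps W τ φ) (controllerValue pc W τ φ) ≤ W τ φ)
    (hG : c 2 + min (sensorValue ps W 2 2) (controllerValue pc W 2 2) ≤ G)
    {α : ℝ} (hα0 : 0 ≤ α) (hα1 : α < 1) :
    ∃ v : ℕ → ℕ → ℝ, Regular ps pc v ∧ (∀ τ φ, bellman ps pc α c v τ φ = v τ φ) ∧
      (∀ τ φ, 0 ≤ v τ φ) ∧ (∀ τ φ, 1 ≤ τ → v τ φ ≤ W τ φ + v 2 2) ∧ (1 - α) * v 2 2 ≤ G := by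
  have hps := hc.ps_mem
  have hpc := hc.pc_mem
  have hmono := hc.strictMono.monotone
  have hq0 : ∀ {h : ℕ → ℕ → ℝ}, (∀ τ φ, 0 ≤ h τ φ) → ∀ τ φ,
      0 ≤ min (sensorValue ps h τ φ) (controllerValue pc h τ φ) := fun hh τ φ => by
    have h1 := sub_nonneg.2 hps.2.le
    have h2 := sub_nonneg.2 hpc.2.le
    exact le_min (add_nonneg (mul_nonneg hps.1.le (hh _ _)) (mul_nonneg h1 (hh _ _)))
      (add_nonneg (mul_nonneg hpc.1.le (hh _ _)) (mul_nonneg h2 (hh _ _)))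
  have hG0 : 0 ≤ G := (add_nonneg (hc.nonneg 2) (hq0 hW0 2 2)).trans hG
  -- a bound by `W` plus a constant passes through the expectation over one slot
  have hshift : ∀ {h : ℕ → ℕ → ℝ} {b : ℝ}, (∀ τ φ, 1 ≤ τ → h τ φ ≤ W τ φ + b) → ∀ τ φ, 1 ≤ τ →
      min (sensorValue ps h τ φ) (controllerValue pc h τ φ) ≤
        min (sensorValue ps W τ φ) (controllerValue pc W τ φ) + b := by
    intro h b hh τ φ hτ
    have h1 := sub_nonneg.2 hps.2.le
    have h2 := sub_nonneg.2 hpc.2.le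
    rw [← min_add_add_right]
    refine min_le_min ?_ ?_
    · have e1 := mul_le_mul_of_nonneg_left (hh (τ + 1) (φ + 1) (by omega)) hps.1.le
      have e2 := mul_le_mul_of_nonneg_left (hh 1 (φ + 1) le_rfl) h1
      simp only [sensorValue]; linarith
    · have e1 := mul_le_mul_of_nonneg_left (hh (τ + 1) (φ + 1) (by omega)) hpc.1.le
      have e2 := mul_le_mul_of_nonneg_left (hh (τ + 1) (τ + 1) (by omega)) h2
      simp only [controllerValue]; linarith
  set u : ℕ → ℕ → ℕ → ℝ := fun k => (bellman ps pc α c)^[k] (fun _ _ => 0) with hu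
  have hsucc : ∀ k, u (k + 1) = bellman ps pc α c (u k) := fun k =>
    Function.iterate_succ_apply' _ _ _
  have hreg : ∀ k, Regular ps pc (u k) := fun k => by
    induction k with
    | zero => exact Regular.zero
    | succ k ih => rw [hsucc]; exact ih.bellman hps hpc hα0 hmono
  have hnn : ∀ k τ φ, 0 ≤ u k τ φ := fun k => by
    induction k with
    | zero => intro τ φ; exact le_rfl
    | succ k ih =>
      intro τ φ
      rw [hsucc]
      exact add_nonneg (hc.nonneg _) (mul_nonneg hα0 (hq0 ih _ _))
  have hstep : ∀ k τ φ, u k τ φ ≤ u (k + 1) τ φ := fun k => by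
    induction k with
    | zero => intro τ φ; exact hnn 1 τ φ
    | succ k ih =>
      intro τ φ
      rw [hsucc, hsucc (k + 1)]
      exact bellman_mono hps hpc hα0 ih τ φ
  have hα1' : 0 < 1 - α := sub_pos.2 hα1
  have hub : ∀ k τ φ, 1 ≤ τ → u k τ φ ≤ W τ φ + G / (1 - α) := fun k => by
    induction k with
    | zero =>
      intro τ φ _
      exact add_nonneg (hW0 _ _) (div_nonneg hG0 hα1'.le)
    | succ k ih =>
      intro τ φ hτ
      rw [hsucc]
      have h1 := mul_le_mul_of_nonneg_left (hshift ih τ φ hτ) hα0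
      have h2 : α * min (sensorValue ps W τ φ) (controllerValue pc W τ φ) ≤
          min (sensorValue ps W τ φ) (controllerValue pc W τ φ) :=
        mul_le_of_le_one_left (hq0 hW0 _ _) hα1.le
      have h3 : c φ + min (sensorValue ps W τ φ) (controllerValue pc W τ φ) ≤ W τ φ + G := by
        by_cases hne : (τ, φ) = (2, 2)
        · obtain ⟨rfl, rfl⟩ := Prod.mk.inj hne
          linarith [hW0 2 2]
        · linarith [hW τ φ hτ hne]
      have h4 : G + α * (G / (1 - α)) = G / (1 - α) := by field_simp; ring
      simp only [bellman]
      linarith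
  have hbdd : ∀ τ φ, BddAbove (Set.range fun k => u k τ φ) := fun τ φ => by
    refine ⟨W (τ + 1) φ + G / (1 - α), ?_⟩
    rintro _ ⟨k, rfl⟩
    exact ((hreg k).mono_left τ φ).trans (hub k _ _ (by omega))
  have htend : ∀ τ φ, Tendsto (fun k => u k τ φ) atTop (𝓝 (⨆ k, u k τ φ)) := fun τ φ =>
    tendsto_atTop_ciSup (monotone_nat_of_le_succ fun k => hstep k τ φ) (hbdd τ φ)
  set v : ℕ → ℕ → ℝ := fun τ φ => ⨆ k, u k τ φ with hv
  have huv : ∀ k τ φ, u k τ φ ≤ v τ φ := fun k τ φ => le_ciSup (hbdd τ φ) k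
  have hv0 : ∀ τ φ, 0 ≤ v τ φ := fun τ φ => (hnn 0 τ φ).trans (huv 0 τ φ)
  refine ⟨v, Regular.of_tendsto (Eventually.of_forall hreg) htend, fun τ φ => ?_, hv0,
    fun τ φ hτ => ?_, ?_⟩
  · refine tendsto_nhds_unique ?_ ((tendsto_add_atTop_iff_nat 1).2 (htend τ φ))
    simp only [hsucc]
    exact tendsto_bellman tendsto_const_nhds htend τ φ
  · refine ciSup_le fun k => ?_
    induction k generalizing τ φ with
    | zero => exact add_nonneg (hW0 _ _) (hv0 2 2)
    | succ k ih =>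
      by_cases hne : (τ, φ) = (2, 2)
      · obtain ⟨rfl, rfl⟩ := Prod.mk.inj hne
        rw [hW2, zero_add]
        exact huv _ _ _
      · rw [hsucc]
        have h1 := hshift ih τ φ hτ
        have h2 : 0 ≤ min (sensorValue ps W τ φ) (controllerValue pc W τ φ) + v 2 2 :=
          add_nonneg (hq0 hW0 _ _) (hv0 2 2)
        have h3 := mul_le_mul_of_nonneg_left h1 hα0
        have h4 := mul_le_of_le_one_left h2 hα1.le
        have h5 := hW τ φ hτ hne
        simp only [bellman]
        linarith
  · have h1 : v 2 2 ≤ W 2 2 + G / (1 - α) := ciSup_le fun k => hub k 2 2 (by omega)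
    rw [hW2, zero_add, le_div_iff₀ hα1'] at h1
    linarith

/-- `h` solves the average-cost optimality equation with optimal average cost `g`, inherits the
invariants of value iteration, is bounded below, and grows at most like the cost. -/
structure IsRelativeValue (ps pc : ℝ) (c : ℕ → ℝ) (g K : ℝ) (h : ℕ → ℕ → ℝ) : Prop where
  regular : Regular ps pc h
  bellman_eq : ∀ τ φ, bellman ps pc 1 c h τ φ = g + h τ φ
  lower : ∀ τ φ, -K ≤ h τ φ
  upper : ∀ τ φ, 1 ≤ τ → τ ≤ φ → h τ φ ≤ K * (1 + c φ)

/-- The average-cost optimality equation, solved by letting the discount factor tend to `1` along an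
ultrafilter: the relative values `v τ φ - v 2 2` are bounded uniformly in the discount factor. -/
theorem CostBounds.exists_optimality_equation (hc : CostBounds ps pc c δ r C) :
    ∃ (g K : ℝ) (h : ℕ → ℕ → ℝ), 0 ≤ g ∧ IsRelativeValue ps pc c g K h := by
  obtain ⟨W, K, hW0, hW2, hW, hK⟩ := hc.exists_lyapunov
  have hps := hc.ps_mem
  have hpc := hc.pc_mem
  set G : ℝ := c 2 + min (sensorValue ps W 2 2) (controllerValue pc W 2 2) with hG
  have hex := fun α : Set.Ico (0 : ℝ) 1 =>
    hc.exists_discounted hW0 hW2 hW (le_of_eq hG.symm) α.2.1 α.2.2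
  choose v hreg hfix hv0 hvW hvG using hex
  -- the sensor at (2, 2), and then the Lyapunov function, compare (2, 2) with (1, 3)
  set L : ℝ := (c 2 + ps * W 3 3) / (1 - ps) with hL
  have hps1 : 0 < 1 - ps := sub_pos.2 hps.2
  have hL0 : 0 ≤ L := div_nonneg (add_nonneg (hc.nonneg _) (mul_nonneg hps.1.le (hW0 _ _))) hps1.le
  have h13 : ∀ α, v α 2 2 ≤ L + v α 1 3 := fun α => by
    have h1 := hfix α 2 2
    have h2 := min_le_left (sensorValue ps (v α) 2 2) (controllerValue pc (v α) 2 2)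
    have h3 := hvW α 3 3 (by omega)
    have h4 : 0 ≤ sensorValue ps (v α) 2 2 :=
      add_nonneg (mul_nonneg hps.1.le (hv0 _ _ _)) (mul_nonneg hps1.le (hv0 _ _ _))
    have h5 : v α 2 2 ≤ c 2 + sensorValue ps (v α) 2 2 := by
      rw [← h1]
      simp only [bellman]
      have := mul_le_mul_of_nonneg_left h2 α.2.1
      have := mul_le_of_le_one_left h4 α.2.2.le
      linarith
    simp only [sensorValue, Nat.reduceAdd] at h5
    have h6 : L * (1 - ps) = c 2 + ps * W 3 3 := by rw [hL]; field_simp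
    have h7 := mul_le_mul_of_nonneg_left h3 hps.1.le
    nlinarith
  have hqmin : ∀ (α : Set.Ico (0 : ℝ) 1) (τ φ : ℕ) (b : ℝ), b ≤ v α 1 (φ + 1) →
      b ≤ v α (τ + 1) (τ + 1) → b ≤ v α (τ + 1) (φ + 1) → α * b ≤ v α τ φ := by
    intro α τ φ b h1 h2 h3
    rw [← hfix α τ φ]
    have : b ≤ min (sensorValue ps (v α) τ φ) (controllerValue pc (v α) τ φ) := by
      refine le_min ?_ ?_
      · simp only [sensorValue]
        nlinarith [hps.1]
      · simp only [controllerValue]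
        nlinarith [hpc.1, hpc.2]
    simp only [bellman]
    have := mul_le_mul_of_nonneg_left this α.2.1
    linarith [hc.nonneg φ]
  have hlow : ∀ α τ φ, -(L + 3 * G) ≤ v α τ φ - v α 2 2 := fun α τ φ => by
    obtain ⟨ha0, ha1⟩ := α.2
    have hle22 : v α 2 2 - L ≤ v α 2 2 := by linarith
    have h12 : α * (v α 2 2 - L) ≤ v α 1 2 := by
      apply hqmin
      · linarith [h13 α]
      · exact hle22
      · exact hle22.trans ((hreg α).mono_right 2 2)
    have h12' : α * (v α 2 2 - L) ≤ v α 2 2 := h12.trans ((hreg α).mono_left 1 2)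
    have h11 : α * (α * (v α 2 2 - L)) ≤ v α 1 1 := hqmin _ _ _ _ h12 h12' h12'
    have h00 : α * (α * (α * (v α 2 2 - L))) ≤ v α 0 0 := hqmin _ _ _ _ h11 h11 h11
    have hmin := (hreg α).mono (Nat.zero_le τ) (Nat.zero_le φ)
    have hg := hvG α
    have h2 : (α : ℝ) * α ≤ 1 := by nlinarith
    have h3 : (α : ℝ) * (α * α) ≤ 1 := by nlinarith
    have h4 : (1 - (α : ℝ) * (α * α)) * v α 2 2 ≤ 3 * G := by
      have : (1 - (α : ℝ) * (α * α)) * v α 2 2 =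
          (1 + α + α * α) * ((1 - α) * v α 2 2) := by ring
      rw [this]
      have hg0 : 0 ≤ (1 - (α : ℝ)) * v α 2 2 := mul_nonneg (by linarith) (hv0 _ _ _)
      exact mul_le_mul (by linarith) hg hg0 (by norm_num)
    nlinarith
  have hup : ∀ α τ φ, v α τ φ - v α 2 2 ≤ W (τ + 1) φ := fun α τ φ => by
    linarith [(hreg α).mono_left τ φ, hvW α (τ + 1) φ (by omega)]
  -- an ultrafilter of discount factors tending to one
  have hne : (comap (Subtype.val : Set.Ico (0 : ℝ) 1 → ℝ) (𝓝 1)).NeBot := by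
    rw [← mem_closure_iff_comap_neBot, closure_Ico (by norm_num)]
    exact ⟨zero_le_one, le_rfl⟩
  set U : Ultrafilter (Set.Ico (0 : ℝ) 1) :=
    Ultrafilter.of (comap (Subtype.val : Set.Ico (0 : ℝ) 1 → ℝ) (𝓝 1))
  have hα1 : Tendsto (fun α : Set.Ico (0 : ℝ) 1 => (α : ℝ)) U (𝓝 1) :=
    tendsto_comap.mono_left (Ultrafilter.of_le _)
  have hlim : ∀ (f : Set.Ico (0 : ℝ) 1 → ℝ) (a b : ℝ), (∀ α, f α ∈ Set.Icc a b) →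
      ∃ x ∈ Set.Icc a b, Tendsto f U (𝓝 x) := fun f a b hf => by
    have := (isCompact_Icc (a := a) (b := b)).ultrafilter_le_nhds (U.map f)
      (le_principal_iff.2 (mem_map.2 (univ_mem' hf)))
    exact this
  obtain ⟨g, hg0, hg⟩ := hlim (fun α => (1 - α) * v α 2 2) 0 G fun α =>
    ⟨mul_nonneg (sub_nonneg.2 α.2.2.le) (hv0 _ _ _), hvG α⟩
  have hh := fun τ φ => hlim (fun α => v α τ φ - v α 2 2) _ _ fun α => ⟨hlow α τ φ, hup α τ φ⟩
  choose h hhmem hhlim using hh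
  refine ⟨g, max K (L + 3 * G), h, hg0.1, ⟨
    Regular.of_tendsto (Eventually.of_forall fun α => (hreg α).sub_const (v α 2 2)) hhlim,
    fun τ φ => ?_, fun τ φ => ?_, fun τ φ hτ hφ => ?_⟩⟩
  · symm
    refine tendsto_nhds_unique (hg.add (hhlim τ φ)) ?_
    refine (tendsto_bellman (ps := ps) (pc := pc) (c := c) hα1 hhlim τ φ).congr fun α => ?_
    have h1 := hfix α τ φ
    have e1 : sensorValue ps (fun τ φ => v α τ φ - v α 2 2) τ φ =
        sensorValue ps (v α) τ φ - v α 2 2 := by simp only [sensorValue]; ring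
    have e2 : controllerValue pc (fun τ φ => v α τ φ - v α 2 2) τ φ =
        controllerValue pc (v α) τ φ - v α 2 2 := by simp only [controllerValue]; ring
    simp only [bellman] at h1 ⊢
    rw [e1, e2, min_sub_sub_right]
    linear_combination h1
  · linarith [(hhmem τ φ).1, le_max_right K (L + 3 * G)]
  · have h1 : h τ φ ≤ W τ φ := le_of_tendsto (hhlim τ φ)
      (Eventually.of_forall fun α => by linarith [hvW α τ φ hτ])
    have h2 := hK τ φ hτ hφ
    have h3 : K * (1 + c φ) ≤ max K (L + 3 * G) * (1 + c φ) :=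
      mul_le_mul_of_nonneg_right (le_max_left _ _) (by linarith [hc.nonneg φ])
    linarith

end

/-! ### Strict monotonicity of the advantage and its sign on the diagonal -/

section

variable {ps pc δ r C g K : ℝ} {c : ℕ → ℝ} {h : ℕ → ℕ → ℝ}

lemma IsRelativeValue.eq_min (H : IsRelativeValue ps pc c g K h) (τ φ : ℕ) :
    g + h τ φ = c φ + min (sensorValue ps h τ φ) (controllerValue pc h τ φ) := by
  rw [← H.bellman_eq, bellman, one_mul]

lemma IsRelativeValue.le_sensor (H : IsRelativeValue ps pc c g K h) (τ φ : ℕ) :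
    g + h τ φ ≤ c φ + sensorValue ps h τ φ := by
  rw [H.eq_min]; gcongr; exact min_le_left _ _

lemma IsRelativeValue.le_controller (H : IsRelativeValue ps pc c g K h) (τ φ : ℕ) :
    g + h τ φ ≤ c φ + controllerValue pc h τ φ := by
  rw [H.eq_min]; gcongr; exact min_le_right _ _

lemma IsRelativeValue.advantage_succ_left_lt (H : IsRelativeValue ps pc c g K h)
    (hc : CostBounds ps pc c δ r C) (τ φ : ℕ) :
    advantage ps pc h (τ + 1) φ < advantage ps pc h τ φ := by
  have h1 := H.regular.bellman_left_le (c := c) hc.ps_mem hc.pc_mem zero_le_one (τ + 1) (φ + 1)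
  simp only [H.bellman_eq] at h1
  have h2 : 0 < (1 - pc) * (c (τ + 1 + 1) - c (τ + 1)) :=
    mul_pos (sub_pos.2 hc.pc_mem.2) (by linarith [hc.increment (τ + 1), hc.pos])
  simp only [advantage, sensorValue, controllerValue]
  linarith

/-- The advantage of the controller increases in `φ` at a uniform rate, hence without bound. -/
lemma IsRelativeValue.advantage_succ_right (H : IsRelativeValue ps pc c g K h)
    (hc : CostBounds ps pc c δ r C) (τ φ : ℕ) :
    advantage ps pc h τ φ + min (1 - ps) (1 - pc) * δ ≤ advantage ps pc h τ (φ + 1) := by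
  have h1 := H.regular.bellman_right_le hc.ps_mem hc.pc_mem zero_le_one hc.strictMono.monotone
    (τ + 1) (φ + 1)
  simp only [H.bellman_eq] at h1
  have h2 := mul_le_mul_of_nonneg_left (hc.increment (φ + 1))
    (le_min (sub_nonneg.2 hc.ps_mem.2.le) (sub_nonneg.2 hc.pc_mem.2.le))
  simp only [advantage, sensorValue, controllerValue]
  linarith

lemma CostBounds.rate_pos (hc : CostBounds ps pc c δ r C) : 0 < min (1 - ps) (1 - pc) * δ :=
  mul_pos (lt_min (sub_pos.2 hc.ps_mem.2) (sub_pos.2 hc.pc_mem.2)) hc.pos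

lemma IsRelativeValue.advantage_strictAnti (H : IsRelativeValue ps pc c g K h)
    (hc : CostBounds ps pc c δ r C) (φ : ℕ) : StrictAnti fun τ => advantage ps pc h τ φ :=
  strictAnti_nat_of_succ_lt fun τ => H.advantage_succ_left_lt hc τ φ

lemma IsRelativeValue.advantage_strictMono (H : IsRelativeValue ps pc c g K h)
    (hc : CostBounds ps pc c δ r C) (τ : ℕ) : StrictMono (advantage ps pc h τ) :=
  strictMono_nat_of_lt_succ fun φ => by
    linarith [H.advantage_succ_right hc τ φ, hc.rate_pos]

lemma IsRelativeValue.exists_advantage_pos (H : IsRelativeValue ps pc c g K h)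
    (hc : CostBounds ps pc c δ r C) (τ φ : ℕ) :
    ∃ j, 0 < advantage ps pc h τ (φ + j) := by
  have h1 : ∀ j : ℕ, advantage ps pc h τ φ + j * (min (1 - ps) (1 - pc) * δ) ≤
      advantage ps pc h τ (φ + j) := fun j => by
    induction j with
    | zero => simp
    | succ j ih =>
      have := H.advantage_succ_right hc τ (φ + j)
      rw [← add_assoc]
      push_cast
      linarith
  obtain ⟨j, hj⟩ := exists_nat_gt (-advantage ps pc h τ φ / (min (1 - ps) (1 - pc) * δ))
  rw [div_lt_iff₀ hc.rate_pos] at hj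
  exact ⟨j, by linarith [h1 j]⟩

/-- A sequence that dominates `A` plus a discounted negative part of its successor is at least `A`,
unless its negative part outgrows the discount. -/
lemma le_of_forall_add_mul_min_le {U B : ℕ → ℝ} {A p : ℝ} (hA : 0 ≤ A) (hp : 0 ≤ p)
    (hU : ∀ j, A + p * min (U (j + 1)) 0 ≤ U j) (hB : ∀ j, -B j ≤ min (U j) 0)
    (hlim : Tendsto (fun j => p ^ j * B (j + 1)) atTop (nhds 0)) : A ≤ U 0 := by
  have h1 : ∀ j, p * min (U (j + 1)) 0 ≤ min (U j) 0 := fun j =>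
    le_min (by linarith [hU j]) (mul_nonpos_of_nonneg_of_nonpos hp (min_le_right _ _))
  have h2 : ∀ j, p ^ j * min (U (j + 1)) 0 ≤ min (U 1) 0 := fun j => by
    induction j with
    | zero => simp
    | succ j ih =>
      refine le_trans ?_ ih
      rw [pow_succ, mul_assoc]
      exact mul_le_mul_of_nonneg_left (h1 _) (pow_nonneg hp _)
  have h3 : 0 ≤ min (U 1) 0 := by
    have : Tendsto (fun j => -(p ^ j * B (j + 1))) atTop (nhds 0) := by simpa using hlim.neg
    refine le_of_tendsto this (Eventually.of_forall fun j => (le_trans ?_ (h2 j)))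
    rw [← mul_neg]
    exact mul_le_mul_of_nonneg_left (hB _) (pow_nonneg hp _)
  linarith [hU 0, mul_nonneg hp h3]

/-- Exchanging the order of a sensor slot and a controller slot in the state `(j + 1, a + j)`. If
the controller is optimal in `(1, a + j + 1)`, this bounds the advantage of the controller
in `(j + 1, a + j)` from below by its advantage in `(j + 2, a + j + 1)`, the state after failure. -/
lemma IsRelativeValue.exchange (H : IsRelativeValue ps pc c g K h)
    (hc : CostBounds ps pc c δ r C) {a j : ℕ} (ha : 0 ≤ advantage ps pc h 1 (a + j + 1)) :
    (1 - pc) * (c (a + j + 1) - g) + (1 - ps) * pc * (h 2 (a + j + 2) - h 1 (a + j + 2)) +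
      ps * (min (advantage ps pc h (j + 2) (a + j + 1)) 0 +
        (1 - pc) * (h (j + 3) (j + 3) - h 2 2)) ≤
      advantage ps pc h (j + 1) (a + j) + (1 - pc) * (h (j + 2) (j + 2) - h 2 2) := by
  have e1 : h (j + 2) (a + j + 1) = c (a + j + 1) - g + controllerValue pc h (j + 2) (a + j + 1) +
      min (advantage ps pc h (j + 2) (a + j + 1)) 0 := by
    have h1 := H.eq_min (j + 2) (a + j + 1)
    have h2 : min (sensorValue ps h (j + 2) (a + j + 1))
          (controllerValue pc h (j + 2) (a + j + 1)) =
        controllerValue pc h (j + 2) (a + j + 1) +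
          min (advantage ps pc h (j + 2) (a + j + 1)) 0 := by
      rw [← min_add_add_left, advantage]; simp
    linarith
  have e2 := H.le_sensor (j + 2) (a + j + 1)
  have e4 : g + h 1 (a + j + 1) = c (a + j + 1) + controllerValue pc h 1 (a + j + 1) := by
    rw [H.eq_min, min_eq_right (sub_nonneg.1 ha)]
  have e5 := mul_le_mul_of_nonneg_left e2 hc.pc_mem.1.le
  rw [show advantage ps pc h (j + 1) (a + j) = ps * h (j + 2) (a + j + 1) +
    (1 - ps) * h 1 (a + j + 1) -
      (pc * h (j + 2) (a + j + 1) + (1 - pc) * h (j + 2) (j + 2)) from rfl]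
  rw [show controllerValue pc h (j + 2) (a + j + 1) =
    pc * h (j + 3) (a + j + 2) + (1 - pc) * h (j + 3) (j + 3) from rfl] at e1
  rw [show sensorValue ps h (j + 2) (a + j + 1) =
    ps * h (j + 3) (a + j + 2) + (1 - ps) * h 1 (a + j + 2) from rfl] at e5
  rw [show controllerValue pc h 1 (a + j + 1) =
    pc * h 2 (a + j + 2) + (1 - pc) * h 2 2 from rfl] at e4
  linear_combination e5 - ps * e1 - (1 - ps) * e4

/-- On the diagonal `τ = φ` the sensor is strictly better.

Otherwise the value would not depend on `τ` in the states `(τ, 3)`, `1 ≤ τ ≤ 3`, and the sensor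
would be optimal in `(1, φ)` exactly for `φ ≤ a`, for some `a ≥ 3`. Then scheduling the controller
in `(1, a)`, ahead of the sensor slots that are optimal there, would be an improvement. -/
theorem IsRelativeValue.advantage_diag_neg (H : IsRelativeValue ps pc c g K h)
    (hc : CostBounds ps pc c δ r C) {τ : ℕ} (hτ : 2 ≤ τ) : advantage ps pc h τ τ < 0 := by
  obtain ⟨hps0, hps1⟩ := hc.ps_mem
  obtain ⟨hpc0, hpc1⟩ := hc.pc_mem
  have R := H.regular
  by_contra! hneg
  -- in the column `φ = τ + 1` the value does not depend on the first indicator, and by increasing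
  -- differences neither does it in the column `φ = 3`
  have hm : h (τ + 1) (τ + 1) ≤ h 1 (τ + 1) := by
    simp only [advantage, sensorValue, controllerValue] at hneg
    nlinarith
  have hsm : Monotone fun φ => h 3 φ - h 1 φ :=
    monotone_nat_of_le_succ fun φ => by linarith [R.supermod 1 φ, R.supermod 2 φ]
  have h33 : h 3 3 = h 1 3 := by
    have h1 := hsm (show 3 ≤ τ + 1 by omega)
    have h2 := R.le_left (show 3 ≤ τ + 1 by omega) (τ + 1)
    have h3 := R.le_left (show 1 ≤ 3 by omega) 3
    simp only at h1
    linarith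
  -- the sensor is optimal in `(1, τ + 1)`, hence in `(1, 3)`
  have hadv : advantage ps pc h 1 (τ + 1) ≤ 0 := by
    by_contra! hpos
    have h2 := H.eq_min (τ + 1) (τ + 1)
    have h3 := H.le_controller 1 (τ + 1)
    have h4 : sensorValue ps h 1 (τ + 1) ≤ sensorValue ps h (τ + 1) (τ + 1) := by
      simp only [sensorValue]
      nlinarith [R.le_left (show 1 + 1 ≤ τ + 1 + 1 by omega) (τ + 1 + 1)]
    have h5 : sensorValue ps h (τ + 1) (τ + 1) ≤ controllerValue pc h (τ + 1) (τ + 1) := by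
      simp only [sensorValue, controllerValue]
      nlinarith [R.le_left (show 1 ≤ τ + 1 + 1 by omega) (τ + 1 + 1)]
    rw [min_eq_left h5] at h2
    simp only [advantage] at hpos
    linarith
  have hadv3 : advantage ps pc h 1 3 ≤ 0 :=
    ((H.advantage_strictMono hc 1).monotone (show 3 ≤ τ + 1 by omega)).trans hadv
  obtain ⟨a, ha3, ha, ha'⟩ : ∃ a, 3 ≤ a ∧ advantage ps pc h 1 a ≤ 0 ∧
      ∀ φ, a < φ → 0 < advantage ps pc h 1 φ := by
    classical
    have hex := H.exists_advantage_pos hc 1 3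
    have hne : Nat.find hex ≠ 0 := fun h0 => by
      have := Nat.find_spec hex
      rw [h0] at this
      exact absurd hadv3 (not_le.2 this)
    obtain ⟨k, hk⟩ := Nat.exists_eq_succ_of_ne_zero hne
    refine ⟨3 + k, by omega, not_lt.1 (Nat.find_min hex (by omega)), fun φ hφ => ?_⟩
    refine (Nat.find_spec hex).trans_le ((H.advantage_strictMono hc 1).monotone (by omega))
  -- the optimality equations at `(2, 2)`, `(1, 3)` and `(1, a)` make the constant term of the
  -- exchange inequality positive
  have hE0 := R.mono_left 1 (a + 1)
  set E := h 2 (a + 1) - h 1 (a + 1) with hE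
  have x2 : g + h 2 2 = c 2 + h 1 3 := by
    have h1 : sensorValue ps h 2 2 = h 1 3 := by
      simp only [sensorValue, Nat.reduceAdd, h33]; ring
    have h2 : controllerValue pc h 2 2 = h 1 3 := by
      simp only [controllerValue, Nat.reduceAdd, h33]; ring
    rw [H.eq_min, h1, h2, min_self]
  have y3 : g + h 1 3 ≤ c 3 + (h 2 (a + 1) - (1 - ps) * E) := by
    have h1 := H.le_sensor 1 3
    have h2 := mul_le_mul_of_nonneg_left (R.le_right 2 (show 4 ≤ a + 1 by omega)) hps0.le
    have h3 := mul_le_mul_of_nonneg_left (R.le_right 1 (show 4 ≤ a + 1 by omega))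
      (sub_nonneg.2 hps1.le)
    simp only [sensorValue, Nat.reduceAdd] at h1
    rw [hE]
    linarith
  have hg3 : c 3 ≤ g := by
    have h1 := R.bellman_diag (pc := pc) (c := c) hc.ps_mem zero_le_one 2
    simp only [H.bellman_eq, Nat.reduceAdd, one_mul] at h1
    have h2 := mul_nonneg hps0.le (sub_nonneg.2 (R.diag 3))
    simp only [Nat.reduceAdd] at h2
    linarith
  have hca : c 2 < c (a + 1) := hc.strictMono (by omega)
  have hA : 0 < (1 - pc) * (c (a + 1) - g) + (1 - ps) * pc * E := by
    have h1 : (1 - pc) * (h 2 (a + 1) - h 2 2) ≤ (1 - ps) * E := by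
      simp only [advantage, sensorValue, controllerValue, Nat.reduceAdd] at ha
      rw [hE]
      linarith
    have h2 : (1 - pc) * (2 * g - c 2 - c 3 + (1 - ps) * E) ≤
        (1 - pc) * (h 2 (a + 1) - h 2 2) :=
      mul_le_mul_of_nonneg_left (by linarith) (sub_nonneg.2 hpc1.le)
    have h3 : 0 < (1 - pc) * (g - c 2 - c 3 + c (a + 1)) :=
      mul_pos (sub_pos.2 hpc1) (by linarith)
    linarith
  refine absurd ha (not_le.2 (hA.trans_le ?_))
  have hz0 : advantage ps pc h 1 a = advantage ps pc h (0 + 1) (a + 0) +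
      (1 - pc) * (h (0 + 2) (0 + 2) - h 2 2) := by simp
  rw [hz0]
  -- iterate the exchange along failed sensor slots; the negative part grows at most like the cost
  refine le_of_forall_add_mul_min_le (p := ps)
    (U := fun j => advantage ps pc h (j + 1) (a + j) + (1 - pc) * (h (j + 2) (j + 2) - h 2 2))
    (B := fun j => K * (1 + c (a + 1 + j)) + K) hA.le hps0.le (fun j => ?_) (fun j => ?_) ?_
  · have h1 := H.exchange hc (ha' (a + j + 1) (by omega)).le
    have h2 : c (a + 1) ≤ c (a + j + 1) := hc.strictMono.monotone (by omega)
    have h3 : E ≤ h 2 (a + j + 2) - h 1 (a + j + 2) :=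
      monotone_nat_of_le_succ (f := fun φ => h 2 φ - h 1 φ)
        (fun φ => by linarith [R.supermod 1 φ]) (show a + 1 ≤ a + j + 2 by omega)
    have h4 : 0 ≤ h (j + 3) (j + 3) - h 2 2 := sub_nonneg.2 (R.mono (by omega) (by omega))
    have h5 := mul_nonneg (sub_nonneg.2 hpc1.le) h4
    refine le_trans ?_ h1
    have e1 : a + (j + 1) = a + j + 1 := rfl
    simp only [e1, add_assoc j 1, Nat.reduceAdd]
    have h6 : min (advantage ps pc h (j + 2) (a + j + 1) +
        (1 - pc) * (h (j + 3) (j + 3) - h 2 2)) 0 ≤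
        min (advantage ps pc h (j + 2) (a + j + 1)) 0 +
          (1 - pc) * (h (j + 3) (j + 3) - h 2 2) := by
      rw [← min_add_add_right]
      exact min_le_min le_rfl (by linarith)
    have h7 := mul_le_mul_of_nonneg_left h2 (sub_nonneg.2 hpc1.le)
    have h8 := mul_le_mul_of_nonneg_left h3 (mul_nonneg (sub_nonneg.2 hps1.le) hpc0.le)
    have h9 := mul_le_mul_of_nonneg_left h6 hps0.le
    linarith
  · have h1 := H.upper (j + 2) (a + 1 + j) (by omega) (by omega)
    have h2 := H.lower 1 (a + 1 + j)
    have h3 := H.lower (j + 2) (a + 1 + j)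
    have h4 : h (j + 2) (j + 2) ≤ h (j + 2) (a + 1 + j) := R.le_right _ (by omega)
    have h5 : h 1 (a + 1 + j) ≤ h (j + 2) (a + 1 + j) := R.le_left (by omega) _
    have h6 : 0 ≤ h (j + 2) (j + 2) - h 2 2 := sub_nonneg.2 (R.mono (by omega) (by omega))
    have h7 := mul_nonneg (sub_nonneg.2 hpc1.le) h6
    have h8 := mul_nonneg (sub_nonneg.2 hpc1.le) (sub_nonneg.2 h4)
    have h9 := mul_nonneg hps0.le (sub_nonneg.2 h5)
    refine le_min ?_ (by linarith)
    have e1 : a + j + 1 = a + 1 + j := by ring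
    simp only [advantage, sensorValue, controllerValue, add_assoc j 1, Nat.reduceAdd, e1]
    linarith
  · have hpr : Tendsto (fun j : ℕ => ps ^ j) atTop (nhds 0) :=
      tendsto_pow_atTop_nhds_zero_of_lt_one hps0.le hps1
    have hr0 : 0 ≤ ps * r := mul_nonneg hps0.le (zero_le_one.trans hc.one_le)
    have hprr : Tendsto (fun j : ℕ => (ps * r) ^ j) atTop (nhds 0) :=
      tendsto_pow_atTop_nhds_zero_of_lt_one hr0 hc.ps_mul
    have hcz : Tendsto (fun j : ℕ => ps ^ j * c (a + 1 + (j + 1))) atTop (nhds 0) := by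
      have h1 : Tendsto (fun j : ℕ => (ps * r) ^ j * (C * c (a + 2))) atTop (nhds 0) := by
        simpa using hprr.mul_const (C * c (a + 2))
      refine squeeze_zero (fun j => mul_nonneg (pow_nonneg hps0.le _) (hc.nonneg _))
        (fun j => ?_) h1
      have h2 := hc.growth (a + 1) j
      rw [show a + 1 + (j + 1) = a + 1 + 1 + j by ring, mul_pow]
      refine (mul_le_mul_of_nonneg_left h2 (pow_nonneg hps0.le j)).trans (le_of_eq ?_)
      ring
    have : Tendsto (fun j : ℕ => 2 * K * ps ^ j + K * (ps ^ j * c (a + 1 + (j + 1)))) atTop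
        (nhds 0) := by simpa using (hpr.const_mul (2 * K)).add (hcz.const_mul K)
    refine this.congr fun j => ?_
    ring

end

/-! ### The indicator chain of a stationary rule -/

/-- The transition operator of the indicator chain `(τ, φ)` under a stationary rule `π`: the
expectation of `f` after one slot. -/
def transition (ps pc : ℝ) (π : ℕ × ℕ → Action) : (ℕ × ℕ → ℝ) →ₗ[ℝ] (ℕ × ℕ → ℝ) where
  toFun f s := match π s with
    | Action.sensor => sensorValue ps (fun τ φ => f (τ, φ)) s.1 s.2
    | Action.controller => controllerValue pc (fun τ φ => f (τ, φ)) s.1 s.2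
  map_add' f f' := by
    ext s
    cases h : π s <;> simp only [h, sensorValue, controllerValue, Pi.add_apply] <;> ring
  map_smul' b f := by
    ext s
    cases h : π s <;>
      simp only [h, sensorValue, controllerValue, Pi.smul_apply, smul_eq_mul, RingHom.id_apply] <;>
      ring

section Chain

variable {ps pc : ℝ} {π : ℕ × ℕ → Action}

lemma transition_sensor {s : ℕ × ℕ} (hs : π s = Action.sensor) (f : ℕ × ℕ → ℝ) :
    transition ps pc π f s = sensorValue ps (fun τ φ => f (τ, φ)) s.1 s.2 := by
  simp only [transition, LinearMap.coe_mk, AddHom.coe_mk, hs]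

lemma transition_controller {s : ℕ × ℕ} (hs : π s = Action.controller) (f : ℕ × ℕ → ℝ) :
    transition ps pc π f s = controllerValue pc (fun τ φ => f (τ, φ)) s.1 s.2 := by
  simp only [transition, LinearMap.coe_mk, AddHom.coe_mk, hs]

lemma fail_mem {s : ℕ × ℕ} (hs : s ∈ stateSpace) : (s.1 + 1, s.2 + 1) ∈ stateSpace := by
  simp only [stateSpace, Set.mem_ofPred_eq] at hs ⊢; omega

lemma sensor_mem {s : ℕ × ℕ} (hs : s ∈ stateSpace) : (1, s.2 + 1) ∈ stateSpace := by
  simp only [stateSpace, Set.mem_ofPred_eq] at hs ⊢; omega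

lemma controller_mem {s : ℕ × ℕ} (hs : s ∈ stateSpace) : (s.1 + 1, s.1 + 1) ∈ stateSpace := by
  simp only [stateSpace, Set.mem_ofPred_eq] at hs ⊢; omega

lemma transition_mono (hps : ps ∈ Set.Ioo (0 : ℝ) 1) (hpc : pc ∈ Set.Ioo (0 : ℝ) 1)
    {f f' : ℕ × ℕ → ℝ} (hf : ∀ s ∈ stateSpace, f s ≤ f' s) {s : ℕ × ℕ} (hs : s ∈ stateSpace) :
    transition ps pc π f s ≤ transition ps pc π f' s := by
  have h1 := sub_nonneg.2 hps.2.le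
  have h2 := sub_nonneg.2 hpc.2.le
  have h3 := hps.1.le
  have h4 := hpc.1.le
  have h5 := hf _ (fail_mem hs)
  cases h : π s with
  | sensor =>
    rw [transition_sensor h, transition_sensor h]
    have h6 := hf _ (sensor_mem hs)
    simp only [sensorValue]
    gcongr
  | controller =>
    rw [transition_controller h, transition_controller h]
    have h6 := hf _ (controller_mem hs)
    simp only [controllerValue]
    gcongr

lemma transition_pow_mono (hps : ps ∈ Set.Ioo (0 : ℝ) 1) (hpc : pc ∈ Set.Ioo (0 : ℝ) 1) (k : ℕ)
    {f f' : ℕ × ℕ → ℝ} (hf : ∀ s ∈ stateSpace, f s ≤ f' s) {s : ℕ × ℕ} (hs : s ∈ stateSpace) :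
    (transition ps pc π ^ k) f s ≤ (transition ps pc π ^ k) f' s := by
  induction k generalizing f f' with
  | zero => simpa using hf s hs
  | succ k ih =>
    rw [pow_succ, Module.End.mul_apply, Module.End.mul_apply]
    exact ih fun t ht => transition_mono hps hpc hf ht

lemma transition_pow_const (k : ℕ) (b : ℝ) (s : ℕ × ℕ) :
    (transition ps pc π ^ k) (fun _ => b) s = b := by
  have h1 : transition ps pc π (fun _ => b) = fun _ => b := by
    ext t
    cases h : π t
    · rw [transition_sensor h, sensorValue]; ring
    · rw [transition_controller h, controllerValue]; ring
  induction k with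
  | zero => simp
  | succ k ih => rw [pow_succ, Module.End.mul_apply, h1, ih]

lemma transition_pow_nonneg (hps : ps ∈ Set.Ioo (0 : ℝ) 1) (hpc : pc ∈ Set.Ioo (0 : ℝ) 1) (k : ℕ)
    {f : ℕ × ℕ → ℝ} (hf : ∀ s ∈ stateSpace, 0 ≤ f s) {s : ℕ × ℕ} (hs : s ∈ stateSpace) :
    0 ≤ (transition ps pc π ^ k) f s := by
  rw [← transition_pow_const (ps := ps) (pc := pc) (π := π) k 0 s]
  exact transition_pow_mono hps hpc k hf hs

end Chain

section Optimality

variable {ps pc δ r C g K : ℝ} {c : ℕ → ℝ} {h : ℕ → ℕ → ℝ} {π : ℕ × ℕ → Action}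

/-- The loss incurred by the rule `π` in the state `s`, measured by the optimality equation. -/
def bellmanLoss (ps pc : ℝ) (c : ℕ → ℝ) (g : ℝ) (h : ℕ → ℕ → ℝ) (π : ℕ × ℕ → Action) :
    ℕ × ℕ → ℝ :=
  (fun s => c s.2) + transition ps pc π (fun s => h s.1 s.2) - (fun _ => g) - fun s => h s.1 s.2

lemma IsRelativeValue.loss_sensor (H : IsRelativeValue ps pc c g K h) {s : ℕ × ℕ}
    (hs : π s = Action.sensor) :
    bellmanLoss ps pc c g h π s = max 0 (advantage ps pc h s.1 s.2) := by
  have h1 := H.eq_min s.1 s.2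
  have h2 := min_add_max (sensorValue ps h s.1 s.2) (controllerValue pc h s.1 s.2)
  have h3 : max 0 (advantage ps pc h s.1 s.2) = max (sensorValue ps h s.1 s.2)
      (controllerValue pc h s.1 s.2) - controllerValue pc h s.1 s.2 := by
    rw [advantage, ← max_sub_sub_right, sub_self, max_comm]
  simp only [bellmanLoss, Pi.sub_apply, Pi.add_apply, transition_sensor hs]
  rw [h3]
  linarith

lemma IsRelativeValue.loss_controller (H : IsRelativeValue ps pc c g K h) {s : ℕ × ℕ}
    (hs : π s = Action.controller) :
    bellmanLoss ps pc c g h π s = max 0 (-advantage ps pc h s.1 s.2) := by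
  have h1 := H.eq_min s.1 s.2
  have h2 := min_add_max (sensorValue ps h s.1 s.2) (controllerValue pc h s.1 s.2)
  have h3 : max 0 (-advantage ps pc h s.1 s.2) = max (sensorValue ps h s.1 s.2)
      (controllerValue pc h s.1 s.2) - sensorValue ps h s.1 s.2 := by
    rw [advantage, ← max_sub_sub_right, sub_self, neg_sub]
  simp only [bellmanLoss, Pi.sub_apply, Pi.add_apply, transition_controller hs]
  rw [h3]
  linarith

lemma IsRelativeValue.loss_nonneg (H : IsRelativeValue ps pc c g K h) (s : ℕ × ℕ) :
    0 ≤ bellmanLoss ps pc c g h π s := by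
  cases hs : π s
  · rw [H.loss_sensor hs]; exact le_max_left _ _
  · rw [H.loss_controller hs]; exact le_max_left _ _

/-- The total expected cost equals the optimal average cost plus the accumulated losses, up to a
boundary term. -/
lemma sum_cost_eq (N : ℕ) (s : ℕ × ℕ) :
    ∑ k ∈ Finset.range N, (transition ps pc π ^ k) (fun s => c s.2) s =
      N * g + h s.1 s.2 - (transition ps pc π ^ N) (fun s => h s.1 s.2) s +
        ∑ k ∈ Finset.range N, (transition ps pc π ^ k) (bellmanLoss ps pc c g h π) s := by
  induction N with
  | zero => simp
  | succ N ih =>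
    rw [Finset.sum_range_succ, Finset.sum_range_succ, ih, pow_succ, Module.End.mul_apply]
    simp only [bellmanLoss, map_add, map_sub, Pi.add_apply, Pi.sub_apply, transition_pow_const]
    push_cast
    ring

/-- A rule that is greedy with respect to `h` has average cost at most `g`. -/
lemma IsRelativeValue.exists_greedy (H : IsRelativeValue ps pc c g K h)
    (hc : CostBounds ps pc c δ r C) :
    ∃ π : ℕ × ℕ → Action, ∀ s ∈ stateSpace, ∀ N : ℕ,
      ∑ k ∈ Finset.range N, (transition ps pc π ^ k) (fun s => c s.2) s ≤
        N * g + (h s.1 s.2 + K) := by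
  classical
  refine ⟨fun s => if advantage ps pc h s.1 s.2 ≤ 0 then Action.sensor else Action.controller,
    fun s hs N => ?_⟩
  set π : ℕ × ℕ → Action := _
  have hloss : bellmanLoss ps pc c g h π = fun _ => 0 := by
    ext t
    by_cases ht : advantage ps pc h t.1 t.2 ≤ 0
    · rw [H.loss_sensor (if_pos ht), max_eq_left ht]
    · rw [H.loss_controller (if_neg ht), max_eq_left (by linarith)]
  rw [sum_cost_eq (g := g) (h := h), hloss]
  simp only [transition_pow_const, Finset.sum_const_zero, add_zero]
  have h1 : -K ≤ (transition ps pc π ^ N) (fun s => h s.1 s.2) s := by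
    rw [← transition_pow_const (ps := ps) (pc := pc) (π := π) N (-K) s]
    exact transition_pow_mono hc.ps_mem hc.pc_mem N (fun t _ => H.lower _ _) hs
  linarith

/-- Along suitable horizons the losses of an average-optimal rule vanish on average. The horizons
are those at which the expected cost is moderate, so that the boundary term `h` is bounded. -/
lemma IsRelativeValue.exists_ultrafilter (H : IsRelativeValue ps pc c g K h)
    (hc : CostBounds ps pc c δ r C) {s : ℕ × ℕ} (hs : s ∈ stateSpace)
    (hopt : ∀ ε > 0, ∀ᶠ N : ℕ in atTop,
      ∑ k ∈ Finset.range N, (transition ps pc π ^ k) (fun s => c s.2) s ≤ (g + ε) * N) :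
    ∃ U : Ultrafilter ℕ, (U : Filter ℕ) ≤ atTop ∧ ∀ ε > 0, ∀ᶠ N : ℕ in U,
      ∑ k ∈ Finset.range N, (transition ps pc π ^ k) (bellmanLoss ps pc c g h π) s ≤ ε * N := by
  have hps := hc.ps_mem
  have hpc := hc.pc_mem
  have hc0 : ∀ k, 0 ≤ (transition ps pc π ^ k) (fun s => c s.2) s := fun k =>
    transition_pow_nonneg hps hpc k (fun t _ => hc.nonneg _) hs
  -- otherwise the average cost would eventually exceed `g + 1`
  have hfreq : ∃ᶠ N : ℕ in atTop,
      (transition ps pc π ^ N) (fun s => c s.2) s ≤ g + 3 := by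
    intro hev
    obtain ⟨M, hM⟩ := eventually_atTop.1 hev
    have h1 : ∀ j : ℕ, (g + 3) * j ≤
        ∑ k ∈ Finset.range (M + j), (transition ps pc π ^ k) (fun s => c s.2) s := fun j => by
      induction j with
      | zero => simpa using Finset.sum_nonneg fun k _ => hc0 k
      | succ j ih =>
        rw [← add_assoc, Finset.sum_range_succ]
        have := not_le.1 (hM (M + j) (by omega))
        push_cast
        linarith
    obtain ⟨N₀, hN₀⟩ := eventually_atTop.1 (hopt 1 one_pos)
    obtain ⟨j, hj⟩ := exists_nat_gt ((g + 1) * M)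
    have h2 := hN₀ (M + (j + N₀)) (by omega)
    have h3 := h1 (j + N₀)
    push_cast at h2 h3
    have hj0 : (0 : ℝ) ≤ N₀ := Nat.cast_nonneg _
    have hj1 : (0 : ℝ) ≤ j := Nat.cast_nonneg _
    nlinarith
  have hQ : ∀ n : ℕ, ∃ᶠ N : ℕ in atTop,
      ∑ k ∈ Finset.range N, (transition ps pc π ^ k) (bellmanLoss ps pc c g h π) s ≤
        1 / ((n : ℝ) + 1) * N := fun n => by
    have hε : 0 < 1 / ((n : ℝ) + 1) / 2 := by positivity
    set ε := 1 / ((n : ℝ) + 1) / 2 with hεdef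
    have hlarge : ∀ᶠ N : ℕ in atTop, |K| * (g + 4) + |h s.1 s.2| ≤ ε * N := by
      have := (tendsto_natCast_atTop_atTop (R := ℝ)).const_mul_atTop hε
      exact this.eventually_ge_atTop _
    refine (hfreq.and_eventually ((hopt ε hε).and hlarge)).mono ?_
    rintro N ⟨h1, h2, h3⟩
    have h4 := sum_cost_eq (ps := ps) (pc := pc) (c := c) (g := g) (h := h) (π := π) N s
    have h5 : (transition ps pc π ^ N) (fun s => h s.1 s.2) s ≤
        |K| * (1 + (transition ps pc π ^ N) (fun s => c s.2) s) := by
      have h6 := transition_pow_mono (π := π) hps hpc N (f := fun s => h s.1 s.2)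
        (f' := |K| • ((fun _ => 1) + fun s => c s.2)) (fun t ht => ?_) hs
      · simpa [transition_pow_const, map_add, mul_add] using h6
      · have h7 := H.upper t.1 t.2 ht.1 ht.2.2.1
        have h8 : K * (1 + c t.2) ≤ |K| * (1 + c t.2) :=
          mul_le_mul_of_nonneg_right (le_abs_self K) (by linarith [hc.nonneg t.2])
        simpa using h7.trans h8
    have h9 := mul_le_mul_of_nonneg_left h1 (abs_nonneg K)
    have h10 := neg_abs_le (h s.1 s.2)
    have h11 : 1 / ((n : ℝ) + 1) = 2 * ε := by rw [hεdef]; ring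
    rw [h11]
    linarith
  obtain ⟨N, hNmono, hN⟩ := extraction_forall_of_frequently hQ
  refine ⟨Ultrafilter.of (map N atTop), (Ultrafilter.of_le _).trans hNmono.tendsto_atTop,
    fun ε hε => Ultrafilter.of_le _ ?_⟩
  obtain ⟨n₀, hn₀⟩ := exists_nat_one_div_lt hε
  refine mem_map.2 (mem_of_superset (Ici_mem_atTop n₀) fun n hn => ?_)
  refine (hN n).trans (mul_le_mul_of_nonneg_right (le_trans ?_ hn₀.le) (Nat.cast_nonneg _))
  have : (n₀ : ℝ) ≤ n := Nat.cast_le.2 hn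
  gcongr

end Optimality

/-! ### Recurrence under an average-optimal rule -/

section Recurrence

variable {ps pc δ r C g K : ℝ} {c : ℕ → ℝ} {h : ℕ → ℕ → ℝ} {π : ℕ × ℕ → Action}

/-- The state `t` is visited a positive fraction of the time, along the horizons selected by `U`,
when the chain starts in `s`. -/
def Recurs (ps pc : ℝ) (π : ℕ × ℕ → Action) (s : ℕ × ℕ) (U : Ultrafilter ℕ) (t : ℕ × ℕ) : Prop :=
  ∃ d > 0, ∀ᶠ N : ℕ in U,
    d * N ≤ ∑ k ∈ Finset.range N, (transition ps pc π ^ k) (Pi.single t 1) s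

lemma single_nonneg (t u : ℕ × ℕ) : (0 : ℝ) ≤ (Pi.single t 1 : ℕ × ℕ → ℝ) u := by
  rw [Pi.single_apply]; split_ifs <;> norm_num

lemma single_le_one (t u : ℕ × ℕ) : (Pi.single t 1 : ℕ × ℕ → ℝ) u ≤ 1 := by
  rw [Pi.single_apply]; split_ifs <;> norm_num

lemma Recurs.mem {s t : ℕ × ℕ} {U : Ultrafilter ℕ} (ht : Recurs ps pc π s U t)
    (hps : ps ∈ Set.Ioo (0 : ℝ) 1) (hpc : pc ∈ Set.Ioo (0 : ℝ) 1) (hU : (U : Filter ℕ) ≤ atTop)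
    (hs : s ∈ stateSpace) : t ∈ stateSpace := by
  by_contra hne
  obtain ⟨d, hd, hev⟩ := ht
  obtain ⟨N, h1, h2⟩ := (hev.and (hU (Ioi_mem_atTop 0))).exists
  have h3 : ∀ k, (transition ps pc π ^ k) (Pi.single t 1) s ≤ 0 := fun k => by
    rw [← transition_pow_const (ps := ps) (pc := pc) (π := π) k 0 s]
    refine transition_pow_mono hps hpc k (fun u hu => le_of_eq ?_) hs
    rw [Pi.single_apply, if_neg]
    rintro rfl
    exact hne hu
  have h4 : (0 : ℝ) < N := Nat.cast_pos.2 h2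
  have h5 := Finset.sum_nonpos fun k (_ : k ∈ Finset.range N) => h3 k
  have := mul_pos hd h4
  linarith

/-- Recurrence propagates along transitions of positive probability. -/
lemma Recurs.step {s t t' : ℕ × ℕ} {U : Ultrafilter ℕ} (ht : Recurs ps pc π s U t)
    (hps : ps ∈ Set.Ioo (0 : ℝ) 1) (hpc : pc ∈ Set.Ioo (0 : ℝ) 1) (hU : (U : Filter ℕ) ≤ atTop)
    (hs : s ∈ stateSpace) (hq : 0 < transition ps pc π (Pi.single t' 1) t) :
    Recurs ps pc π s U t' := by
  obtain ⟨d, hd, hev⟩ := ht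
  set q := transition ps pc π (Pi.single t' 1) t with hqdef
  have h1 : ∀ k, q * (transition ps pc π ^ k) (Pi.single t 1) s ≤
      (transition ps pc π ^ (k + 1)) (Pi.single t' 1) s := fun k => by
    rw [pow_succ, Module.End.mul_apply]
    have := transition_pow_mono (π := π) hps hpc k (f := q • Pi.single t 1)
      (f' := transition ps pc π (Pi.single t' 1)) (fun u hu => ?_) hs
    · simpa using this
    · rw [Pi.smul_apply, Pi.single_apply]
      split_ifs with hut
      · subst hut; simp [hqdef]
      · simpa using transition_pow_nonneg (π := π) hps hpc 1 (fun v _ => single_nonneg t' v) hu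
  refine ⟨q * d / 2, by positivity, ?_⟩
  have hlarge : ∀ᶠ N : ℕ in U, 1 ≤ q * d / 2 * N := hU <| by
    have := (tendsto_natCast_atTop_atTop (R := ℝ)).const_mul_atTop
      (show 0 < q * d / 2 by positivity)
    exact this.eventually_ge_atTop _
  filter_upwards [hev, hlarge] with N h2 h3
  have h4 : q * ∑ k ∈ Finset.range N, (transition ps pc π ^ k) (Pi.single t 1) s ≤
      ∑ k ∈ Finset.range N, (transition ps pc π ^ (k + 1)) (Pi.single t' 1) s := by
    rw [Finset.mul_sum]
    exact Finset.sum_le_sum fun k _ => h1 k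
  have h5 := Finset.sum_range_succ' (fun k => (transition ps pc π ^ k) (Pi.single t' 1) s) N
  rw [Finset.sum_range_succ] at h5
  have h6 : (transition ps pc π ^ N) (Pi.single t' 1) s ≤ 1 := by
    refine (transition_pow_mono hps hpc N (f' := fun _ => 1) (fun u _ => single_le_one t' u)
      hs).trans ?_
    rw [transition_pow_const]
  have h7 : 0 ≤ (transition ps pc π ^ 0) (Pi.single t' 1) s := by simpa using single_nonneg t' s
  have h8 := mul_le_mul_of_nonneg_left h2 hq.le
  linarith

lemma Recurs.fail {s t : ℕ × ℕ} {U : Ultrafilter ℕ} (ht : Recurs ps pc π s U t)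
    (hps : ps ∈ Set.Ioo (0 : ℝ) 1) (hpc : pc ∈ Set.Ioo (0 : ℝ) 1) (hU : (U : Filter ℕ) ≤ atTop)
    (hs : s ∈ stateSpace) : Recurs ps pc π s U (t.1 + 1, t.2 + 1) := by
  refine ht.step hps hpc hU hs ?_
  cases hπ : π t with
  | sensor =>
    rw [transition_sensor hπ, sensorValue]
    have := mul_nonneg (sub_nonneg.2 hps.2.le) (single_nonneg (t.1 + 1, t.2 + 1) (1, t.2 + 1))
    simp only [Pi.single_eq_same]
    linarith [hps.1]
  | controller =>
    rw [transition_controller hπ, controllerValue]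
    have := mul_nonneg (sub_nonneg.2 hpc.2.le)
      (single_nonneg (t.1 + 1, t.2 + 1) (t.1 + 1, t.1 + 1))
    simp only [Pi.single_eq_same]
    linarith [hpc.1]

lemma Recurs.sensor {s t : ℕ × ℕ} {U : Ultrafilter ℕ} (ht : Recurs ps pc π s U t)
    (hps : ps ∈ Set.Ioo (0 : ℝ) 1) (hpc : pc ∈ Set.Ioo (0 : ℝ) 1) (hU : (U : Filter ℕ) ≤ atTop)
    (hs : s ∈ stateSpace) (hπ : π t = Action.sensor) : Recurs ps pc π s U (1, t.2 + 1) := by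
  refine ht.step hps hpc hU hs ?_
  rw [transition_sensor hπ, sensorValue]
  have := mul_nonneg hps.1.le (single_nonneg (1, t.2 + 1) (t.1 + 1, t.2 + 1))
  simp only [Pi.single_eq_same]
  linarith [hps.2]

lemma Recurs.controller {s t : ℕ × ℕ} {U : Ultrafilter ℕ} (ht : Recurs ps pc π s U t)
    (hps : ps ∈ Set.Ioo (0 : ℝ) 1) (hpc : pc ∈ Set.Ioo (0 : ℝ) 1) (hU : (U : Filter ℕ) ≤ atTop)
    (hs : s ∈ stateSpace) (hπ : π t = Action.controller) :
    Recurs ps pc π s U (t.1 + 1, t.1 + 1) := by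
  refine ht.step hps hpc hU hs ?_
  rw [transition_controller hπ, controllerValue]
  have := mul_nonneg hpc.1.le (single_nonneg (t.1 + 1, t.1 + 1) (t.1 + 1, t.2 + 1))
  simp only [Pi.single_eq_same]
  linarith [hpc.2]

/-- Vanishing average loss forces zero loss in every recurrent state. -/
lemma Recurs.loss_eq_zero {s t : ℕ × ℕ} {U : Ultrafilter ℕ} (ht : Recurs ps pc π s U t)
    (H : IsRelativeValue ps pc c g K h) (hps : ps ∈ Set.Ioo (0 : ℝ) 1)
    (hpc : pc ∈ Set.Ioo (0 : ℝ) 1) (hU : (U : Filter ℕ) ≤ atTop) (hs : s ∈ stateSpace)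
    (hloss : ∀ ε > 0, ∀ᶠ N : ℕ in U,
      ∑ k ∈ Finset.range N, (transition ps pc π ^ k) (bellmanLoss ps pc c g h π) s ≤ ε * N) :
    bellmanLoss ps pc c g h π t = 0 := by
  refine le_antisymm (not_lt.1 fun hpos => ?_) (H.loss_nonneg t)
  obtain ⟨d, hd, hev⟩ := ht
  set b := bellmanLoss ps pc c g h π t with hb
  obtain ⟨N, ⟨h1, h2⟩, h3⟩ :=
    ((hev.and (hloss (b * d / 2) (by positivity))).and (hU (Ioi_mem_atTop 0))).exists
  have h4 : b * ∑ k ∈ Finset.range N, (transition ps pc π ^ k) (Pi.single t 1) s ≤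
      ∑ k ∈ Finset.range N, (transition ps pc π ^ k) (bellmanLoss ps pc c g h π) s := by
    rw [Finset.mul_sum]
    refine Finset.sum_le_sum fun k _ => ?_
    have := transition_pow_mono (π := π) hps hpc k (f := b • Pi.single t 1)
      (f' := bellmanLoss ps pc c g h π) (fun u _ => ?_) hs
    · simpa using this
    · rw [Pi.smul_apply, Pi.single_apply]
      split_ifs with hut
      · subst hut; simp [hb]
      · simpa using H.loss_nonneg u
  have h5 : (0 : ℝ) < N := Nat.cast_pos.2 h3
  have h6 := mul_le_mul_of_nonneg_left h1 hpos.le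
  have h7 : 0 < b * d * N := by positivity
  linarith

/-- If finitely many counts have a positive joint share, one of them has a positive share. -/
lemma exists_share {ι : Type*} {U : Ultrafilter ℕ} (hU : (U : Filter ℕ) ≤ atTop) {L : Finset ι}
    {f : ι → ℕ → ℝ} (hf : ∀ᶠ N : ℕ in U, (N : ℝ) / 2 ≤ ∑ t ∈ L, f t N) :
    ∃ t ∈ L, ∃ d > 0, ∀ᶠ N : ℕ in U, d * N ≤ f t N := by
  by_contra! hno
  have hd0 : (0 : ℝ) < 1 / (2 * (L.card + 1)) := by positivity
  have hd1 : (L.card : ℝ) * (1 / (2 * (L.card + 1))) < 1 / 2 := by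
    rw [mul_one_div, div_lt_div_iff₀ (by positivity) (by norm_num)]
    linarith
  generalize (1 : ℝ) / (2 * (L.card + 1)) = d at hd0 hd1
  have hall : ∀ᶠ N : ℕ in U, ∀ t ∈ L, f t N < d * N := by
    rw [Filter.eventually_all_finset]
    exact fun t ht => hno t ht d hd0
  obtain ⟨N, ⟨h1, h2⟩, h3⟩ := ((hf.and hall).and (hU (Ioi_mem_atTop 0))).exists
  have h4 : ∑ t ∈ L, f t N ≤ ∑ _t ∈ L, d * (N : ℝ) :=
    Finset.sum_le_sum fun t ht => (h2 t ht).le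
  rw [Finset.sum_const, nsmul_eq_mul] at h4
  have h5 : (0 : ℝ) < N := Nat.cast_pos.2 h3
  nlinarith

/-- Bounded average cost keeps the chain in a finite set half of the time. -/
lemma exists_recurs (hc : CostBounds ps pc c δ r C) (hg : 0 ≤ g) {s : ℕ × ℕ} (hs : s ∈ stateSpace)
    {U : Ultrafilter ℕ} (hU : (U : Filter ℕ) ≤ atTop)
    (hcost : ∀ᶠ N : ℕ in atTop,
      ∑ k ∈ Finset.range N, (transition ps pc π ^ k) (fun s => c s.2) s ≤ (g + 1) * N) :
    ∃ t, Recurs ps pc π s U t := by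
  have hps := hc.ps_mem
  have hpc := hc.pc_mem
  obtain ⟨B, hB⟩ := exists_nat_gt (2 * (g + 1) / δ)
  rw [div_lt_iff₀ hc.pos] at hB
  set L : Finset (ℕ × ℕ) := Finset.range B ×ˢ Finset.range B with hL
  set x : ℝ := 1 / (2 * (g + 1)) with hx
  have hx0 : 0 < x := by rw [hx]; positivity
  have hdom : ∀ u ∈ stateSpace,
      (1 : ℝ) ≤ ((∑ t ∈ L, Pi.single t (1 : ℝ)) + x • fun s : ℕ × ℕ => c s.2) u := fun u hu => by
    have h0 : 0 ≤ x * c u.2 := mul_nonneg hx0.le (hc.nonneg _)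
    have h0' : ∀ t ∈ L, (0 : ℝ) ≤ (Pi.single t 1 : ℕ × ℕ → ℝ) u := fun t _ => single_nonneg t u
    simp only [Pi.add_apply, Finset.sum_apply, Pi.smul_apply, smul_eq_mul]
    by_cases huL : u ∈ L
    · have h1 := Finset.single_le_sum h0' huL
      simp only [Pi.single_eq_same] at h1
      linarith
    · have h1 := Finset.sum_nonneg h0'
      have h2 : B ≤ u.2 := by
        have h3 := hu.2.2.1
        simp only [hL, Finset.mem_product, Finset.mem_range] at huL
        omega
      have h4 : 2 * (g + 1) ≤ c u.2 := by
        have h5 := hc.mul_le u.2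
        have h6 : δ * (B : ℝ) ≤ δ * u.2 := mul_le_mul_of_nonneg_left (Nat.cast_le.2 h2) hc.pos.le
        linarith
      have h7 := mul_le_mul_of_nonneg_left h4 hx0.le
      have h8 : x * (2 * (g + 1)) = 1 := by rw [hx]; field_simp
      linarith
  have hcount : ∀ᶠ N : ℕ in U, (N : ℝ) / 2 ≤
      ∑ t ∈ L, ∑ k ∈ Finset.range N, (transition ps pc π ^ k) (Pi.single t 1) s := by
    filter_upwards [hU hcost] with N hN
    have h1 : ∀ k ∈ Finset.range N, (1 : ℝ) ≤
        (∑ t ∈ L, (transition ps pc π ^ k) (Pi.single t 1) s) +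
          x * (transition ps pc π ^ k) (fun s => c s.2) s := fun k _ => by
      have h2 := transition_pow_mono (π := π) hps hpc k (f := fun _ => 1) hdom hs
      rw [transition_pow_const] at h2
      simpa using h2
    have h3 := Finset.sum_le_sum h1
    rw [Finset.sum_add_distrib, ← Finset.mul_sum, Finset.sum_comm] at h3
    simp only [Finset.sum_const, Finset.card_range, nsmul_eq_mul, mul_one] at h3
    have h4 := mul_le_mul_of_nonneg_left hN hx0.le
    have h5 : x * ((g + 1) * N) = N / 2 := by rw [hx]; field_simp
    linarith
  obtain ⟨t, _, ht⟩ := exists_share hU hcount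
  exact ⟨t, ht⟩

/-- A rule whose average cost is at most `g` never deviates from the optimality equation, in any
state: all states are recurrent under such a rule. -/
theorem IsRelativeValue.action_optimal (H : IsRelativeValue ps pc c g K h)
    (hc : CostBounds ps pc c δ r C) (hg : 0 ≤ g) {s : ℕ × ℕ} (hs : s ∈ stateSpace)
    (hopt : ∀ ε > 0, ∀ᶠ N : ℕ in atTop,
      ∑ k ∈ Finset.range N, (transition ps pc π ^ k) (fun s => c s.2) s ≤ (g + ε) * N)
    {t : ℕ × ℕ} (ht : t ∈ stateSpace) :
    (π t = Action.sensor → advantage ps pc h t.1 t.2 ≤ 0) ∧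
      (π t = Action.controller → 0 ≤ advantage ps pc h t.1 t.2) := by
  have hps := hc.ps_mem
  have hpc := hc.pc_mem
  obtain ⟨U, hU, hloss⟩ := H.exists_ultrafilter hc hs hopt
  have hact : ∀ t, Recurs ps pc π s U t →
      (π t = Action.sensor → advantage ps pc h t.1 t.2 ≤ 0) ∧
      (π t = Action.controller → 0 ≤ advantage ps pc h t.1 t.2) := fun t ht => by
    have h1 := ht.loss_eq_zero H hps hpc hU hs hloss
    refine ⟨fun hπ => ?_, fun hπ => ?_⟩
    · rw [H.loss_sensor hπ, max_eq_left_iff] at h1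
      exact h1
    · rw [H.loss_controller hπ, max_eq_left_iff] at h1
      linarith
  have hdiag : ∀ τ, 2 ≤ τ → Recurs ps pc π s U (τ, τ) → π (τ, τ) = Action.sensor := by
    intro τ hτ h1
    cases hπ : π (τ, τ) with
    | sensor => rfl
    | controller => exact absurd ((hact _ h1).2 hπ) (not_le.2 (H.advantage_diag_neg hc hτ))
  -- a recurrent state with a fresh estimate
  obtain ⟨t₀, ht₀⟩ := exists_recurs hc hg hs hU (hopt 1 one_pos)
  obtain ⟨φ₀, h₀⟩ : ∃ φ₀, Recurs ps pc π s U (1, φ₀) := by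
    cases hπ : π t₀ with
    | sensor => exact ⟨_, ht₀.sensor hps hpc hU hs hπ⟩
    | controller =>
      have h1 := ht₀.controller hps hpc hU hs hπ
      have h2 := (ht₀.mem hps hpc hU hs).1
      exact ⟨_, h1.sensor hps hpc hU hs (hdiag _ (by omega) h1)⟩
  -- repeated sensing raises `φ` until the controller must be scheduled
  have h22 : Recurs ps pc π s U (2, 2) := by
    by_contra h22
    have h1 : ∀ j, Recurs ps pc π s U (1, φ₀ + j) := fun j => by
      induction j with
      | zero => exact h₀
      | succ j ih =>
        cases hπ : π (1, φ₀ + j) with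
        | sensor => exact ih.sensor hps hpc hU hs hπ
        | controller => exact absurd (ih.controller hps hpc hU hs hπ) h22
    obtain ⟨j, hj⟩ := H.exists_advantage_pos hc 1 φ₀
    cases hπ : π (1, φ₀ + j) with
    | sensor => exact absurd ((hact _ (h1 j)).1 hπ) (not_le.2 hj)
    | controller => exact h22 ((h1 j).controller hps hpc hU hs hπ)
  have hrd : ∀ j, Recurs ps pc π s U (2 + j, 2 + j) := fun j => by
    induction j with
    | zero => exact h22
    | succ j ih => exact ih.fail hps hpc hU hs
  have hr1 : ∀ j, Recurs ps pc π s U (1, 3 + j) := fun j => by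
    have h1 := (hrd j).sensor hps hpc hU hs (hdiag _ (by omega) (hrd j))
    rwa [show 3 + j = 2 + j + 1 by ring]
  have hr : ∀ i j, Recurs ps pc π s U (1 + i, 3 + j + i) := fun i j => by
    induction i with
    | zero => exact hr1 j
    | succ i ih => exact ih.fail hps hpc hU hs
  refine hact t ?_
  obtain ⟨τ, φ⟩ := t
  obtain ⟨h1, h2, h3, h4⟩ := ht
  simp only at h1 h2 h3 h4
  rcases h3.eq_or_lt with rfl | h5
  · obtain ⟨j, rfl⟩ := Nat.exists_eq_add_of_le h2
    exact hrd j
  · obtain ⟨i, rfl⟩ := Nat.exists_eq_add_of_le h1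
    obtain ⟨j, rfl⟩ := Nat.exists_eq_add_of_le (show 3 + i ≤ φ by omega)
    rw [show 3 + i + j = 3 + j + i by ring]
    exact hr i j

/-- A rule whose average cost is at most `g` is of switching type. -/
theorem IsRelativeValue.switching (H : IsRelativeValue ps pc c g K h)
    (hc : CostBounds ps pc c δ r C) (hg : 0 ≤ g) {s : ℕ × ℕ} (hs : s ∈ stateSpace)
    (hopt : ∀ ε > 0, ∀ᶠ N : ℕ in atTop,
      ∑ k ∈ Finset.range N, (transition ps pc π ^ k) (fun s => c s.2) s ≤ (g + ε) * N) :
    (∀ τ φ z : ℕ, (τ, φ) ∈ stateSpace → π (τ, φ) = Action.sensor →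
      0 < z → (τ + z, φ) ∈ stateSpace → π (τ + z, φ) = Action.sensor) ∧
    (∀ τ φ z : ℕ, (τ, φ) ∈ stateSpace → π (τ, φ) = Action.controller →
      0 < z → (τ, φ + z) ∈ stateSpace → π (τ, φ + z) = Action.controller) := by
  have hact := fun {t : ℕ × ℕ} => H.action_optimal hc hg hs hopt (t := t)
  refine ⟨fun τ φ z h1 hπ hz h2 => ?_, fun τ φ z h1 hπ hz h2 => ?_⟩
  · have h3 : advantage ps pc h (τ + z) φ < advantage ps pc h τ φ :=
      H.advantage_strictAnti hc φ (show τ < τ + z by omega)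
    cases hπ' : π (τ + z, φ) with
    | sensor => rfl
    | controller =>
      exact absurd (h3.trans_le ((hact h1).1 hπ)) (not_lt.2 ((hact h2).2 hπ'))
  · have h3 : advantage ps pc h τ φ < advantage ps pc h τ (φ + z) :=
      H.advantage_strictMono hc τ (show φ < φ + z by omega)
    cases hπ' : π (τ, φ + z) with
    | sensor => exact absurd (((hact h1).2 hπ).trans_lt h3) (not_lt.2 ((hact h2).1 hπ'))
    | controller => rfl

end Recurrence

/-! ### Growth of the noise covariance -/

section Cost

open scoped Matrix.Norms.Frobenius MatrixOrder ComplexOrder NNReal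

variable {n m : ℕ}

lemma exists_isUnit_transpose_mul {P : Matrix (Fin n) (Fin n) ℝ} (hP : P.PosDef) :
    ∃ G : Matrix (Fin n) (Fin n) ℝ, IsUnit G ∧ P = Gᵀ * G := by
  obtain ⟨G, hG⟩ := CStarAlgebra.nonneg_iff_eq_star_mul_self.mp hP.posSemidef.nonneg
  rw [Matrix.star_eq_conjTranspose, Matrix.conjTranspose_eq_transpose_of_trivial] at hG
  refine ⟨G, ?_, hG⟩
  have h1 := hP.isUnit
  rw [hG, Matrix.isUnit_iff_isUnit_det, Matrix.det_mul] at h1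
  rw [Matrix.isUnit_iff_isUnit_det]
  exact isUnit_of_mul_isUnit_right h1

lemma frobenius_norm_sq (M : Matrix (Fin n) (Fin n) ℝ) : ‖M‖ ^ 2 = (M * Mᵀ).trace := by
  rw [Matrix.frobenius_norm_def, ← Real.sqrt_eq_rpow, Real.sq_sqrt (by positivity)]
  simp only [Matrix.trace, Matrix.diag, Matrix.mul_apply, Matrix.transpose_apply, Real.norm_eq_abs,
    Real.rpow_ofNat, sq_abs]
  simp only [sq]

/-- For positive definite `Q` and `R`, the quadratic form `M ↦ tr (Q M R Mᵀ)` is equivalent to the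
square of the Frobenius norm. -/
lemma exists_trace_bounds {Q R : Matrix (Fin n) (Fin n) ℝ} (hQ : Q.PosDef) (hR : R.PosDef) :
    ∃ l u : ℝ, 0 < l ∧ 0 ≤ u ∧ ∀ M : Matrix (Fin n) (Fin n) ℝ,
      l * ‖M‖ ^ 2 ≤ (Q * (M * R * Mᵀ)).trace ∧ (Q * (M * R * Mᵀ)).trace ≤ u * ‖M‖ ^ 2 := by
  obtain ⟨G, hG, rfl⟩ := exists_isUnit_transpose_mul hQ
  obtain ⟨J, hJ, rfl⟩ := exists_isUnit_transpose_mul hR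
  have key : ∀ M : Matrix (Fin n) (Fin n) ℝ,
      (Gᵀ * G * (M * (Jᵀ * J) * Mᵀ)).trace = ‖G * M * Jᵀ‖ ^ 2 := fun M => by
    rw [frobenius_norm_sq, Matrix.mul_assoc, Matrix.trace_mul_comm]
    congr 1
    simp only [Matrix.transpose_mul, Matrix.transpose_transpose, Matrix.mul_assoc]
  have hJ' : IsUnit Jᵀ := by
    rw [Matrix.isUnit_iff_isUnit_det, Matrix.det_transpose, ← Matrix.isUnit_iff_isUnit_det]
    exact hJ
  obtain ⟨G', hG'⟩ := hG.exists_left_inv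
  obtain ⟨J', hJ''⟩ := hJ'.exists_right_inv
  set b : ℝ := ‖G'‖ * ‖J'‖ + 1 with hb
  have hb0 : 0 < b := by positivity
  refine ⟨1 / b ^ 2, (‖G‖ * ‖Jᵀ‖) ^ 2, by positivity, by positivity, fun M => ⟨?_, ?_⟩⟩
  · rw [key, one_div_mul_eq_div, div_le_iff₀ (by positivity), ← mul_pow]
    gcongr
    calc ‖M‖ = ‖G' * (G * M * Jᵀ) * J'‖ := by
          rw [show G' * (G * M * Jᵀ) * J' = (G' * G) * M * (Jᵀ * J') by
            simp only [Matrix.mul_assoc], hG', hJ'', Matrix.one_mul, Matrix.mul_one]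
      _ ≤ ‖G'‖ * ‖G * M * Jᵀ‖ * ‖J'‖ := by
          refine (norm_mul_le _ _).trans ?_
          gcongr
          exact norm_mul_le _ _
      _ = ‖G * M * Jᵀ‖ * (‖G'‖ * ‖J'‖) := by ring
      _ ≤ ‖G * M * Jᵀ‖ * b := by gcongr; linarith
  · rw [key, ← mul_pow]
    gcongr
    calc ‖G * M * Jᵀ‖ ≤ ‖G‖ * ‖M‖ * ‖Jᵀ‖ := by
          refine (norm_mul_le _ _).trans ?_
          gcongr
          exact norm_mul_le _ _
      _ = ‖G‖ * ‖Jᵀ‖ * ‖M‖ := by ring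

lemma norm_map_pow (A : Matrix (Fin n) (Fin n) ℝ) (i : ℕ) :
    ‖(A.map (algebraMap ℝ ℂ)) ^ i‖ = ‖A ^ i‖ := by
  rw [← RingHom.mapMatrix_apply, ← map_pow, RingHom.mapMatrix_apply]
  exact Matrix.frobenius_norm_map_eq _ _ fun a => by simp

/-- The powers of an unstable matrix stay away from zero. -/
lemma exists_le_norm_pow {A : Matrix (Fin n) (Fin n) ℝ} (hA : 1 < specRadius A) :
    ∃ b > 0, ∀ i, b ≤ ‖A ^ i‖ := by
  set N : ℝ := ‖(1 : Matrix (Fin n) (Fin n) ℂ)‖ with hN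
  have hN1 : ‖(1 : Matrix (Fin n) (Fin n) ℝ)‖ = N := by
    simpa using (norm_map_pow A 0).symm
  have h1 : ∀ i, 1 ≤ ‖A ^ (i + 1)‖ * N := fun i => by
    by_contra! hlt
    have h2 := hA.trans_le
      (spectrum.spectralRadius_le_pow_nnnorm_pow_one_div ℂ (A.map (algebraMap ℝ ℂ)) i)
    rw [← ENNReal.mul_rpow_of_nonneg _ _ (by positivity)] at h2
    refine absurd h2 (not_lt.2 (ENNReal.rpow_le_one ?_ (by positivity)))
    rw [← ENNReal.coe_mul]
    have h3 : ‖(A.map (algebraMap ℝ ℂ)) ^ (i + 1)‖₊ * ‖(1 : Matrix (Fin n) (Fin n) ℂ)‖₊ ≤ 1 := by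
      rw [← NNReal.coe_le_coe]
      push_cast
      rw [norm_map_pow]
      exact hlt.le
    exact_mod_cast h3
  have hN0 : 0 < N := by
    rcases (norm_nonneg (1 : Matrix (Fin n) (Fin n) ℂ)).eq_or_lt with h | h
    · have := h1 0
      rw [hN, ← h] at this
      norm_num at this
    · exact h
  refine ⟨1 / N, by positivity, fun i => ?_⟩
  rw [div_le_iff₀ hN0]
  cases i with
  | zero =>
    have h2 : N ≤ N * N := by
      have := norm_mul_le (1 : Matrix (Fin n) (Fin n) ℂ) 1
      rwa [mul_one] at this
    rw [pow_zero, hN1]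
    nlinarith
  | succ i => exact h1 i

/-- Gelfand's formula bounds the powers of `A` by any rate above the squared spectral radius. -/
lemma exists_norm_pow_sq_le {A : Matrix (Fin n) (Fin n) ℝ} {r : ℝ} (hr : 0 < r)
    (hA : specRadius A < ENNReal.ofReal (√r)) : ∃ b, 0 ≤ b ∧ ∀ i, ‖A ^ i‖ ^ 2 ≤ b * r ^ i := by
  have h1 := spectrum.pow_norm_pow_one_div_tendsto_nhds_spectralRadius (A.map (algebraMap ℝ ℂ))
  have h2 : ∀ᶠ i : ℕ in atTop, ‖A ^ i‖ ^ 2 / r ^ i ≤ 1 := by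
    filter_upwards [h1.eventually_lt_const hA, eventually_gt_atTop 0] with i hi hi0
    rw [ENNReal.ofReal_lt_ofReal_iff (Real.sqrt_pos.2 hr), norm_map_pow] at hi
    rw [div_le_one (pow_pos hr i)]
    have h3 : ‖A ^ i‖ ≤ √r ^ i := by
      have h4 := pow_le_pow_left₀ (by positivity) hi.le i
      rwa [← Real.rpow_natCast (‖A ^ i‖ ^ (1 / i : ℝ)), ← Real.rpow_mul (norm_nonneg _),
        one_div_mul_cancel (by exact_mod_cast hi0.ne'), Real.rpow_one] at h4
    calc ‖A ^ i‖ ^ 2 ≤ (√r ^ i) ^ 2 := by gcongr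
      _ = r ^ i := by rw [← pow_mul, mul_comm, pow_mul, Real.sq_sqrt hr.le]
  obtain ⟨b, hb⟩ := (isBoundedUnder_of_eventually_le h2).bddAbove_range
  refine ⟨b, ?_, fun i => ?_⟩
  · exact le_trans (by positivity) (hb ⟨0, rfl⟩)
  · have := hb ⟨i, rfl⟩
    rwa [div_le_iff₀ (pow_pos hr i)] at this

/-- The expected stage cost `tr (Q F(φ))` of a state with indicator `φ`. -/
def System.cost (S : System n m) (φ : ℕ) : ℝ := (S.Q * S.F φ).trace

lemma System.F_succ (S : System n m) (φ : ℕ) :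
    S.F (φ + 1) = S.F φ + S.A ^ φ * S.R * S.Aᵀ ^ φ := by
  rw [System.F, Finset.sum_Icc_succ_top (by omega), System.F, Nat.add_sub_cancel]

lemma System.cost_succ (S : System n m) (φ : ℕ) :
    S.cost (φ + 1) - S.cost φ = (S.Q * (S.A ^ φ * S.R * (S.A ^ φ)ᵀ)).trace := by
  rw [System.cost, System.cost, System.F_succ, Matrix.mul_add, Matrix.trace_add,
    Matrix.transpose_pow]
  ring

/-- The stage cost satisfies the bounds that the dynamic programming argument needs: its increments
`tr (Q Aᶦ R (Aᶦ)ᵀ)` are comparable to `‖Aᶦ‖²`, which instability keeps away from zero and Gelfand's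
formula bounds by a rate below `1 / max ps pc`. -/
theorem System.exists_costBounds (S : System n m) (hS : S.Standing) (hstab : S.Stabilizable) :
    ∃ δ r C : ℝ, CostBounds S.ps S.pc S.cost δ r C := by
  obtain ⟨l, u, hl, hu, hlu⟩ := exists_trace_bounds hS.posDef_Q hS.posDef_R
  obtain ⟨b, hb, hbA⟩ := exists_le_norm_pow hS.unstable
  have hzero : S.cost 0 = 0 := by simp [System.cost, System.F]
  -- a rate between the squared spectral radius and the inverse loss probabilities
  obtain ⟨r, hr1, hrA, hrp⟩ : ∃ r : ℝ, 1 < r ∧ specRadius S.A < ENNReal.ofReal (√r) ∧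
      max S.ps S.pc * r < 1 := by
    have hp0 : 0 < max S.ps S.pc := lt_max_of_lt_left hS.ps_mem.1
    have hfin : specRadius S.A ≠ ⊤ := fun h => by
      have h2 := hstab
      rw [System.Stabilizable, h] at h2
      simp at h2
    obtain ⟨q, hq⟩ : ∃ q : NNReal, (q : ℝ≥0∞) = specRadius S.A := ⟨_, ENNReal.coe_toNNReal hfin⟩
    have hq1 : 1 < q := by
      have := hS.unstable
      rw [← hq] at this
      exact_mod_cast this
    have hq1' : (1 : ℝ) < q := by exact_mod_cast hq1
    have h2 : (q : ℝ) ^ 2 < 1 / max S.ps S.pc := by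
      have h3 := hstab
      rw [System.Stabilizable, ← hq, one_div, ← ENNReal.coe_pow,
        ← ENNReal.coe_inv (by positivity), ENNReal.ofReal,
        ENNReal.coe_lt_coe, ← NNReal.coe_lt_coe, Real.coe_toNNReal _ hp0.le] at h3
      push_cast at h3
      rw [lt_one_div (by positivity) hp0, one_div]
      exact h3
    obtain ⟨r, hr1, hr2⟩ := exists_between h2
    refine ⟨r, by nlinarith, ?_, ?_⟩
    · rw [← hq, ENNReal.ofReal, ENNReal.coe_lt_coe, ← NNReal.coe_lt_coe,
        Real.coe_toNNReal _ (Real.sqrt_nonneg _)]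
      exact Real.lt_sqrt_of_sq_lt hr1
    · rw [lt_div_iff₀ hp0] at hr2
      linarith
  obtain ⟨B, hB0, hB⟩ := exists_norm_pow_sq_le (by linarith) hrA
  have hinc : ∀ i, l * b ^ 2 ≤ S.cost (i + 1) - S.cost i := fun i => by
    rw [System.cost_succ]
    refine le_trans ?_ (hlu _).1
    gcongr
    exact hbA i
  have hl' : 0 < l * b ^ 2 := by positivity
  have hmono : Monotone S.cost := monotone_nat_of_le_succ fun i => by linarith [hinc i]
  have hnn : ∀ i, 0 ≤ S.cost i := fun i => by rw [← hzero]; exact hmono (Nat.zero_le i)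
  -- submultiplicativity of the norm compares increments at different times
  have hsub : ∀ i j, S.cost (i + j + 1) - S.cost (i + j) ≤
      u / l * B * r ^ j * (S.cost (i + 1) - S.cost i) := fun i j => by
    rw [System.cost_succ, System.cost_succ]
    have h1 : ‖S.A ^ (i + j)‖ ^ 2 ≤ ‖S.A ^ i‖ ^ 2 * (B * r ^ j) := by
      rw [pow_add]
      calc ‖S.A ^ i * S.A ^ j‖ ^ 2 ≤ (‖S.A ^ i‖ * ‖S.A ^ j‖) ^ 2 := by
            gcongr; exact norm_mul_le _ _
        _ = ‖S.A ^ i‖ ^ 2 * ‖S.A ^ j‖ ^ 2 := mul_pow _ _ _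
        _ ≤ _ := by gcongr; exact hB j
    have h2 := (hlu (S.A ^ i)).1
    have h3 : 0 ≤ r ^ j := by positivity
    calc _ ≤ u * ‖S.A ^ (i + j)‖ ^ 2 := (hlu _).2
      _ ≤ u * (‖S.A ^ i‖ ^ 2 * (B * r ^ j)) := by gcongr
      _ = u / l * B * r ^ j * (l * ‖S.A ^ i‖ ^ 2) := by field_simp
      _ ≤ _ := by gcongr
  set D : ℝ := u / l * B with hD
  have hD0 : 0 ≤ D := by positivity
  have hshift : ∀ j φ, S.cost (φ + j) - S.cost j ≤ D * r ^ j * S.cost φ := fun j φ => by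
    induction φ with
    | zero => simp [hzero]
    | succ φ ih =>
      have := hsub φ j
      rw [show φ + 1 + j = φ + j + 1 by ring]
      linarith
  have hgeom : ∀ j, S.cost j ≤ D / (r - 1) * r ^ j * S.cost 1 := fun j => by
    have hr0 : 0 < r - 1 := by linarith
    have h0 : 0 ≤ D / (r - 1) := by positivity
    induction j with
    | zero => rw [hzero]; exact mul_nonneg (by positivity) (hnn 1)
    | succ j ih =>
      have h1 := hshift j 1
      rw [add_comm 1 j] at h1
      have h2 : D / (r - 1) * r ^ (j + 1) = D / (r - 1) * r ^ j + D * r ^ j := by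
        field_simp; ring
      rw [h2]
      linarith
  refine ⟨l * b ^ 2, r, D + D / (r - 1), hS.ps_mem, hS.pc_mem, hzero, hl', hinc, hr1.le, ?_, ?_,
    fun φ j => ?_⟩
  · exact lt_of_le_of_lt (by gcongr; exact le_max_left _ _) hrp
  · exact lt_of_le_of_lt (by gcongr; exact le_max_right _ _) hrp
  · have h1 := hshift j (φ + 1)
    have h2 := hgeom j
    have h3 : D / (r - 1) * r ^ j * S.cost 1 ≤ D / (r - 1) * r ^ j * S.cost (φ + 1) := by
      have hr0 : 0 < r - 1 := by linarith
      have h0 : 0 ≤ D / (r - 1) := by positivity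
      gcongr
      exact hmono (by omega)
    linarith

end Cost

/-! ### The primitives of one slot -/

section Independence

variable {Ω α β γ : Type*} [MeasurableSpace Ω] [MeasurableSpace α] [MeasurableSpace β]
  [MeasurableSpace γ] {μ : Measure Ω} [IsProbabilityMeasure μ]

lemma indepFun_prodMk_left {f : Ω → α} {g : Ω → β} {h : Ω → γ} (hf : Measurable f)
    (hg : Measurable g) (hh : Measurable h) (h1 : IndepFun f (fun ω => (g ω, h ω)) μ)
    (h2 : IndepFun g h μ) : IndepFun (fun ω => (f ω, g ω)) h μ := by
  have hfg : IndepFun f g μ := h1.comp measurable_id measurable_fst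
  rw [indepFun_iff_map_prod_eq_prod_map_map hf.aemeasurable (hg.prodMk hh).aemeasurable,
    (indepFun_iff_map_prod_eq_prod_map_map hg.aemeasurable hh.aemeasurable).1 h2] at h1
  rw [indepFun_iff_map_prod_eq_prod_map_map (hf.prodMk hg).aemeasurable hh.aemeasurable,
    (indepFun_iff_map_prod_eq_prod_map_map hf.aemeasurable hg.aemeasurable).1 hfg]
  have := Measure.isProbabilityMeasure_map (μ := μ) hf.aemeasurable
  have := Measure.isProbabilityMeasure_map (μ := μ) hg.aemeasurable
  have := Measure.isProbabilityMeasure_map (μ := μ) hh.aemeasurable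
  apply (MeasurableEquiv.prodAssoc (α := α) (β := β) (γ := γ)).map_measurableEquiv_injective
  rw [Measure.prodAssoc_prod, ← h1,
    Measure.map_map MeasurableEquiv.prodAssoc.measurable ((hf.prodMk hg).prodMk hh)]
  rfl

end Independence

section Noise

variable {Ω : Type*} [MeasurableSpace Ω] {n m : ℕ} {μ : Measure Ω}
  {X : Primitives Ω n} {S : System n m} {s₀ : ℕ × ℕ}

/-- The random primitives of one time slot. -/
def Primitives.slot (X : Primitives Ω n) (k : ℕ) (ω : Ω) : (Fin n → ℝ) × Bool × Bool :=
  (X.w k ω, X.up k ω, X.down k ω)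

/-- The random primitives that determine the closed loop at the beginning of slot `k`. -/
def Primitives.past (X : Primitives Ω n) (k : ℕ) (ω : Ω) :
    ((Fin n → ℝ) × (Fin n → ℝ)) × (Finset.range k → (Fin n → ℝ) × Bool × Bool) :=
  ((X.x₀ ω, X.xhat₀ ω), fun j => X.slot j ω)

lemma Primitives.IsModel.measurable_slot (hX : X.IsModel μ S s₀) (k : ℕ) :
    Measurable (X.slot k) :=
  (hX.measurable_w k).prodMk ((hX.measurable_up k).prodMk (hX.measurable_down k))

lemma Primitives.IsModel.measurable_past (hX : X.IsModel μ S s₀) (k : ℕ) :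
    Measurable (X.past k) :=
  (hX.measurable_x₀.prodMk hX.measurable_xhat₀).prodMk
    (measurable_pi_lambda _ fun j => hX.measurable_slot j)

lemma Primitives.IsModel.indepFun_past [IsProbabilityMeasure μ]
    (hX : X.IsModel μ S s₀) (k : ℕ) :
    IndepFun (X.past k) (X.slot k) μ := by
  refine indepFun_prodMk_left (hX.measurable_x₀.prodMk hX.measurable_xhat₀)
    (measurable_pi_lambda _ fun j => hX.measurable_slot j) (hX.measurable_slot k) ?_ ?_
  · exact hX.indep_init.comp measurable_id
      (ψ := fun y => ((fun j : Finset.range k => y j), y k)) (by fun_prop)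
  · exact (hX.indep_time.indepFun_finset (Finset.range k) {k} (by simp)
      hX.measurable_slot).comp measurable_id
      (measurable_pi_apply (⟨k, Finset.mem_singleton_self k⟩ : ({k} : Finset ℕ)))

lemma Primitives.IsModel.memLp_w (hX : X.IsModel μ S s₀) (k : ℕ) (i : Fin n) :
    MemLp (fun ω => X.w k ω i) 2 μ := by
  have h1 : MemLp (fun x : EuclideanSpace ℝ (Fin n) => x i) 2 (multivariateGaussian 0 S.R) :=
    (IsGaussian.memLp_dual _ (EuclideanSpace.proj i) 2 (by simp))
  rw [← (hX.law_w k).map_eq] at h1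
  exact h1.comp_of_map (hX.law_w k).aemeasurable

lemma Primitives.IsModel.integral_w (hX : X.IsModel μ S s₀) (k : ℕ) (i : Fin n) :
    ∫ ω, X.w k ω i ∂μ = 0 := by
  have h1 := (hX.law_w k).integral_comp (f := fun x => x i)
    (by fun_prop)
  refine h1.trans ?_
  have h2 := (EuclideanSpace.proj i : EuclideanSpace ℝ (Fin n) →L[ℝ] ℝ).integral_comp_comm
    (IsGaussian.integrable_fun_id (μ := multivariateGaussian 0 S.R))
  simpa using h2

lemma Primitives.IsModel.integral_w_mul_w [IsProbabilityMeasure μ]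
    (hX : X.IsModel μ S s₀) (hR : S.R.PosSemidef) (k : ℕ)
    (i j : Fin n) : ∫ ω, X.w k ω i * X.w k ω j ∂μ = S.R i j := by
  have h1 := (hX.law_w k).covariance_fun_comp (f := fun x => x i) (g := fun x => x j)
    (by fun_prop) (by fun_prop)
  rw [covariance_eval_multivariateGaussian hR,
    covariance_eq_sub (hX.memLp_w k i) (hX.memLp_w k j)] at h1
  simpa [hX.integral_w] using h1

end Noise

section Moments

variable {Ω ι : Type*} [MeasurableSpace Ω] {μ : Measure Ω} [IsProbabilityMeasure μ]
  {n : ℕ}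

/-- One slot of the second-moment recursion: `b` is the (bounded) indicator of a link event of the
slot, `w` the disturbance, while the weight `U` and the vector `v` depend on the past `p` only. -/
lemma integral_mul_add_mul_add {α : Type*} [MeasurableSpace α] {p : Ω → α}
    {w : Ω → Fin n → ℝ} {b : Ω → ℝ} {R : Matrix (Fin n) (Fin n) ℝ} (hp : Measurable p)
    (hb : Measurable b) (hw : Measurable w) (hb1 : ∀ ω, |b ω| ≤ 1)
    (hpast : IndepFun p (fun ω => (w ω, b ω)) μ) (hslot : IndepFun w b μ)
    (hw2 : ∀ i, MemLp (fun ω => w ω i) 2 μ) (hw0 : ∀ i, ∫ ω, w ω i ∂μ = 0)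
    (hwR : ∀ i j, ∫ ω, w ω i * w ω j ∂μ = R i j)
    {U : α → ℝ} {C : ℝ} (hU : Measurable U) (hUC : ∀ ω, |U (p ω)| ≤ C)
    {v : α → Fin n → ℝ} (hv : Measurable v) (hv2 : ∀ i, MemLp (fun ω => v (p ω) i) 2 μ)
    (i j : Fin n) :
    Integrable (fun ω => b ω * (U (p ω) * ((v (p ω) i + w ω i) * (v (p ω) j + w ω j)))) μ ∧
    ∫ ω, b ω * (U (p ω) * ((v (p ω) i + w ω i) * (v (p ω) j + w ω j))) ∂μ =
      (∫ ω, b ω ∂μ) * ∫ ω, U (p ω) * (v (p ω) i * v (p ω) j + R i j) ∂μ := by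
  have hvi : ∀ i, Measurable fun a => v a i := fun i => (measurable_pi_apply i).comp hv
  have hwi : ∀ i, Measurable fun ω => w ω i := fun i => (measurable_pi_apply i).comp hw
  have hUm : AEStronglyMeasurable (fun ω => U (p ω)) μ := (hU.comp hp).aestronglyMeasurable
  have hbm : AEStronglyMeasurable b μ := hb.aestronglyMeasurable
  have hUb : ∀ᵐ ω ∂μ, ‖U (p ω)‖ ≤ C := Eventually.of_forall fun ω => hUC _
  have hbb : ∀ᵐ ω ∂μ, ‖b ω‖ ≤ 1 := Eventually.of_forall hb1
  have bI : Integrable b μ := Integrable.of_bound hbm 1 hbb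
  have UI : Integrable (fun ω => U (p ω)) μ := Integrable.of_bound hUm C hUb
  have UvI : ∀ i, Integrable (fun ω => U (p ω) * v (p ω) i) μ := fun i =>
    ((hv2 i).integrable (by norm_num)).bdd_mul hUm hUb
  have UvvI : Integrable (fun ω => U (p ω) * (v (p ω) i * v (p ω) j)) μ :=
    ((hv2 i).integrable_mul (hv2 j)).bdd_mul hUm hUb
  have bwI : ∀ i, Integrable (fun ω => b ω * w ω i) μ := fun i =>
    ((hw2 i).integrable (by norm_num)).bdd_mul hbm hbb
  have bwwI : Integrable (fun ω => b ω * (w ω i * w ω j)) μ :=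
    ((hw2 i).integrable_mul (hw2 j)).bdd_mul hbm hbb
  -- the link event is independent of the disturbance within the slot
  have bw : ∀ i, ∫ ω, b ω * w ω i ∂μ = 0 := fun i => by
    have h1 : IndepFun b (fun ω => w ω i) μ := hslot.symm.comp measurable_id (measurable_pi_apply i)
    rw [h1.integral_fun_mul_eq_mul_integral hbm (hwi i).aestronglyMeasurable, hw0, mul_zero]
  have bww : ∫ ω, b ω * (w ω i * w ω j) ∂μ = (∫ ω, b ω ∂μ) * R i j := by
    have h1 : IndepFun b (fun ω => w ω i * w ω j) μ := hslot.symm.comp measurable_id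
      (ψ := fun x : Fin n → ℝ => x i * x j) (by fun_prop)
    rw [h1.integral_fun_mul_eq_mul_integral hbm ((hwi i).mul (hwi j)).aestronglyMeasurable, hwR]
  -- factors of the past and of the slot separate
  have key : ∀ {f : α → ℝ} {g : (Fin n → ℝ) × ℝ → ℝ}, Measurable f → Measurable g →
      Integrable (fun ω => f (p ω)) μ → Integrable (fun ω => g (w ω, b ω)) μ →
      Integrable (fun ω => f (p ω) * g (w ω, b ω)) μ ∧
      ∫ ω, f (p ω) * g (w ω, b ω) ∂μ = (∫ ω, f (p ω) ∂μ) * ∫ ω, g (w ω, b ω) ∂μ := by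
    intro f g hf hg hfI hgI
    have h1 : IndepFun (fun ω => f (p ω)) (fun ω => g (w ω, b ω)) μ := hpast.comp hf hg
    exact ⟨h1.integrable_mul hfI hgI, h1.integral_fun_mul_eq_mul_integral
      hfI.aestronglyMeasurable hgI.aestronglyMeasurable⟩
  obtain ⟨i1, e1⟩ := key (f := fun a => U a * (v a i * v a j)) (g := fun y => y.2)
    (hU.mul ((hvi i).mul (hvi j))) measurable_snd UvvI bI
  obtain ⟨i2, e2⟩ := key (f := fun a => U a * v a i) (g := fun y => y.2 * y.1 j)
    (hU.mul (hvi i)) (by fun_prop) (UvI i) (bwI j)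
  obtain ⟨i3, e3⟩ := key (f := fun a => U a * v a j) (g := fun y => y.2 * y.1 i)
    (hU.mul (hvi j)) (by fun_prop) (UvI j) (bwI i)
  obtain ⟨i4, e4⟩ := key (f := U) (g := fun y => y.2 * (y.1 i * y.1 j)) hU (by fun_prop) UI bwwI
  have heq : (fun ω => b ω * (U (p ω) * ((v (p ω) i + w ω i) * (v (p ω) j + w ω j)))) =
      fun ω => (U (p ω) * (v (p ω) i * v (p ω) j) * b ω + U (p ω) * v (p ω) i * (b ω * w ω j)) +
        (U (p ω) * v (p ω) j * (b ω * w ω i) + U (p ω) * (b ω * (w ω i * w ω j))) := by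
    ext ω; ring
  have h5 : ∫ ω, U (p ω) * (v (p ω) i * v (p ω) j + R i j) ∂μ =
      ∫ ω, U (p ω) * (v (p ω) i * v (p ω) j) ∂μ + (∫ ω, U (p ω) ∂μ) * R i j := by
    rw [← integral_mul_const, ← integral_add UvvI (UI.mul_const _)]
    congr 1; ext ω; ring
  rw [h5, heq]
  refine ⟨(i1.add i2).add (i3.add i4), (integral_add (i1.add i2) (i3.add i4)).trans ?_⟩
  refine (congrArg₂ (· + ·) ((integral_add i1 i2).trans (congrArg₂ (· + ·) e1 e2))
    ((integral_add i3 i4).trans (congrArg₂ (· + ·) e3 e4))).trans ?_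
  simp only [bw, bww]
  ring

end Moments

/-! ### The closed loop as a recursion in the estimation error -/

section ClosedLoop

variable {Ω : Type*} {n m : ℕ} {S : System n m} {X : Primitives Ω n} {s₀ : ℕ × ℕ}
  {π : ℕ × ℕ → Action}

/-- The indicators, the plant state and the estimation error at time `k` under the stationary
rule `π`. -/
def closedLoop (S : System n m) (X : Primitives Ω n) (s₀ : ℕ × ℕ) (π : ℕ × ℕ → Action) (k : ℕ)
    (ω : Ω) : (ℕ × ℕ) × (Fin n → ℝ) × (Fin n → ℝ) :=
  (((loop S X s₀ (stationary π) ω k).1.τ, (loop S X s₀ (stationary π) ω k).1.φ),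
    (loop S X s₀ (stationary π) ω k).1.x,
    (loop S X s₀ (stationary π) ω k).1.x - (loop S X s₀ (stationary π) ω k).1.xhat)

/-- Whether the transmission of the decision `a` is received, from the conditions of the uplink
and of the downlink. -/
def link (a : Action) (y : Bool × Bool) : Bool :=
  match a with
  | Action.sensor => y.1
  | Action.controller => y.2

/-- The indicators after the decision `a`, received if `β` is true. -/
def nextIndicators (a : Action) (β : Bool) (s : ℕ × ℕ) : ℕ × ℕ :=
  match a, β with
  | Action.sensor, true => (1, s.2 + 1)
  | Action.controller, true => (s.1 + 1, s.1 + 1)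
  | _, false => (s.1 + 1, s.2 + 1)

/-- The vector that the plant matrix carries to the next plant state: since `A + B K = 0`, it is
the estimation error if the control packet is received, and the plant state otherwise. -/
def plantSource (a : Action) (β : Bool) (z : (ℕ × ℕ) × (Fin n → ℝ) × (Fin n → ℝ)) : Fin n → ℝ :=
  match a, β with
  | Action.controller, true => z.2.2
  | _, _ => z.2.1

/-- The vector that the plant matrix carries to the next estimation error. -/
def errorSource (a : Action) (β : Bool) (z : (ℕ × ℕ) × (Fin n → ℝ) × (Fin n → ℝ)) : Fin n → ℝ :=
  match a, β with
  | Action.sensor, true => 0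
  | _, _ => z.2.2

/-- One slot of the closed loop with disturbance `w`, for a decision `a`, received if `β`. -/
def advance (A : Matrix (Fin n) (Fin n) ℝ) (a : Action) (β : Bool)
    (z : (ℕ × ℕ) × (Fin n → ℝ) × (Fin n → ℝ)) (w : Fin n → ℝ) :
    (ℕ × ℕ) × (Fin n → ℝ) × (Fin n → ℝ) :=
  (nextIndicators a β z.1, A *ᵥ plantSource a β z + w, A *ᵥ errorSource a β z + w)

lemma closedLoop_succ (hone : S.OneStepControllable) (k : ℕ) (ω : Ω) :
    closedLoop S X s₀ π (k + 1) ω =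
      advance S.A (π (closedLoop S X s₀ π k ω).1)
        (link (π (closedLoop S X s₀ π k ω).1) (X.slot k ω).2)
        (closedLoop S X s₀ π k ω) (X.slot k ω).1 := by
  have hBK : ∀ v, S.B *ᵥ (S.K *ᵥ v) = -(S.A *ᵥ v) := fun v => by
    rw [Matrix.mulVec_mulVec, eq_neg_iff_add_eq_zero, ← Matrix.add_mulVec, add_comm,
      show S.A + S.B * S.K = 0 from hone, Matrix.zero_mulVec]
  obtain ⟨c, hc⟩ : ∃ c, c = (loop S X s₀ (stationary π) ω k).1 := ⟨_, rfl⟩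
  have hstep : (loop S X s₀ (stationary π) ω (k + 1)).1 =
      S.step (π (c.τ, c.φ)) (X.w k ω) (X.up k ω) (X.down k ω) c := by rw [hc]; rfl
  simp only [closedLoop, advance, link, plantSource, errorSource, nextIndicators, Primitives.slot,
    hstep, ← hc]
  generalize X.w k ω = w
  cases h : π (c.τ, c.φ) <;> cases X.up k ω <;> cases X.down k ω <;>
    simp only [System.step, hBK, Matrix.mulVec_sub, Matrix.mulVec_zero, if_true, if_false,
      Bool.false_eq_true, add_zero, zero_add] <;>
    refine Prod.ext rfl (Prod.ext ?_ ?_) <;> dsimp only <;> abel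

lemma measurable_plantSource (a : Action) (β : Bool) :
    Measurable (plantSource (n := n) a β) := by
  cases a <;> cases β <;>
    first | exact measurable_snd.fst | exact measurable_snd.snd

lemma measurable_errorSource (a : Action) (β : Bool) :
    Measurable (errorSource (n := n) a β) := by
  cases a <;> cases β <;>
    first | exact measurable_snd.snd | exact measurable_const

lemma measurable_mulVec (A : Matrix (Fin n) (Fin n) ℝ) : Measurable fun v : Fin n → ℝ => A *ᵥ v :=
  (Continuous.matrix_mulVec continuous_const continuous_id).measurable

lemma measurable_advance (A : Matrix (Fin n) (Fin n) ℝ) :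
    Measurable fun q : ((ℕ × ℕ) × (Fin n → ℝ) × (Fin n → ℝ)) × ((Fin n → ℝ) × Bool × Bool) =>
      advance A (π q.1.1) (link (π q.1.1) q.2.2) q.1 q.2.1 := by
  have h1 : ∀ x : (ℕ × ℕ) × Bool × Bool, Measurable
      fun q : ((ℕ × ℕ) × (Fin n → ℝ) × (Fin n → ℝ)) × ((Fin n → ℝ) × Bool × Bool) =>
        advance A (π x.1) (link (π x.1) x.2) q.1 q.2.1 := fun x => by
    refine Measurable.prodMk ?_ (Measurable.prodMk ?_ ?_)
    · exact (measurable_of_countable (nextIndicators (π x.1) (link (π x.1) x.2))).comp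
        measurable_fst.fst
    · exact ((measurable_mulVec A).comp ((measurable_plantSource _ _).comp measurable_fst)).add
        measurable_snd.fst
    · exact ((measurable_mulVec A).comp ((measurable_errorSource _ _).comp measurable_fst)).add
        measurable_snd.fst
  have h2 : Measurable fun q : ((ℕ × ℕ) × (Fin n → ℝ) × (Fin n → ℝ)) ×
      ((Fin n → ℝ) × Bool × Bool) => ((q.1.1, q.2.2), q) := by fun_prop
  exact (measurable_from_prod_countable_right (f := fun r : ((ℕ × ℕ) × Bool × Bool) ×
    (((ℕ × ℕ) × (Fin n → ℝ) × (Fin n → ℝ)) × ((Fin n → ℝ) × Bool × Bool)) =>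
      advance A (π r.1.1) (link (π r.1.1) r.1.2) r.2.1 r.2.2.1) h1).comp h2

/-- The closed loop at time `k` is a measurable function of the primitives of earlier slots. -/
lemma exists_closedLoop_eq (hone : S.OneStepControllable) (k : ℕ) :
    ∃ f : ((Fin n → ℝ) × (Fin n → ℝ)) × (Finset.range k → (Fin n → ℝ) × Bool × Bool) →
        (ℕ × ℕ) × (Fin n → ℝ) × (Fin n → ℝ),
      Measurable f ∧ ∀ ω, closedLoop S X s₀ π k ω = f (X.past k ω) := by
  induction k with
  | zero =>
    exact ⟨fun p => (s₀, p.1.1, p.1.1 - p.1.2), by fun_prop, fun ω => rfl⟩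
  | succ k ih =>
    obtain ⟨f, hf, hfe⟩ := ih
    let past : ((Fin n → ℝ) × (Fin n → ℝ)) × (Finset.range (k + 1) → (Fin n → ℝ) × Bool × Bool) →
        (ℕ × ℕ) × (Fin n → ℝ) × (Fin n → ℝ) := fun p =>
      f (p.1, fun j => p.2 ⟨j, Finset.mem_range.2 ((Finset.mem_range.1 j.2).trans k.lt_succ_self)⟩)
    refine ⟨fun p => advance S.A (π (past p).1)
      (link (π (past p).1) (p.2 ⟨k, Finset.self_mem_range_succ k⟩).2) (past p)
      (p.2 ⟨k, Finset.self_mem_range_succ k⟩).1, ?_, fun ω => ?_⟩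
    · exact (measurable_advance S.A).comp ((hf.comp (by fun_prop)).prodMk (by fun_prop))
    · rw [closedLoop_succ hone, hfe]
      rfl

lemma finite_range_closedLoop (hone : S.OneStepControllable) (k : ℕ) :
    (Set.range fun ω => (closedLoop S X s₀ π k ω).1).Finite := by
  induction k with
  | zero => exact (Set.finite_singleton s₀).subset (by rintro _ ⟨ω, rfl⟩; rfl)
  | succ k ih =>
    refine ((ih.prod (Set.finite_univ (α := Bool × Bool))).image
      fun x => nextIndicators (π x.1) (link (π x.1) x.2) x.1).subset ?_
    rintro _ ⟨ω, rfl⟩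
    refine ⟨((closedLoop S X s₀ π k ω).1, X.up k ω, X.down k ω), ⟨⟨ω, rfl⟩, trivial⟩, ?_⟩
    simp only [closedLoop_succ hone]
    rfl

variable [MeasurableSpace Ω] {μ : Measure Ω}

lemma measurable_closedLoop (hone : S.OneStepControllable) (hX : X.IsModel μ S s₀) (k : ℕ) :
    Measurable (closedLoop S X s₀ π k) := by
  obtain ⟨f, hf, hfe⟩ := exists_closedLoop_eq (S := S) (X := X) (s₀ := s₀) (π := π) hone k
  rw [funext hfe]
  exact hf.comp (hX.measurable_past k)

lemma indepFun_closedLoop [IsProbabilityMeasure μ] (hone : S.OneStepControllable)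
    (hX : X.IsModel μ S s₀) (k : ℕ) : IndepFun (closedLoop S X s₀ π k) (X.slot k) μ := by
  obtain ⟨f, hf, hfe⟩ := exists_closedLoop_eq (S := S) (X := X) (s₀ := s₀) (π := π) hone k
  rw [funext hfe]
  exact (hX.indepFun_past k).comp hf measurable_id

end ClosedLoop

section Split

variable {Ω : Type*} [MeasurableSpace Ω] {π : ℕ × ℕ → Action} {μ : Measure Ω}

lemma integral_comp_bool [IsProbabilityMeasure μ] {u : Ω → Bool} (hu : Measurable u) {p : ℝ}
    (hp : 0 ≤ p) (hup : μ {ω | u ω = false} = ENNReal.ofReal p) (b : Bool → ℝ) :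
    ∫ ω, b (u ω) ∂μ = p * b false + (1 - p) * b true := by
  have hs : MeasurableSet {ω | u ω = false} := hu (measurableSet_singleton false)
  have h1 : (fun ω => b (u ω)) = fun ω => b true +
      ({ω | u ω = false}.indicator (fun _ => (1 : ℝ)) ω) * (b false - b true) := by
    ext ω
    cases h : u ω <;> simp [Set.indicator, h]
  have h2 : ∫ ω, {ω | u ω = false}.indicator (fun _ => (1 : ℝ)) ω ∂μ = p := by
    rw [integral_indicator hs, setIntegral_const, Measure.real, hup, ENNReal.toReal_ofReal hp]
    simp
  rw [h1, integral_add (integrable_const _)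
    (((integrable_const 1).indicator hs).mul_const _), integral_mul_const, h2]
  simp
  ring

/-- The weight of a decision at a state: `1` if the rule takes it there, `0` otherwise. -/
def chosen (π : ℕ × ℕ → Action) (a : Action) (s : ℕ × ℕ) : ℝ :=
  match π s, a with
  | Action.sensor, Action.sensor => 1
  | Action.controller, Action.controller => 1
  | _, _ => 0

/-- The real indicator of the link condition `β`. -/
def hit (β u : Bool) : ℝ := if u = β then 1 else 0

/-- A quantity that depends on the decision and on the reception of its packet is a sum of products
of a factor of the slot and a factor of the past. -/
lemma apply_eq_sum_chosen (F : Action → Bool → ℝ) (s : ℕ × ℕ) (y : Bool × Bool) :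
    F (π s) (link (π s) y) =
      (hit true (link Action.sensor y) * (chosen π Action.sensor s * F Action.sensor true) +
        hit false (link Action.sensor y) * (chosen π Action.sensor s * F Action.sensor false)) +
      (hit true (link Action.controller y) *
          (chosen π Action.controller s * F Action.controller true) +
        hit false (link Action.controller y) *
          (chosen π Action.controller s * F Action.controller false)) := by
  obtain ⟨u, d⟩ := y
  simp only [chosen, hit, link]
  cases π s <;> cases u <;> cases d <;> simp

lemma transition_eq (ps pc : ℝ) (f : ℕ × ℕ → ℝ) (s : ℕ × ℕ) :
    transition ps pc π f s =
      ((1 - ps) * (chosen π Action.sensor s * f (nextIndicators Action.sensor true s)) +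
        ps * (chosen π Action.sensor s * f (nextIndicators Action.sensor false s))) +
      ((1 - pc) * (chosen π Action.controller s * f (nextIndicators Action.controller true s)) +
        pc * (chosen π Action.controller s * f (nextIndicators Action.controller false s))) := by
  cases h : π s
  · rw [transition_sensor h]; simp [chosen, h, sensorValue, nextIndicators]; ring
  · rw [transition_controller h]; simp [chosen, h, controllerValue, nextIndicators]; ring

end Split

/-! ### Second moments given the indicators -/

lemma System.F_succ_eq_conj {n m : ℕ} (S : System n m) (φ : ℕ) :
    S.F (φ + 1) = S.A * S.F φ * S.Aᵀ + S.R := by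
  induction φ with
  | zero => simp [System.F]
  | succ φ ih =>
    rw [System.F_succ S (φ + 1)]
    nth_rewrite 1 [ih]
    rw [System.F_succ S φ, mul_add, add_mul, pow_succ' S.A, pow_succ S.Aᵀ]
    simp only [mul_assoc]
    abel

lemma exists_abs_le_of_finite_range {Ω : Type*} {s : Ω → ℕ × ℕ} (hs : (Set.range s).Finite)
    (g : ℕ × ℕ → ℝ) : ∃ C, ∀ ω, |g (s ω)| ≤ C := by
  obtain ⟨C, hC⟩ := (hs.image fun t => |g t|).bddAbove
  exact ⟨C, fun ω => hC ⟨s ω, ⟨ω, rfl⟩, rfl⟩⟩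

section SecondMoments

variable {Ω : Type*} [MeasurableSpace Ω] {n m : ℕ} {S : System n m} {X : Primitives Ω n}
  {s₀ : ℕ × ℕ} {π : ℕ × ℕ → Action} {μ : Measure Ω}

/-- The random vector `v` has, conditionally on the indicators `s`, the second-moment matrix
`F (ψ s)`; conditioning is expressed by testing against functions of `s`. -/
structure HasSecondMoment (S : System n m) (μ : Measure Ω) (s : Ω → ℕ × ℕ) (ψ : ℕ × ℕ → ℕ)
    (v : Ω → Fin n → ℝ) : Prop where
  memLp : ∀ i, MemLp (fun ω => v ω i) 2 μ
  integral_eq : ∀ (g : ℕ × ℕ → ℝ) (i j : Fin n),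
    ∫ ω, g (s ω) * (v ω i * v ω j) ∂μ = ∫ ω, g (s ω) * S.F (ψ (s ω)) i j ∂μ

lemma integrable_comp_of_finite_range [IsProbabilityMeasure μ] {s : Ω → ℕ × ℕ}
    (hs : (Set.range s).Finite) (hm : Measurable s) (g : ℕ × ℕ → ℝ) :
    Integrable (fun ω => g (s ω)) μ := by
  obtain ⟨C, hC⟩ := exists_abs_le_of_finite_range hs g
  exact Integrable.of_bound ((measurable_of_countable g).comp hm).aestronglyMeasurable C
    (Eventually.of_forall hC)

lemma HasSecondMoment.integrable [IsProbabilityMeasure μ] {s : Ω → ℕ × ℕ} {ψ : ℕ × ℕ → ℕ}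
    {v : Ω → Fin n → ℝ} (H : HasSecondMoment S μ s ψ v) (hs : (Set.range s).Finite)
    (hm : Measurable s) (g : ℕ × ℕ → ℝ) (i j : Fin n) :
    Integrable (fun ω => g (s ω) * (v ω i * v ω j)) μ := by
  obtain ⟨C, hC⟩ := exists_abs_le_of_finite_range hs g
  exact ((H.memLp i).integrable_mul (H.memLp j)).bdd_mul
    ((measurable_of_countable g).comp hm).aestronglyMeasurable (Eventually.of_forall hC)

/-- The plant matrix acts on second moments by `M ↦ A M Aᵀ`; adding the noise covariance gives the
recursion of `F`. -/
lemma HasSecondMoment.integral_mulVec [IsProbabilityMeasure μ] {s : Ω → ℕ × ℕ} {ψ : ℕ × ℕ → ℕ}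
    {v : Ω → Fin n → ℝ} (H : HasSecondMoment S μ s ψ v) (hs : (Set.range s).Finite)
    (hm : Measurable s) (g : ℕ × ℕ → ℝ) (i j : Fin n) :
    ∫ ω, g (s ω) * ((S.A *ᵥ v ω) i * (S.A *ᵥ v ω) j + S.R i j) ∂μ =
      ∫ ω, g (s ω) * S.F (ψ (s ω) + 1) i j ∂μ := by
  have hF : ∀ k, S.F (k + 1) i j =
      (∑ a, ∑ b, S.A i a * S.A j b * S.F k a b) + S.R i j := fun k => by
    rw [System.F_succ_eq_conj, Matrix.add_apply, Matrix.mul_apply]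
    congr 1
    simp only [Matrix.mul_apply, Matrix.transpose_apply, Finset.sum_mul]
    rw [Finset.sum_comm]
    exact Finset.sum_congr rfl fun a _ => Finset.sum_congr rfl fun b _ => by ring
  have h1 : (fun ω => g (s ω) * ((S.A *ᵥ v ω) i * (S.A *ᵥ v ω) j + S.R i j)) = fun ω =>
      (∑ a, ∑ b, S.A i a * S.A j b * (g (s ω) * (v ω a * v ω b))) + g (s ω) * S.R i j := by
    ext ω
    simp only [Matrix.mulVec, dotProduct]
    rw [Finset.sum_mul_sum, mul_add, Finset.mul_sum]
    congr 1
    refine Finset.sum_congr rfl fun a _ => ?_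
    rw [Finset.mul_sum]
    exact Finset.sum_congr rfl fun b _ => by ring
  have h2 : (fun ω => g (s ω) * S.F (ψ (s ω) + 1) i j) = fun ω =>
      (∑ a, ∑ b, S.A i a * S.A j b * (g (s ω) * S.F (ψ (s ω)) a b)) + g (s ω) * S.R i j := by
    ext ω
    rw [hF, mul_add, Finset.mul_sum]
    congr 1
    refine Finset.sum_congr rfl fun a _ => ?_
    rw [Finset.mul_sum]
    exact Finset.sum_congr rfl fun b _ => by ring
  have i1 : ∀ a b, Integrable (fun ω => S.A i a * S.A j b * (g (s ω) * (v ω a * v ω b))) μ :=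
    fun a b => (H.integrable hs hm g a b).const_mul _
  have i2 : ∀ a b, Integrable
      (fun ω => S.A i a * S.A j b * (g (s ω) * S.F (ψ (s ω)) a b)) μ := fun a b =>
    (integrable_comp_of_finite_range hs hm fun t => g t * S.F (ψ t) a b).const_mul _
  have i3 : Integrable (fun ω => g (s ω) * S.R i j) μ :=
    (integrable_comp_of_finite_range hs hm g).mul_const _
  rw [h1, h2, integral_add (integrable_finsetSum _ fun a _ => integrable_finsetSum _
    fun b _ => i1 a b) i3, integral_add (integrable_finsetSum _ fun a _ =>
    integrable_finsetSum _ fun b _ => i2 a b) i3]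
  congr 1
  rw [integral_finsetSum _ fun a _ => integrable_finsetSum _ fun b _ => i1 a b,
    integral_finsetSum _ fun a _ => integrable_finsetSum _ fun b _ => i2 a b]
  refine Finset.sum_congr rfl fun a _ => ?_
  rw [integral_finsetSum _ fun b _ => i1 a b, integral_finsetSum _ fun b _ => i2 a b]
  refine Finset.sum_congr rfl fun b _ => ?_
  rw [integral_const_mul, integral_const_mul, H.integral_eq]

/-- A vanishing carry-over, for the estimation error after a received sensor packet. -/
lemma hasSecondMoment_zero (s : Ω → ℕ × ℕ) :
    HasSecondMoment S μ s (fun _ => 0) (fun _ => 0) where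
  memLp i := by simp
  integral_eq g i j := by simp [System.F]

lemma abs_hit_le (β u : Bool) : |hit β u| ≤ 1 := by
  rw [hit]; split_ifs <;> simp

lemma abs_chosen_le (π : ℕ × ℕ → Action) (a : Action) (s : ℕ × ℕ) : |chosen π a s| ≤ 1 := by
  cases h : π s <;> cases a <;> simp [chosen, h]

/-- The contribution to a second moment of the event that a link is in the condition `β`. -/
lemma integral_hit_mul_mul [IsProbabilityMeasure μ] (hR : S.R.PosSemidef)
    (hone : S.OneStepControllable) (hX : X.IsModel μ S s₀) (k : ℕ)
    {V : (ℕ × ℕ) × (Fin n → ℝ) × (Fin n → ℝ) → Fin n → ℝ} (hV : Measurable V) {ψ : ℕ × ℕ → ℕ}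
    (H : HasSecondMoment S μ (fun ω => (closedLoop S X s₀ π k ω).1) ψ
      (fun ω => V (closedLoop S X s₀ π k ω)))
    (f : Bool × Bool → Bool) (β : Bool) (g : ℕ × ℕ → ℝ) (i j : Fin n) :
    Integrable (fun ω => hit β (f (X.up k ω, X.down k ω)) * (g (closedLoop S X s₀ π k ω).1 *
      ((S.A *ᵥ V (closedLoop S X s₀ π k ω) + X.w k ω) i *
        (S.A *ᵥ V (closedLoop S X s₀ π k ω) + X.w k ω) j))) μ ∧
    ∫ ω, hit β (f (X.up k ω, X.down k ω)) * (g (closedLoop S X s₀ π k ω).1 *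
      ((S.A *ᵥ V (closedLoop S X s₀ π k ω) + X.w k ω) i *
        (S.A *ᵥ V (closedLoop S X s₀ π k ω) + X.w k ω) j)) ∂μ =
      (∫ ω, hit β (f (X.up k ω, X.down k ω)) ∂μ) *
        ∫ ω, g (closedLoop S X s₀ π k ω).1 *
          S.F (ψ (closedLoop S X s₀ π k ω).1 + 1) i j ∂μ := by
  have hm := measurable_closedLoop (π := π) hone hX k
  have hfin := finite_range_closedLoop (S := S) (X := X) (s₀ := s₀) (π := π) hone k
  obtain ⟨C, hC⟩ := exists_abs_le_of_finite_range hfin g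
  have hb : Measurable fun y : Bool × Bool => hit β (f y) := measurable_of_countable _
  rw [← H.integral_mulVec hfin hm.fst]
  refine integral_mul_add_mul_add (p := closedLoop S X s₀ π k) (w := X.w k)
    (b := fun ω => hit β (f (X.up k ω, X.down k ω))) (R := S.R) hm
    (hb.comp ((hX.measurable_up k).prodMk (hX.measurable_down k))) (hX.measurable_w k)
    (fun ω => abs_hit_le _ _) ?_ ((hX.indep_slot k).comp measurable_id hb) (hX.memLp_w k)
    (hX.integral_w k) (hX.integral_w_mul_w hR k) (U := fun a => g a.1) (C := C)
    ((measurable_of_countable g).comp measurable_fst) hC (v := fun a => S.A *ᵥ V a)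
    ((measurable_mulVec S.A).comp hV) (fun i => ?_) i j
  · exact (indepFun_closedLoop hone hX k).comp measurable_id
      (ψ := fun y => (y.1, hit β (f y.2))) (measurable_fst.prodMk (hb.comp measurable_snd))
  · simp only [Matrix.mulVec, dotProduct]
    exact memLp_finsetSum _ fun a _ => (H.memLp a).const_mul _

lemma integral_hit_mul [IsProbabilityMeasure μ] (hone : S.OneStepControllable)
    (hX : X.IsModel μ S s₀) (k : ℕ) (f : Bool × Bool → Bool) (β : Bool) (g : ℕ × ℕ → ℝ) :
    Integrable (fun ω => hit β (f (X.up k ω, X.down k ω)) * g (closedLoop S X s₀ π k ω).1) μ ∧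
    ∫ ω, hit β (f (X.up k ω, X.down k ω)) * g (closedLoop S X s₀ π k ω).1 ∂μ =
      (∫ ω, hit β (f (X.up k ω, X.down k ω)) ∂μ) * ∫ ω, g (closedLoop S X s₀ π k ω).1 ∂μ := by
  have hm := measurable_closedLoop (π := π) hone hX k
  have hfin := finite_range_closedLoop (S := S) (X := X) (s₀ := s₀) (π := π) hone k
  have hb : Measurable fun y : Bool × Bool => hit β (f y) := measurable_of_countable _
  have hbm := hb.comp ((hX.measurable_up k).prodMk (hX.measurable_down k))
  have hI := integrable_comp_of_finite_range (μ := μ) hfin hm.fst g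
  have hind : IndepFun (fun ω => hit β (f (X.up k ω, X.down k ω)))
      (fun ω => g (closedLoop S X s₀ π k ω).1) μ :=
    ((indepFun_closedLoop hone hX k).comp ((measurable_of_countable g).comp measurable_fst)
      (hb.comp measurable_snd)).symm
  exact ⟨hI.bdd_mul hbm.aestronglyMeasurable (Eventually.of_forall fun ω => abs_hit_le _ _),
    hind.integral_fun_mul_eq_mul_integral hbm.aestronglyMeasurable hI.aestronglyMeasurable⟩

lemma integral_hit_link [IsProbabilityMeasure μ] (hS : S.Standing) (hX : X.IsModel μ S s₀) (k : ℕ)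
    (a : Action) (β : Bool) : ∫ ω, hit β (link a (X.up k ω, X.down k ω)) ∂μ =
      match a, β with
      | Action.sensor, true => 1 - S.ps
      | Action.sensor, false => S.ps
      | Action.controller, true => 1 - S.pc
      | Action.controller, false => S.pc := by
  cases a with
  | sensor =>
    refine (integral_comp_bool (hX.measurable_up k) hS.ps_mem.1.le (hX.prob_up k) (hit β)).trans ?_
    cases β <;> simp [hit]
  | controller =>
    refine (integral_comp_bool (hX.measurable_down k) hS.pc_mem.1.le (hX.prob_down k)
      (hit β)).trans ?_
    cases β <;> simp [hit]

section Recursion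

variable [IsProbabilityMeasure μ] (hS : S.Standing) (hone : S.OneStepControllable)
  (hX : X.IsModel μ S s₀)

include hS hone hX

/-- The indicators form a Markov chain with the given transition operator. -/
lemma integral_indicators_succ (k : ℕ) (f : ℕ × ℕ → ℝ) :
    ∫ ω, f (closedLoop S X s₀ π (k + 1) ω).1 ∂μ =
      ∫ ω, transition S.ps S.pc π f (closedLoop S X s₀ π k ω).1 ∂μ := by
  have hm := measurable_closedLoop (π := π) hone hX k
  have hfin := finite_range_closedLoop (S := S) (X := X) (s₀ := s₀) (π := π) hone k
  have hI := integrable_comp_of_finite_range (μ := μ) hfin hm.fst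
  have key := fun a β => integral_hit_mul (π := π) hone hX k (link a) β
    (fun s => chosen π a s * f (nextIndicators a β s))
  have e := fun a β => ((key a β).2.trans (congrArg (· * _) (integral_hit_link hS hX k a β))).trans
    (integral_const_mul _ _).symm
  have j := fun a β (r : ℝ) => (hI fun s => chosen π a s * f (nextIndicators a β s)).const_mul r
  have h1 : (fun ω => f (closedLoop S X s₀ π (k + 1) ω).1) = fun ω => f (nextIndicators
      (π (closedLoop S X s₀ π k ω).1) (link (π (closedLoop S X s₀ π k ω).1)
        (X.up k ω, X.down k ω)) (closedLoop S X s₀ π k ω).1) :=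
    funext fun ω => by rw [closedLoop_succ hone]; rfl
  rw [h1]
  simp only [transition_eq, fun ω => apply_eq_sum_chosen (π := π)
    (fun a β => f (nextIndicators a β (closedLoop S X s₀ π k ω).1))]
  refine (integral_add ((key _ _).1.add (key _ _).1) ((key _ _).1.add (key _ _).1)).trans
    ((congrArg₂ (· + ·)
    ((integral_add (key _ _).1 (key _ _).1).trans (congrArg₂ (· + ·) (e _ _) (e _ _)))
    ((integral_add (key _ _).1 (key _ _).1).trans (congrArg₂ (· + ·) (e _ _) (e _ _)))).trans ?_)
  exact ((integral_add ((j _ _ _).add (j _ _ _)) ((j _ _ _).add (j _ _ _))).trans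
    (congrArg₂ (· + ·) (integral_add (j _ _ _) (j _ _ _))
      (integral_add (j _ _ _) (j _ _ _)))).symm

lemma integral_indicators (k : ℕ) (f : ℕ × ℕ → ℝ) :
    ∫ ω, f (closedLoop S X s₀ π k ω).1 ∂μ = (transition S.ps S.pc π ^ k) f s₀ := by
  induction k generalizing f with
  | zero =>
    have h1 : ∀ ω, (closedLoop S X s₀ π 0 ω).1 = s₀ := fun ω => rfl
    simp [h1]
  | succ k ih =>
    rw [integral_indicators_succ hS hone hX, ih, pow_succ, Module.End.mul_apply]

/-- The second moment of a vector after one slot, when the vector that the plant matrix carries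
over depends on the decision and on whether its transmission is received. -/
lemma hasSecondMoment_succ (k : ℕ)
    {src : Action → Bool → (ℕ × ℕ) × (Fin n → ℝ) × (Fin n → ℝ) → Fin n → ℝ}
    {ψ : Action → Bool → ℕ × ℕ → ℕ} {ψ' : ℕ × ℕ → ℕ} (hsrc : ∀ a β, Measurable (src a β))
    (H : ∀ a β, HasSecondMoment S μ (fun ω => (closedLoop S X s₀ π k ω).1) (ψ a β)
      (fun ω => src a β (closedLoop S X s₀ π k ω)))
    (hψ : ∀ a β s, ψ' (nextIndicators a β s) = ψ a β s + 1) :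
    HasSecondMoment S μ (fun ω => (closedLoop S X s₀ π (k + 1) ω).1) ψ'
      (fun ω => S.A *ᵥ src (π (closedLoop S X s₀ π k ω).1)
        (link (π (closedLoop S X s₀ π k ω).1) (X.up k ω, X.down k ω))
        (closedLoop S X s₀ π k ω) + X.w k ω) := by
  have hR := hS.posDef_R.posSemidef
  have hm := measurable_closedLoop (π := π) hone hX k
  have hh : ∀ a β, Measurable fun ω => hit β (link a (X.up k ω, X.down k ω)) := fun a β =>
    (measurable_of_countable fun y => hit β (link a y)).comp
      ((hX.measurable_up k).prodMk (hX.measurable_down k))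
  have hc : ∀ a, Measurable fun ω => chosen π a (closedLoop S X s₀ π k ω).1 := fun a =>
    (measurable_of_countable (chosen π a)).comp hm.fst
  refine ⟨fun i => ?_, fun g i j => ?_⟩
  · have h1 : ∀ a β, MemLp (fun ω => hit β (link a (X.up k ω, X.down k ω)) *
        (chosen π a (closedLoop S X s₀ π k ω).1 *
          (S.A *ᵥ src a β (closedLoop S X s₀ π k ω) + X.w k ω) i)) 2 μ := fun a β => by
      have h2 : MemLp (fun ω => (S.A *ᵥ src a β (closedLoop S X s₀ π k ω) + X.w k ω) i) 2 μ := by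
        refine MemLp.add ?_ (hX.memLp_w k i)
        simp only [Matrix.mulVec, dotProduct]
        exact memLp_finsetSum _ fun b _ => ((H a β).memLp b).const_mul _
      refine h2.mono (((hh a β).mul (hc a)).aestronglyMeasurable.mul h2.1 |>.congr
        (Eventually.of_forall fun ω => mul_assoc _ _ _)) (Eventually.of_forall fun ω => ?_)
      rw [norm_mul, norm_mul, ← mul_assoc]
      exact mul_le_of_le_one_left (norm_nonneg _)
        (mul_le_one₀ (abs_hit_le _ _) (norm_nonneg _) (abs_chosen_le _ _ _))
    simp only [fun ω => apply_eq_sum_chosen (π := π)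
      (fun a β => (S.A *ᵥ src a β (closedLoop S X s₀ π k ω) + X.w k ω) i)]
    exact ((h1 _ _).add (h1 _ _)).add ((h1 _ _).add (h1 _ _))
  · have key := fun a β => integral_hit_mul_mul hR hone hX k (hsrc a β) (H a β) (link a) β
      (fun s => chosen π a s * g (nextIndicators a β s)) i j
    have key' := fun a β => integral_hit_mul (π := π) hone hX k (link a) β
      (fun s => chosen π a s * (g (nextIndicators a β s) * S.F (ψ' (nextIndicators a β s)) i j))
    have heq : ∀ a β, ∫ ω, hit β (link a (X.up k ω, X.down k ω)) *
        (chosen π a (closedLoop S X s₀ π k ω).1 * g (nextIndicators a β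
          (closedLoop S X s₀ π k ω).1) * ((S.A *ᵥ src a β (closedLoop S X s₀ π k ω) + X.w k ω) i *
        (S.A *ᵥ src a β (closedLoop S X s₀ π k ω) + X.w k ω) j)) ∂μ = _ := fun a β =>
      ((key a β).2.trans (congrArg (_ * ·) (integral_congr_ae (Eventually.of_forall fun ω => by
        simp only [hψ, mul_assoc])))).trans (key' a β).2.symm
    simp only [mul_assoc] at key heq
    have h1 : ∀ ω, (closedLoop S X s₀ π (k + 1) ω).1 = nextIndicators
        (π (closedLoop S X s₀ π k ω).1) (link (π (closedLoop S X s₀ π k ω).1)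
          (X.up k ω, X.down k ω)) (closedLoop S X s₀ π k ω).1 := fun ω => by
      rw [closedLoop_succ hone]; rfl
    -- both sides split into four products with equal integrals
    simp only [h1, fun ω => apply_eq_sum_chosen (π := π) (fun a β =>
        g (nextIndicators a β (closedLoop S X s₀ π k ω).1) *
          ((S.A *ᵥ src a β (closedLoop S X s₀ π k ω) + X.w k ω) i *
            (S.A *ᵥ src a β (closedLoop S X s₀ π k ω) + X.w k ω) j)),
      fun ω => apply_eq_sum_chosen (π := π) (fun a β =>
        g (nextIndicators a β (closedLoop S X s₀ π k ω).1) *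
          S.F (ψ' (nextIndicators a β (closedLoop S X s₀ π k ω).1)) i j)]
    refine (integral_add ((key _ _).1.add (key _ _).1) ((key _ _).1.add (key _ _).1)).trans
      ((congrArg₂ (· + ·)
      ((integral_add (key _ _).1 (key _ _).1).trans (congrArg₂ (· + ·) (heq _ _) (heq _ _)))
      ((integral_add (key _ _).1 (key _ _).1).trans
        (congrArg₂ (· + ·) (heq _ _) (heq _ _)))).trans ?_)
    exact ((integral_add ((key' _ _).1.add (key' _ _).1) ((key' _ _).1.add (key' _ _).1)).trans
      (congrArg₂ (· + ·) (integral_add (key' _ _).1 (key' _ _).1)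
        (integral_add (key' _ _).1 (key' _ _).1))).symm

/-- Second moments of the plant state and of the estimation error, given the indicators. -/
lemma hasSecondMoment_closedLoop (k : ℕ) :
    HasSecondMoment S μ (fun ω => (closedLoop S X s₀ π k ω).1) Prod.snd
      (fun ω => (closedLoop S X s₀ π k ω).2.1) ∧
    HasSecondMoment S μ (fun ω => (closedLoop S X s₀ π k ω).1) Prod.fst
      (fun ω => (closedLoop S X s₀ π k ω).2.2) := by
  induction k with
  | zero =>
    have hx : ∀ i, MemLp (fun ω => X.x₀ ω i) 2 μ := fun i => (memLp_pi_iff.1 hX.memLp_x₀) i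
    have hxh : ∀ i, MemLp (fun ω => X.xhat₀ ω i) 2 μ := fun i => (memLp_pi_iff.1 hX.memLp_xhat₀) i
    refine ⟨⟨hx, fun g i j => ?_⟩, ⟨fun i => (hx i).sub (hxh i), fun g i j => ?_⟩⟩
    · change ∫ ω, g s₀ * (X.x₀ ω i * X.x₀ ω j) ∂μ = ∫ ω, g s₀ * S.F s₀.2 i j ∂μ
      rw [integral_const_mul, hX.cov_x₀]
      simp
    · change ∫ ω, g s₀ * ((X.x₀ ω i - X.xhat₀ ω i) * (X.x₀ ω j - X.xhat₀ ω j)) ∂μ =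
        ∫ ω, g s₀ * S.F s₀.1 i j ∂μ
      rw [integral_const_mul, hX.cov_e₀]
      simp
  | succ k ih =>
    obtain ⟨Hx, He⟩ := ih
    have H0 := hasSecondMoment_zero (S := S) (μ := μ) fun ω => (closedLoop S X s₀ π k ω).1
    constructor
    · have := hasSecondMoment_succ hS hone hX (π := π) k (src := plantSource)
        (ψ := fun a β s => match a, β with
          | Action.controller, true => s.1
          | _, _ => s.2) (ψ' := Prod.snd) measurable_plantSource
        (fun a β => by cases a <;> cases β <;> assumption)
        (fun a β s => by cases a <;> cases β <;> rfl)
      convert this using 2 with ω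
      rw [closedLoop_succ hone]
      rfl
    · have := hasSecondMoment_succ hS hone hX (π := π) k (src := errorSource)
        (ψ := fun a β s => match a, β with
          | Action.sensor, true => 0
          | _, _ => s.1) (ψ' := Prod.fst) measurable_errorSource
        (fun a β => by cases a <;> cases β <;> assumption)
        (fun a β s => by cases a <;> cases β <;> rfl)
      convert this using 2 with ω
      rw [closedLoop_succ hone]
      rfl

end Recursion

end SecondMoments

/-! ### The average cost of a stationary rule -/

section Cost

variable {Ω : Type*} [MeasurableSpace Ω] {n m : ℕ} {S : System n m} {X : Primitives Ω n}
  {s₀ : ℕ × ℕ} {μ : Measure Ω} [IsProbabilityMeasure μ]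

/-- The cost at time `k` is an expectation over the indicator chain, because the plant state has
second moment `F (φ)` given the indicators. -/
theorem stageCost_stationary (hS : S.Standing) (hone : S.OneStepControllable)
    (hX : X.IsModel μ S s₀) (π : ℕ × ℕ → Action) (k : ℕ) :
    stageCost S X μ s₀ (stationary π) k =
      ENNReal.ofReal ((transition S.ps S.pc π ^ k) (fun s => S.cost s.2) s₀) := by
  have hm := measurable_closedLoop (π := π) hone hX k
  have hfin := finite_range_closedLoop (S := S) (X := X) (s₀ := s₀) (π := π) hone k
  have H := (hasSecondMoment_closedLoop (π := π) hS hone hX k).1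
  have i1 : ∀ i j, Integrable (fun ω => S.Q i j * (1 *
      ((closedLoop S X s₀ π k ω).2.1 j * (closedLoop S X s₀ π k ω).2.1 i))) μ := fun i j =>
    (H.integrable hfin hm.fst (fun _ => 1) j i).const_mul _
  have i2 : ∀ i j, Integrable (fun ω => S.Q i j *
      (1 * S.F (closedLoop S X s₀ π k ω).1.2 j i)) μ := fun i j =>
    (integrable_comp_of_finite_range hfin hm.fst fun s => 1 * S.F s.2 j i).const_mul _
  have hx : ∀ x : Fin n → ℝ, x ⬝ᵥ (S.Q *ᵥ x) = ∑ i, ∑ j, S.Q i j * (1 * (x j * x i)) := fun x => by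
    simp only [dotProduct, Matrix.mulVec, Finset.mul_sum]
    exact Finset.sum_congr rfl fun i _ => Finset.sum_congr rfl fun j _ => by ring
  have hF : ∀ φ, S.cost φ = ∑ i, ∑ j, S.Q i j * (1 * S.F φ j i) := fun φ => by
    simp only [System.cost, Matrix.trace, Matrix.diag_apply, Matrix.mul_apply, one_mul]
  rw [← integral_indicators hS hone hX]
  change ∫⁻ ω, ENNReal.ofReal ((closedLoop S X s₀ π k ω).2.1 ⬝ᵥ
    (S.Q *ᵥ (closedLoop S X s₀ π k ω).2.1)) ∂μ = _
  rw [← ofReal_integral_eq_lintegral_ofReal]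
  · congr 1
    simp only [hx, hF]
    rw [integral_finsetSum _ fun i _ => integrable_finsetSum _ fun j _ => i1 i j,
      integral_finsetSum _ fun i _ => integrable_finsetSum _ fun j _ => i2 i j]
    refine Finset.sum_congr rfl fun i _ => ?_
    rw [integral_finsetSum _ fun j _ => i1 i j, integral_finsetSum _ fun j _ => i2 i j]
    refine Finset.sum_congr rfl fun j _ => ?_
    exact (integral_const_mul _ _).trans ((congrArg (S.Q i j * ·)
      (H.integral_eq (fun _ => 1) j i)).trans (integral_const_mul _ _).symm)
  · simp only [hx]
    exact integrable_finsetSum _ fun i _ => integrable_finsetSum _ fun j _ => i1 i j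
  · exact Eventually.of_forall fun ω => by
      simpa using hS.posDef_Q.posSemidef.dotProduct_mulVec_nonneg (closedLoop S X s₀ π k ω).2.1

lemma averageCost_stationary (hS : S.Standing) (hone : S.OneStepControllable)
    (hX : X.IsModel μ S s₀) (π : ℕ × ℕ → Action)
    (hnn : ∀ k, 0 ≤ (transition S.ps S.pc π ^ k) (fun s => S.cost s.2) s₀) :
    averageCost S X μ s₀ (stationary π) = limsup (fun N : ℕ => ENNReal.ofReal
      (∑ k ∈ Finset.range N, (transition S.ps S.pc π ^ k) (fun s => S.cost s.2) s₀) /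
        (N : ℝ≥0∞)) atTop := by
  simp only [averageCost, stageCost_stationary hS hone hX,
    ENNReal.ofReal_sum_of_nonneg fun k _ => hnn k]

lemma limsup_ofReal_div_le {u : ℕ → ℝ} {g b : ℝ} (h : ∀ N : ℕ, u N ≤ N * g + b) :
    limsup (fun N : ℕ => ENNReal.ofReal (u N) / (N : ℝ≥0∞)) atTop ≤ ENNReal.ofReal g := by
  have h1 : Tendsto (fun N : ℕ => ENNReal.ofReal (g + |b| / N)) atTop
      (nhds (ENNReal.ofReal g)) := by
    refine ENNReal.tendsto_ofReal ?_
    simpa using (tendsto_const_nhds (x := g)).add (tendsto_const_div_atTop_nhds_zero_nat |b|)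
  rw [← h1.limsup_eq]
  refine limsup_le_limsup ?_
  filter_upwards [eventually_gt_atTop 0] with N hN
  have hN' : (0 : ℝ) < N := by exact_mod_cast hN
  rw [← ENNReal.ofReal_natCast, ← ENNReal.ofReal_div_of_pos hN']
  refine ENNReal.ofReal_le_ofReal ?_
  rw [div_le_iff₀ hN', add_mul, div_mul_cancel₀ _ hN'.ne']
  linarith [h N, le_abs_self b]

lemma eventually_le_of_limsup_le {u : ℕ → ℝ} {g ε : ℝ} (hg : 0 ≤ g) (hε : 0 < ε)
    (h : limsup (fun N : ℕ => ENNReal.ofReal (u N) / (N : ℝ≥0∞)) atTop ≤ ENNReal.ofReal g) :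
    ∀ᶠ N : ℕ in atTop, u N ≤ (g + ε) * N := by
  have h1 : ENNReal.ofReal g < ENNReal.ofReal (g + ε) :=
    (ENNReal.ofReal_lt_ofReal_iff (by linarith)).2 (by linarith)
  filter_upwards [eventually_lt_of_limsup_lt (h.trans_lt h1), eventually_gt_atTop 0] with N hN hN0
  have hN' : (0 : ℝ) < N := by exact_mod_cast hN0
  rw [← ENNReal.ofReal_natCast, ← ENNReal.ofReal_div_of_pos hN',
    ENNReal.ofReal_lt_ofReal_iff (by linarith), div_lt_iff₀ hN'] at hN
  exact hN.le

end Cost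

end HalfDuplex

end

theorem proposition2 {n m : ℕ} (S : HalfDuplex.System n m) (hS : S.Standing)
    (hone : S.OneStepControllable) (hstab : S.Stabilizable)
    {Ω : Type*} [MeasurableSpace Ω] (μ : Measure Ω) [IsProbabilityMeasure μ]
    (X : HalfDuplex.Primitives Ω n) (s₀ : ℕ × ℕ) (hs₀ : s₀ ∈ HalfDuplex.stateSpace)
    (hX : X.IsModel μ S s₀) (π : ℕ × ℕ → HalfDuplex.Action)
    (hπ : HalfDuplex.IsOptimal S X μ s₀ (HalfDuplex.stationary π)) :
    (∀ τ φ z : ℕ, (τ, φ) ∈ HalfDuplex.stateSpace → π (τ, φ) = HalfDuplex.Action.sensor →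
      0 < z → (τ + z, φ) ∈ HalfDuplex.stateSpace →
        π (τ + z, φ) = HalfDuplex.Action.sensor) ∧
    (∀ τ φ z : ℕ, (τ, φ) ∈ HalfDuplex.stateSpace → π (τ, φ) = HalfDuplex.Action.controller →
      0 < z → (τ, φ + z) ∈ HalfDuplex.stateSpace →
        π (τ, φ + z) = HalfDuplex.Action.controller) := by
  obtain ⟨δ, r, C, hc⟩ := S.exists_costBounds hS hstab
  obtain ⟨g, K, h, hg, H⟩ := hc.exists_optimality_equation
  obtain ⟨π', hπ'⟩ := H.exists_greedy hc
  have hnn : ∀ (π : ℕ × ℕ → HalfDuplex.Action) (k : ℕ),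
      0 ≤ (HalfDuplex.transition S.ps S.pc π ^ k) (fun s => S.cost s.2) s₀ := fun π k =>
    HalfDuplex.transition_pow_nonneg hc.ps_mem hc.pc_mem k (fun s _ => hc.nonneg s.2) hs₀
  refine H.switching hc hg hs₀ fun ε hε => HalfDuplex.eventually_le_of_limsup_le hg hε ?_
  have h1 := hπ (HalfDuplex.stationary π')
  rw [HalfDuplex.averageCost_stationary hS hone hX π (hnn π),
    HalfDuplex.averageCost_stationary hS hone hX π' (hnn π')] at h1
  exact h1.trans (HalfDuplex.limsup_ofReal_div_le fun N => hπ' s₀ hs₀ N)
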